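/- Let $V$ be a finite set and let $x$ be a feasible half-integral point of the Held–Karp relaxation: $x_{\{u,v\}}\in\{0,\tfrac12,1\}$, $\sum_{v}x_{\{u,v\}}=2$ for every $u\in V$, and $x(\delta(S))\ge 2$ for every $\emptyset\ne S\subsetneq V$. Let $G=(V,E)$ be its support graph, with one edge for each pair of value $\tfrac12$ and two parallel edges for each pair of value $1$ (so $G$ is 4-regular and 4-edge-connected), and let $e^+\in E$ be an edge whose pair of endpoints has value $1$. In $G$ and in its contractions a vertex set $S$ is *tight* if $|\delta(S)|=4$; it is *proper* if $S$ and its complement each contain at least two vertices; two sets $S,S'$ *cross* if $S\setminus S'$, $S'\setminus S$, $S\cap S'$ and the complement of $S\cup S'$ are all nonempty. *Algorithm.* While the current graph has a proper tight set that is not crossed by a tight set, select an inclusion-minimal such set $S$ with $e^+\notin E(S)$, sample a spanning tree on $S$ (in the current graph) from the maximum entropy distribution ($\Pr[F]\propto\prod_{e\in F}\lambda_e$ for some nonnegative weights $\lambda$) whose marginals are exactly $\tfrac12$ on the edges inside $S$, and contract $S$. When no such set is left, sample uniformly a cycle through all the remaining vertices that contains $e^+$. All samples are independent, and $T$ is the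 union of the sampled edge sets. *Critical sets* are the selected sets (viewed as subsets of $V$) and, as degenerate cases, the single vertices. They form a hierarchy whose root is $V$: the children (nodes) of a member $R$ are the maximal critical sets strictly inside $R$. For an edge $e=\{u,v\}$ let $S_{u}$ be the highest (inclusion-largest) critical set that contains $u$ and not $v$, define $S_v$ symmetrically, and let $S_e$ be the lowest member of the hierarchy (possibly the root $V$) that has both $S_u$ and $S_v$ as nodes. Let $G_e$ be the graph obtained from $G$ by contracting every node of $S_e$ and, if $S_e\neq V$, contracting $V\setminus S_e$ to one further vertex. The edge $e$ is a *bottom edge* if $G_e$ is a cycle of length at least $3$ with exactly two parallel edges between consecutive vertices and no other edges, and a *top edge* otherwise. A cut is *even* in $T$ if it contains an even number of edges of $T$. A bottom edge $e$ is *even at last* if all minimum cuts of $G_e$ that contain $e$ are even in $T$; a top edge $e$ is *even at last* if $\delta(S_u)$ and $\delta(S_v)$ are both even in $T$. **Lemma.** For every execution of the algorithm and every critical set $S$, there is an edge $e\in\delta(S)$ such that $$\Pr[e\text{ is even at last}]\ \ge\ \frac1{27}.$$ -/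

import Mathlib

open scoped ENNReal NNReal

namespace HalfIntegralTSP

section LP

variable {V E : Type*} [Fintype V] [DecidableEq V] [Fintype E]

/-- A half-integral feasible point of the Held-Karp (subtour elimination) relaxation. The value at a
diagonal element of `Sym2 V` is `0`, so that `x` is a function on unordered pairs of distinct
vertices. -/
structure IsHalfIntegralHeldKarp (x : Sym2 V → ℝ) : Prop where
  half : ∀ p, x p = 0 ∨ x p = 1 / 2 ∨ x p = 1
  diag : ∀ v, x s(v, v) = 0
  degree : ∀ v, ∑ w, x s(v, w) = 2
  subtour : ∀ S : Finset V, S.Nonempty → S ≠ Finset.univ → 2 ≤ ∑ u ∈ S, ∑ w ∈ Sᶜ, x s(u, w)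

/-- The multigraph with edge set `E` and endpoint map `ends` is the support graph of `x`: one edge
for each pair of value `1/2`, two parallel edges for each pair of value `1`. -/
def IsSupportGraph (x : Sym2 V → ℝ) (ends : E → Sym2 V) : Prop :=
  ∀ p, ((Finset.univ.filter fun e => ends e = p).card : ℝ) = 2 * x p

end LP

section Multigraph

variable {V E : Type*} [Fintype V] [DecidableEq V] [Fintype E] [DecidableEq E]

/-- The edge `e` joins the vertex sets `A` and `B`. -/
def Joins (ends : E → Sym2 V) (A B : Finset V) (e : E) : Prop :=
  ∃ a ∈ A, ∃ b ∈ B, ends e = s(a, b)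

instance (ends : E → Sym2 V) (A B : Finset V) : DecidablePred (Joins ends A B) :=
  fun e => inferInstanceAs (Decidable (∃ a ∈ A, ∃ b ∈ B, ends e = s(a, b)))

/-- The cut `δ(S)`. -/
def cut (ends : E → Sym2 V) (S : Finset V) : Finset E :=
  Finset.univ.filter (Joins ends S Sᶜ)

/-- `E(S)`: the edges with both endpoints in `S`. -/
def edgesIn (ends : E → Sym2 V) (S : Finset V) : Finset E :=
  Finset.univ.filter (Joins ends S S)

/-- `S` is tight. The support graph is 4-edge-connected and 4-regular, so that
minimum cuts have exactly four edges. -/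
def IsTight (ends : E → Sym2 V) (S : Finset V) : Prop := (cut ends S).card = 4

/-- The sets `S` and `S'` cross. -/
def Crosses (S S' : Finset V) : Prop :=
  (S \ S').Nonempty ∧ (S' \ S).Nonempty ∧ (S ∩ S').Nonempty ∧ (S ∪ S')ᶜ.Nonempty

/-- Contracted graphs are given by a family `N` of disjoint vertex sets, each of which is
contracted to one node. A set of nodes is identified with the union of its members, that is, with a
vertex set that contains or avoids each node. -/
def IsNodeSet (N : Finset (Finset V)) (X : Finset V) : Prop := ∀ A ∈ N, A ⊆ X ∨ Disjoint A X

/-- At least two nodes lie on each side of the cut. -/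
def IsProper (N : Finset (Finset V)) (X : Finset V) : Prop :=
  2 ≤ (N.filter fun A => A ⊆ X).card ∧ 2 ≤ (N.filter fun A => Disjoint A X).card

/-- The edges that join two different nodes of `N`. -/
def edgesBetween (ends : E → Sym2 V) (N : Finset (Finset V)) : Finset E :=
  Finset.univ.filter fun e => ∃ A ∈ N, ∃ B ∈ N, A ≠ B ∧ Joins ends A B e

/-- Adjacency of nodes through the edges in `F`. -/
def nodeGraph (ends : E → Sym2 V) (N : Finset (Finset V)) (F : Finset E) :
    SimpleGraph {A // A ∈ N} :=
  SimpleGraph.fromRel fun A B => ∃ e ∈ F, Joins ends A.1 B.1 e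

/-- `F` is the edge set of a spanning tree of the multigraph on the node set `N`. -/
def IsSpanningTree (ends : E → Sym2 V) (N : Finset (Finset V)) (F : Finset E) : Prop :=
  F ⊆ edgesBetween ends N ∧ (nodeGraph ends N F).Connected ∧ F.card + 1 = N.card

/-- `F` is the edge set of a cycle through all nodes of `N`. -/
def IsSpanningCycle (ends : E → Sym2 V) (N : Finset (Finset V)) (F : Finset E) : Prop :=
  F ⊆ edgesBetween ends N ∧ (nodeGraph ends N F).Connected ∧
    ∀ A ∈ N, (F ∩ cut ends A).card = 2

/-- The multigraph on the node set `N` is a cycle of length at least three, with exactly two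
parallel edges between consecutive nodes and no other edges. -/
def IsDoubledCycle (ends : E → Sym2 V) (N : Finset (Finset V)) : Prop :=
  ∃ m : ℕ, 3 ≤ m ∧ ∃ f : ZMod m → Finset V, Function.Injective f ∧ Set.range f = (N : Set (Finset V)) ∧
    ∀ i j, i ≠ j → (Finset.univ.filter (Joins ends (f i) (f j))).card =
      if j = i + 1 ∨ i = j + 1 then 2 else 0

end Multigraph

section Algorithm

variable {V E : Type*} [Fintype V] [DecidableEq V] [Fintype E] [DecidableEq E]

/-- The critical sets: the sets selected so far, listed in `L` with the most recent one first, and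
the single vertices as degenerate critical sets. -/
def criticalSets (L : List (Finset V)) : Finset (Finset V) :=
  L.toFinset ∪ Finset.univ.image fun v => {v}

/-- The nodes inside `R`: the critical sets strictly inside `R` that are maximal with this property,
that is, the children of `R` in the hierarchy. -/
def nodesIn (L : List (Finset V)) (R : Finset V) : Finset (Finset V) :=
  (criticalSets L).filter fun A => A ⊂ R ∧ ∀ B ∈ criticalSets L, A ⊂ B → ¬ B ⊂ R

/-- The nodes of the graph that remains after the sets in `L` have been contracted. -/
def currentNodes (L : List (Finset V)) : Finset (Finset V) := nodesIn L Finset.univ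

/-- In the graph that remains after the contractions in `L`, the set `S` is a proper tight set that
is not crossed by a tight set. -/
def IsUncrossedProperTight (ends : E → Sym2 V) (L : List (Finset V)) (S : Finset V) : Prop :=
  IsNodeSet (currentNodes L) S ∧ IsProper (currentNodes L) S ∧ IsTight ends S ∧
    ∀ X, IsNodeSet (currentNodes L) X → IsTight ends X → ¬ Crosses S X

/-- `L` lists the sets selected in the first iterations of the while loop: each one is, in the graph
that remained at its time, an inclusion-minimal uncrossed proper tight set `S` with `e⁺ ∉ E(S)`. -/
def IsRun (ends : E → Sym2 V) (ePlus : E) : List (Finset V) → Prop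
  | [] => True
  | S :: L => IsRun ends ePlus L ∧
      Minimal (fun S' => IsUncrossedProperTight ends L S' ∧ ePlus ∉ edgesIn ends S') S

/-- `L` lists the sets selected in a complete execution of the while loop. -/
def IsExecution (ends : E → Sym2 V) (ePlus : E) (L : List (Finset V)) : Prop :=
  IsRun ends ePlus L ∧ ¬ ∃ S, IsUncrossedProperTight ends L S

/-- `μ` is the maximum entropy (`λ`-uniform) distribution on the spanning trees of the multigraph on
the node set `N` with marginals `1/2`, the value of `x` on each edge of the support graph. -/
structure IsMaxEntropyTree (ends : E → Sym2 V) (N : Finset (Finset V)) (μ : PMF (Finset E)) :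
    Prop where
  uniform : ∃ (w : E → ℝ≥0) (c : ℝ≥0), ∀ F,
    (IsSpanningTree ends N F → μ F = ((c * ∏ e ∈ F, w e : ℝ≥0) : ℝ≥0∞)) ∧
    (¬ IsSpanningTree ends N F → μ F = 0)
  marginal : ∀ e ∈ edgesBetween ends N, μ.toOuterMeasure {F | e ∈ F} = 1 / 2

/-- `ν` is the uniform distribution on the spanning cycles through `e⁺` of the multigraph on the
node set `N`. -/
def IsUniformCycle (ends : E → Sym2 V) (N : Finset (Finset V)) (ePlus : E)
    (ν : PMF (Finset E)) : Prop :=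
  ∃ c : ℝ≥0∞, ∀ F,
    (IsSpanningCycle ends N F ∧ ePlus ∈ F → ν F = c) ∧
    (¬ (IsSpanningCycle ends N F ∧ ePlus ∈ F) → ν F = 0)

/-- The union of trees sampled independently from `μ S`, for the sets `S` in the list. -/
noncomputable def treesLaw (μ : Finset V → PMF (Finset E)) :
    List (Finset V) → PMF (Finset E)
  | [] => PMF.pure ∅
  | S :: L => (treesLaw μ L).bind fun T => (μ S).bind fun T' => PMF.pure (T ∪ T')

/-- The law of the random 1-tree `T`: the sampled trees together with an independent sample of the
final cycle. -/
noncomputable def oneTreeLaw (μ : Finset V → PMF (Finset E)) (ν : PMF (Finset E))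
    (L : List (Finset V)) : PMF (Finset E) :=
  (treesLaw μ L).bind fun T => ν.bind fun C => PMF.pure (T ∪ C)

end Algorithm

section EvenAtLast

variable {V E : Type*} [Fintype V] [DecidableEq V] [Fintype E] [DecidableEq E]

/-- `S = S_{u,e}` for `e = {u,v}`: the highest critical set that contains `u` and not `v`. -/
def IsHighest (L : List (Finset V)) (u v : V) (S : Finset V) : Prop :=
  IsGreatest {S' : Finset V | S' ∈ criticalSets L ∧ u ∈ S' ∧ v ∉ S'} S

/-- The lowest member `R` of the hierarchy (a selected set, or the root `V`) such that `A` and `B`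
are both nodes of `R`. -/
def IsLowestCommon (L : List (Finset V)) (A B R : Finset V) : Prop :=
  IsLeast {R' : Finset V | (R' ∈ L ∨ R' = Finset.univ) ∧ A ∈ nodesIn L R' ∧ B ∈ nodesIn L R'} R

/-- The nodes of the multigraph on `R` with `V ∖ R` contracted to one further node; the latter is
absent for the root `R = V`. -/
def localNodes (L : List (Finset V)) (R : Finset V) : Finset (Finset V) :=
  (insert Rᶜ (nodesIn L R)).erase ∅

/-- The cut `δ(X)` is even in `T`. -/
def IsEvenCut (ends : E → Sym2 V) (T : Finset E) (X : Finset V) : Prop :=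
  Even (T ∩ cut ends X).card

/-- The edge `e = {u,v}` is even at last in `T`. Let `R = S_e`. If the local graph on `R` is a cycle
(`e` is a bottom edge), all minimum cuts of that cycle that contain `e` are even; otherwise (`e` is
a top edge) the critical cuts of `S_{u,e}` and `S_{v,e}` are both even. -/
def EvenAtLast (ends : E → Sym2 V) (L : List (Finset V)) (e : E) (T : Finset E) : Prop :=
  ∃ u v Su Sv R, ends e = s(u, v) ∧ IsHighest L u v Su ∧ IsHighest L v u Sv ∧
    IsLowestCommon L Su Sv R ∧
    (IsDoubledCycle ends (localNodes L R) →
      ∀ X, IsNodeSet (localNodes L R) X → IsTight ends X → e ∈ cut ends X →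
        IsEvenCut ends T X) ∧
    (¬ IsDoubledCycle ends (localNodes L R) → IsEvenCut ends T Su ∧ IsEvenCut ends T Sv)

end EvenAtLast

end HalfIntegralTSP

set_option linter.unusedSectionVars false

/-! Let `R` be the parent of a critical set `S` in the hierarchy. Every edge belongs to a single
level, so, conditioned on all samples at other levels, the tree inside a selected `R` is a fresh
weighted spanning tree with marginals `1/2`, and the edges leaving `R` only prescribe the parities
it has to realize. Two tools control such a tree. Weighted spanning trees have the Rayleigh
property, even when one edge is forced in and another is forced out; with all marginals `1/2` this
bounds from below the traces of the tree on the three or four edges at a node (`four_edges`,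
`three_edges_mem`, `three_edges_of_max`). Moreover, exchanging an edge at a node for a heavier one
at the same node does not decrease the weight of the tree (`exists_exchange`,
`prob_le_of_exchange`).

The local graph of `R` has little freedom. Since `R` was chosen inclusion-minimal, every proper
minimum cut of this graph is crossed (`allCrossed_localNodes`). Uncrossing shows that a double edge
at a node forces a second double edge there, and connectivity then gives a dichotomy: all
multiplicities are at most one, or all are zero or two (`dichotomy`).

In the simple case, let `e` be the heaviest edge of the level at `S` and `B` its other end. With
probability at least `1/9`, `e` is absent and the degree at `S` has the prescribed parity.
Exchanging `e` in keeps this degree and flips the parity at `B`; at most three edges can be the one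
exchanged out, so both parities are right with probability at least `1/27` (`prob_two_parities`).

In the doubled case, the tree contains exactly one edge of every parallel pair inside `R`. Hence all
cuts of the local graph are even as soon as exactly one edge of each of the two pairs leaving `R` is
sampled. These four edges form a critical cut one level higher, where their pairing is arbitrary;
`prob_exactly_one_of_each_pair` bounds the probability by distinguishing which of them belong to
that level and climbing the hierarchy for the others.

The final graph is doubled too, because `e⁺` has a parallel edge that is never contracted. There the
sampled cycle has degree two at every node, so all node cuts are even with certainty. -/

namespace HalfIntegralTSP

/-! ### Determinants of weighted Gram matrices -/

section CauchyBinet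

open Matrix

variable {n E R : Type*} [Fintype n] [DecidableEq n] [Fintype E] [DecidableEq E] [CommRing R]

/-- The weighted Gram matrix of a family of vectors. -/
def gram (b : E → n → R) (w : E → R) : Matrix n n R := ∑ e, w e • vecMulVec (b e) (b e)

/-- Row `i` of the Gram matrix is the combination of the vectors `b e` with coefficients `w e * b e
i`; expanding multilinearly in the rows chooses one index `g i` per row. -/
theorem det_gram_eq_sum_functions (b : E → n → R) (w : E → R) :
    (gram b w).det =
      ∑ g : n → E, (∏ i, w (g i)) * (Matrix.of fun i => b (g i) i • b (g i)).det := by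
  have h : gram b w = fun i => ∑ e, (w e • (b e i • b e) : n → R) := by
    funext i; ext j
    simp [gram, Matrix.sum_apply, vecMulVec_apply]
  have h1 : (gram b w).det = detRowAlternating (fun i => ∑ e, (w e • (b e i • b e) : n → R)) := by
    rw [h]; rfl
  rw [h1]
  have h2 := MultilinearMap.map_sum (detRowAlternating (n := n) (R := R)).toMultilinearMap
    (fun i e => (w e • (b e i • b e) : n → R))
  refine h2.trans (Finset.sum_congr rfl fun g _ => ?_)
  exact (MultilinearMap.map_smul_univ (detRowAlternating (n := n) (R := R)).toMultilinearMap
    (fun i => w (g i)) (fun i => b (g i) i • b (g i)))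

theorem det_rows_eq_zero_of_not_injective (b : E → n → R) (g : n → E)
    (hg : ¬ Function.Injective g) :
    (Matrix.of fun i => b (g i) i • b (g i)).det = 0 := by
  simp only [Function.Injective, not_forall] at hg
  obtain ⟨i, j, hij, hne⟩ := hg
  have h := MultilinearMap.map_smul_univ (detRowAlternating (n := n) (R := R)).toMultilinearMap
    (fun i => b (g i) i) (fun i => b (g i))
  refine h.trans ?_
  have h0 : (detRowAlternating (n := n) (R := R)) (fun i => b (g i)) = 0 :=
    AlternatingMap.map_eq_zero_of_eq _ _ (by simp [hij]) hne
  erw [h0]; simp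

/-- A form of the **Cauchy–Binet formula**. -/
theorem det_gram (b : E → n → R) (w : E → R) :
    (gram b w).det = ∑ F ∈ Finset.powersetCard (Fintype.card n) Finset.univ,
      (∏ e ∈ F, w e) * (gram b fun e => if e ∈ F then 1 else 0).det := by
  classical
  set c : (n → E) → R := fun g => (Matrix.of fun i => b (g i) i • b (g i)).det with hc
  have key : ∀ v : E → R, (gram b v).det =
      ∑ g ∈ Finset.univ.filter (fun g : n → E => Function.Injective g),
        (∏ i, v (g i)) * c g := by
    intro v
    rw [det_gram_eq_sum_functions, Finset.sum_filter_of_ne]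
    intro g _ h
    by_contra hg
    exact h (by simp only [hc]; rw [det_rows_eq_zero_of_not_injective b g hg, mul_zero])
  have him : ∀ g : n → E, Function.Injective g →
      (Finset.univ.image g).card = Fintype.card n := fun g hg => by
    rw [Finset.card_image_of_injective _ hg, Finset.card_univ]
  rw [key w, ← Finset.sum_fiberwise_of_maps_to
    (t := Finset.powersetCard (Fintype.card n) Finset.univ) (g := fun g => Finset.univ.image g)
    (fun g hg => Finset.mem_powersetCard.2 ⟨Finset.subset_univ _, him g (by simpa using hg)⟩)]
  refine Finset.sum_congr rfl fun F hF => ?_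
  have hFc := (Finset.mem_powersetCard.1 hF).2
  -- With indicator weights only the injective choices with image `F` survive, each with weight one,
  -- so the right-hand side is the same fibre sum with its common factor pulled out.
  rw [key, Finset.mul_sum, ← Finset.sum_filter_of_ne (s := Finset.univ.filter _)
    (p := fun g : n → E => Finset.univ.image g = F)]
  · refine Finset.sum_congr rfl fun g hg => ?_
    simp only [Finset.mem_filter, Finset.mem_univ, true_and] at hg
    obtain ⟨hi, rfl⟩ := hg
    have h1 : ∏ i, (if g i ∈ Finset.univ.image g then (1 : R) else 0) = 1 :=
      Finset.prod_eq_one fun i _ => by simp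
    rw [h1, one_mul, Finset.prod_image (fun x _ y _ h => hi h)]
  · intro g hg h
    simp only [Finset.mem_filter, Finset.mem_univ, true_and] at hg
    refine Finset.eq_of_subset_of_card_le (fun e he => ?_) (by rw [hFc, him g hg])
    obtain ⟨i, -, rfl⟩ := Finset.mem_image.1 he
    by_contra hgi
    exact h (by rw [Finset.prod_eq_zero (Finset.mem_univ i) (by simp [hgi])]; simp)

theorem gram_transpose (b : E → n → R) (w : E → R) : (gram b w)ᵀ = gram b w := by
  ext i j
  simp [gram, Matrix.sum_apply, vecMulVec_apply, mul_comm]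

/-- The matrix determinant lemma for an update of rank two. Symmetry of `A` makes the two
off-diagonal entries of the resulting two-by-two matrix equal, which produces the square. -/
theorem det_add_two (A : Matrix n n R) (hA : Aᵀ = A) (hd : IsUnit A.det) (u v : n → R) :
    (A + vecMulVec u u + vecMulVec v v).det =
      A.det * ((1 + u ⬝ᵥ A⁻¹ *ᵥ u) * (1 + v ⬝ᵥ A⁻¹ *ᵥ v) - (u ⬝ᵥ A⁻¹ *ᵥ v) ^ 2) := by
  have hU : A + vecMulVec u u + vecMulVec v v =
      A + (Matrix.of ![u, v])ᵀ * (Matrix.of ![u, v]) := by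
    ext i j
    simp [Matrix.mul_apply, Fin.sum_univ_two, vecMulVec_apply, add_assoc]
  have hent : ∀ i j, ((Matrix.of ![u, v]) * A⁻¹ * (Matrix.of ![u, v])ᵀ) i j =
      (![u, v] i) ⬝ᵥ A⁻¹ *ᵥ (![u, v] j) := by
    intro i j
    rw [Matrix.mul_assoc, Matrix.mul_apply']
    congr 1
  have hsymm : v ⬝ᵥ A⁻¹ *ᵥ u = u ⬝ᵥ A⁻¹ *ᵥ v := by
    rw [dotProduct_mulVec, dotProduct_comm, ← mulVec_transpose, transpose_nonsing_inv, hA]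
  rw [hU, det_add_mul _ _ hd, det_fin_two]
  simp only [Matrix.add_apply, hent]
  simp [hsymm]
  ring

/-- For invertible `A`, the right side minus the left side is the square of `A.det * (u ⬝ᵥ A⁻¹ *ᵥ
v)`. For singular `A` the left side vanishes, and the sign assumptions settle the right side. -/
theorem rayleigh_det (A : Matrix n n ℝ) (hA : Aᵀ = A) (u v : n → ℝ)
    (hu : 0 ≤ (A + vecMulVec u u).det) (hv : 0 ≤ (A + vecMulVec v v).det) :
    ((A + vecMulVec u u + vecMulVec v v).det - (A + vecMulVec u u).det
      - (A + vecMulVec v v).det + A.det) * A.det ≤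
    ((A + vecMulVec u u).det - A.det) * ((A + vecMulVec v v).det - A.det) := by
  by_cases hd : A.det = 0
  · rw [hd]; simpa using mul_nonneg hu hv
  · have hd' : IsUnit A.det := isUnit_iff_ne_zero.2 hd
    have h1 := det_add_two A hA hd' u v
    -- The rank-one determinants are the case where the other vector is zero.
    have h2 := det_add_two A hA hd' u 0
    have h3 := det_add_two A hA hd' 0 v
    simp at h2 h3
    rw [h1, h2, h3]
    nlinarith [mul_nonneg (sq_nonneg A.det) (sq_nonneg (u ⬝ᵥ A⁻¹ *ᵥ v))]

end CauchyBinet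


/-! ### Determinants of reduced incidence matrices -/

section MatrixTree

open Matrix

variable {ι E : Type*} [Fintype ι] [DecidableEq ι] [Fintype E] [DecidableEq E]

/-- The incidence vector of the edge `e` from `src e` to `tgt e`, without the coordinate of the
root `r`. -/
def incidence (R : Type*) [Ring R] (src tgt : E → ι) (r : ι) (e : E) : {v // v ≠ r} → R :=
  fun v => (if src e = v then 1 else 0) - (if tgt e = v then 1 else 0)

/-- The edges in `F` connect the vertices as in the simple graph `G`. -/
def Realizes (src tgt : E → ι) (F : Finset E) (G : SimpleGraph ι) : Prop :=
  ∀ u v, G.Adj u v ↔ u ≠ v ∧ ∃ e ∈ F, (src e = u ∧ tgt e = v) ∨ (src e = v ∧ tgt e = u)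

/-- For indicator weights the Gram matrix factors as `BᵀB` with `B` square; squaring makes the
orientation and the enumeration of `F` irrelevant. -/
theorem gram_indicator_det_eq_sq {n R : Type*} [Fintype n] [DecidableEq n] [CommRing R]
    (b : E → n → R) (F : Finset E) (g : n ≃ F) :
    (gram b fun e => if e ∈ F then 1 else 0).det = (Matrix.of fun i => b (g i)).det ^ 2 := by
  have h : gram b (fun e => if e ∈ F then 1 else 0) =
      (Matrix.of fun i => b (g i))ᵀ * (Matrix.of fun i => b (g i)) := by
    ext i j
    simp only [gram, Matrix.sum_apply, Matrix.mul_apply, transpose_apply, of_apply]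
    rw [Equiv.sum_comp g (fun e : F => b e i * b e j),
      Finset.sum_coe_sort F (fun e => b e i * b e j), ← Finset.sum_filter_of_ne (p := (· ∈ F))]
    · refine Finset.sum_congr (by ext; simp) fun e he => ?_
      simp [he, vecMulVec_apply]
    · intro e _ he
      by_contra h
      simp [h] at he
  rw [h, det_mul, det_transpose, sq]

/-- Modulo the integer span of the rows, the unit vectors of the two ends of an edge agree, and the
one of the root is zero. Connectivity therefore puts all unit vectors into the span, which gives an
integral left inverse, and the determinant is a unit of `ℤ`. -/
theorem det_incidence_sq_of_connected (src tgt : E → ι) (r : ι) (F : Finset E)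
    (G : SimpleGraph ι) (hG : Realizes src tgt F G) (hc : G.Connected)
    (g : {v // v ≠ r} ≃ F) :
    (Matrix.of fun i => incidence ℤ src tgt r (g i)).det ^ 2 = 1 := by
  set b := incidence ℤ src tgt r
  set s : ι → {v // v ≠ r} → ℤ := fun u v => if u = v then 1 else 0 with hs
  set M := Submodule.span ℤ (Set.range fun i => b (g i)) with hM
  have hb : ∀ e ∈ F, s (src e) - s (tgt e) ∈ M := by
    intro e he
    refine Submodule.subset_span ⟨g.symm ⟨e, he⟩, ?_⟩
    funext v
    simp [b, incidence, hs]
  have hstep : ∀ u v, G.Adj u v → s u ∈ M → s v ∈ M := by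
    intro u v huv hu
    obtain ⟨-, e, he, ⟨rfl, rfl⟩ | ⟨rfl, rfl⟩⟩ := (hG u v).1 huv
    · have := M.sub_mem hu (hb e he); simpa using this
    · have := M.add_mem hu (hb e he); simpa using this
  have hr : s r ∈ M := by
    have : s r = 0 := by
      funext v
      have := v.2.symm
      simp [hs, this]
    rw [this]; exact M.zero_mem
  have hall : ∀ v, s v ∈ M := by
    intro v
    have : ∀ u w (p : G.Walk u w), s u ∈ M → s w ∈ M := by
      intro u w p
      induction p with
      | nil => exact id
      | cons h _ ih => exact fun hu => ih (hstep _ _ h hu)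
    obtain ⟨p⟩ := hc.preconnected r v
    exact this r v p hr
  have hex : ∀ v : {v // v ≠ r}, ∃ c : {v // v ≠ r} → ℤ, ∑ i, c i • b (g i) = s v := fun v =>
    (Submodule.mem_span_range_iff_exists_fun ℤ).1 (hall v)
  choose C hC using hex
  have hmul : (Matrix.of C) * (Matrix.of fun i => b (g i)) = 1 := by
    ext v j
    have := congrFun (hC v) j
    simp only [Finset.sum_apply, Pi.smul_apply, smul_eq_mul] at this
    simp only [Matrix.mul_apply, of_apply, this, hs, Matrix.one_apply, Subtype.ext_iff]
  have hdet : (Matrix.of C).det * (Matrix.of fun i => b (g i)).det = 1 := by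
    rw [← det_mul, hmul, det_one]
  have hu : IsUnit (Matrix.of fun i => b (g i)).det := IsUnit.of_mul_eq_one_right _ hdet
  rcases Int.isUnit_iff.1 hu with h | h <;> rw [h] <;> norm_num

/-- The indicator of the vertices that are unreachable from the root is a nonzero kernel vector: it
agrees at both ends of each edge of `F`, and it is zero at the deleted coordinate. -/
theorem det_incidence_of_not_connected (src tgt : E → ι) (r : ι) (F : Finset E)
    (G : SimpleGraph ι) (hG : Realizes src tgt F G) (hc : ¬ G.Connected)
    (g : {v // v ≠ r} ≃ F) :
    (Matrix.of fun i => incidence ℤ src tgt r (g i)).det = 0 := by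
  classical
  obtain ⟨v, hv⟩ : ∃ v, ¬ G.Reachable r v := by
    by_contra! h
    exact hc ((SimpleGraph.connected_iff_exists_forall_reachable G).2 ⟨r, h⟩)
  have hvr : v ≠ r := by rintro rfl; exact hv (SimpleGraph.Reachable.refl _)
  set φ : ι → ℤ := fun v => if G.Reachable r v then 0 else 1 with hφ
  rw [← Matrix.exists_mulVec_eq_zero_iff]
  refine ⟨fun v => φ v, fun h => ?_, ?_⟩
  · have := congrFun h ⟨v, hvr⟩
    simp [hφ, hv] at this
  · funext i
    have hsum : ∀ u, ∑ v : {v // v ≠ r}, (if u = (v : ι) then (1 : ℤ) else 0) * φ v = φ u := by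
      intro u
      by_cases hu : u = r
      · subst hu
        rw [Finset.sum_eq_zero]
        · simp [hφ]
        · intro v _; simp [v.2.symm]
      · rw [Finset.sum_eq_single ⟨u, hu⟩]
        · simp
        · intro v _ hv
          have : u ≠ v := fun h => hv (Subtype.ext h.symm)
          simp [this]
        · simp
    simp only [mulVec, dotProduct, of_apply, incidence, sub_mul, Finset.sum_sub_distrib, hsum,
      Pi.zero_apply]
    by_cases hst : src (g i) = tgt (g i)
    · rw [hst, sub_self]
    · have hadj : G.Adj (src (g i)) (tgt (g i)) := (hG _ _).2 ⟨hst, g i, (g i).2, Or.inl ⟨rfl, rfl⟩⟩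
      have : G.Reachable r (src (g i)) ↔ G.Reachable r (tgt (g i)) :=
        ⟨fun h => h.trans hadj.reachable, fun h => h.trans hadj.symm.reachable⟩
      simp [hφ, this]

theorem gram_incidence_det (src tgt : E → ι) (r : ι) (F : Finset E)
    (G : SimpleGraph ι) (hG : Realizes src tgt F G) (hF : F.card + 1 = Fintype.card ι)
    [Decidable G.Connected] :
    (gram (incidence ℝ src tgt r) fun e => if e ∈ F then 1 else 0).det =
      if G.Connected then 1 else 0 := by
  have hcard : Fintype.card {v // v ≠ r} = Fintype.card F := by
    rw [Fintype.card_subtype_compl, Fintype.card_coe]; simp; omega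
  let g : {v // v ≠ r} ≃ F := Fintype.equivOfCardEq hcard
  rw [gram_indicator_det_eq_sq _ _ g]
  have hmap : (Matrix.of fun i => incidence ℝ src tgt r (g i)) =
      (Matrix.of fun i => incidence ℤ src tgt r (g i)).map (Int.castRingHom ℝ) := by
    ext i j
    simp only [of_apply, incidence, map_apply, map_sub, eq_intCast, Int.cast_ite, Int.cast_one,
      Int.cast_zero]
  have : (Matrix.of fun i => incidence ℝ src tgt r (g i)).det ^ 2 =
      (((Matrix.of fun i => incidence ℤ src tgt r (g i)).det ^ 2 : ℤ) : ℝ) := by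
    rw [hmap, ← RingHom.mapMatrix_apply, ← RingHom.map_det]; simp
  rw [this]
  split_ifs with hc
  · rw [det_incidence_sq_of_connected src tgt r F G hG hc g]; simp
  · rw [det_incidence_of_not_connected src tgt r F G hG hc g]; simp

end MatrixTree

/-! ### The matrix-tree theorem for contracted multigraphs -/

section Rayleigh

variable {V E : Type*} [Fintype V] [DecidableEq V] [Fintype E] [DecidableEq E]

open Classical in
/-- The total weight of the spanning trees that satisfy `P`. -/
noncomputable def treeWeight (ends : E → Sym2 V) (N : Finset (Finset V)) (w : E → ℝ)
    (P : Finset E → Prop) : ℝ :=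
  ∑ F : Finset E, if IsSpanningTree ends N F ∧ P F then ∏ e ∈ F, w e else 0

theorem Joins.symm {ends : E → Sym2 V} {A B : Finset V} {e : E} (h : Joins ends A B e) :
    Joins ends B A e := by
  obtain ⟨a, ha, b, hb, h⟩ := h
  exact ⟨b, hb, a, ha, by rw [h, Sym2.eq_swap]⟩

theorem Joins.unique {ends : E → Sym2 V} {N : Finset (Finset V)}
    (hN : (N : Set (Finset V)).PairwiseDisjoint id) {A B A' B' : Finset V} {e : E}
    (hA : A ∈ N) (hB : B ∈ N) (hA' : A' ∈ N) (hB' : B' ∈ N)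
    (h : Joins ends A B e) (h' : Joins ends A' B' e) : (A' = A ∧ B' = B) ∨ (A' = B ∧ B' = A) := by
  obtain ⟨a, ha, b, hb, h⟩ := h
  obtain ⟨a', ha', b', hb', h'⟩ := h'
  have key : ∀ {X Y : Finset V} {v : V}, X ∈ N → Y ∈ N → v ∈ X → v ∈ Y → X = Y := by
    intro X Y v hX hY hvX hvY
    by_contra hne
    exact Finset.disjoint_left.1 (hN hX hY hne) hvX hvY
  rw [h, Sym2.eq_iff] at h'
  rcases h' with ⟨rfl, rfl⟩ | ⟨rfl, rfl⟩
  · exact Or.inl ⟨key hA' hA ha' ha, key hB' hB hb' hb⟩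
  · exact Or.inr ⟨key hA' hB ha' hb, key hB' hA hb' ha⟩

/-- An orientation of the edges between the nodes. -/
theorem exists_orientation (ends : E → Sym2 V) (N : Finset (Finset V))
    (hN : (N : Set (Finset V)).PairwiseDisjoint id) (r : {A // A ∈ N}) :
    ∃ src tgt : E → {A // A ∈ N}, ∀ F ⊆ edgesBetween ends N,
      Realizes src tgt F (nodeGraph ends N F) := by
  classical
  have h : ∀ e, ∃ p : {A // A ∈ N} × {A // A ∈ N}, e ∈ edgesBetween ends N →
      Joins ends p.1.1 p.2.1 e := by
    intro e
    by_cases he : e ∈ edgesBetween ends N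
    · have he' := he
      simp only [edgesBetween, Finset.mem_filter, Finset.mem_univ, true_and] at he'
      obtain ⟨A, hA, B, hB, -, hJ⟩ := he'
      exact ⟨(⟨A, hA⟩, ⟨B, hB⟩), fun _ => hJ⟩
    -- Edges that do not join two nodes get a dummy orientation; they never occur in the sets `F`
    -- under consideration.
    · exact ⟨(r, r), fun h => absurd h he⟩
  choose p hp using h
  refine ⟨fun e => (p e).1, fun e => (p e).2, fun F hF u v => ?_⟩
  simp only [nodeGraph, SimpleGraph.fromRel_adj]
  refine and_congr_right fun huv => ⟨?_, ?_⟩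
  · rintro (⟨e, he, hJ⟩ | ⟨e, he, hJ⟩)
    · refine ⟨e, he, ?_⟩
      rcases Joins.unique hN u.2 v.2 (p e).1.2 (p e).2.2 hJ (hp e (hF he)) with h | h
      · exact Or.inl ⟨Subtype.ext h.1, Subtype.ext h.2⟩
      · exact Or.inr ⟨Subtype.ext h.1, Subtype.ext h.2⟩
    · refine ⟨e, he, ?_⟩
      rcases Joins.unique hN v.2 u.2 (p e).1.2 (p e).2.2 hJ (hp e (hF he)) with h | h
      · exact Or.inr ⟨Subtype.ext h.1, Subtype.ext h.2⟩
      · exact Or.inl ⟨Subtype.ext h.1, Subtype.ext h.2⟩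
  · rintro ⟨e, he, ⟨rfl, rfl⟩ | ⟨rfl, rfl⟩⟩
    · exact Or.inl ⟨e, he, hp e (hF he)⟩
    · exact Or.inr ⟨e, he, hp e (hF he)⟩

/-- The weighted **matrix-tree theorem**. -/
theorem exists_treeWeight_eq_det.{u, v} {V : Type u} {E : Type v} [Fintype V] [DecidableEq V]
    [Fintype E] [DecidableEq E] (ends : E → Sym2 V) (N : Finset (Finset V))
    (hN : (N : Set (Finset V)).PairwiseDisjoint id) (hne : N.Nonempty) :
    ∃ (n : Type u) (_ : Fintype n) (_ : DecidableEq n) (b : E → n → ℝ), ∀ w : E → ℝ,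
      (∀ e ∉ edgesBetween ends N, w e = 0) →
      treeWeight ends N w (fun _ => True) = (gram b w).det := by
  classical
  obtain ⟨A₀, hA₀⟩ := hne
  let r : {A // A ∈ N} := ⟨A₀, hA₀⟩
  obtain ⟨src, tgt, hst⟩ := exists_orientation ends N hN r
  refine ⟨{v // v ≠ r}, inferInstance, inferInstance, incidence ℝ src tgt r, fun w hw => ?_⟩
  rw [det_gram, treeWeight]
  have hcard : Fintype.card {v // v ≠ r} + 1 = N.card := by
    rw [Fintype.card_subtype_compl]; simp
    have : 0 < N.card := Finset.card_pos.2 ⟨A₀, hA₀⟩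
    omega
  symm
  refine Finset.sum_subset_zero_on_sdiff (Finset.subset_univ _) (fun F hF => ?_) fun F hF => ?_
  · rw [if_neg]
    rintro ⟨⟨-, -, h⟩, -⟩
    simp [Finset.mem_powersetCard] at hF
    omega
  · have hFc := (Finset.mem_powersetCard.1 hF).2
    by_cases hsub : F ⊆ edgesBetween ends N
    · rw [gram_incidence_det src tgt r F _ (hst F hsub) (by simp; omega)]
      have : (IsSpanningTree ends N F ∧ True) ↔ (nodeGraph ends N F).Connected := by
        simp [IsSpanningTree, hsub]; omega
      simp [this]
    · obtain ⟨e, he, hne⟩ := Finset.not_subset.1 hsub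
      rw [Finset.prod_eq_zero he (hw e hne), zero_mul, if_neg]
      exact fun h => hsub h.1.1

end Rayleigh


/-! ### The Rayleigh property of spanning trees and its conditional forms -/

section Rayleigh

open Matrix Function

variable {V E : Type*} [Fintype V] [DecidableEq V] [Fintype E] [DecidableEq E]
variable {ends : E → Sym2 V} {N : Finset (Finset V)}

theorem treeWeight_congr {w : E → ℝ} {P Q : Finset E → Prop}
    (h : ∀ F, IsSpanningTree ends N F → (P F ↔ Q F)) :
    treeWeight ends N w P = treeWeight ends N w Q := by
  classical
  refine Finset.sum_congr rfl fun F _ => ?_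
  by_cases hF : IsSpanningTree ends N F
  · simp [hF, h F hF]
  · simp [hF]

theorem treeWeight_nonneg {w : E → ℝ} (hw : ∀ e, 0 ≤ w e) (P : Finset E → Prop) :
    0 ≤ treeWeight ends N w P := by
  classical
  refine Finset.sum_nonneg fun F _ => ?_
  split_ifs
  · exact Finset.prod_nonneg fun e _ => hw e
  · exact le_rfl

theorem treeWeight_split (w : E → ℝ) (P Q : Finset E → Prop) :
    treeWeight ends N w P =
      treeWeight ends N w (fun F => P F ∧ Q F) + treeWeight ends N w (fun F => P F ∧ ¬ Q F) := by
  classical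
  rw [treeWeight, treeWeight, treeWeight, ← Finset.sum_add_distrib]
  refine Finset.sum_congr rfl fun F _ => ?_
  by_cases h1 : IsSpanningTree ends N F <;> by_cases h2 : P F <;> by_cases h3 : Q F <;>
    simp [h1, h2, h3]

/-- The weight is affine in each edge weight. Thus `t = 0` deletes `g`, and the coefficient of `t`
belongs to the trees that contain `g`: this is the means of conditioning in what follows. -/
theorem treeWeight_update (w : E → ℝ) (P : Finset E → Prop) (g : E) (t : ℝ) :
    treeWeight ends N (update w g (t * w g)) P =
      treeWeight ends N w (fun F => P F ∧ g ∉ F) +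
        t * treeWeight ends N w (fun F => P F ∧ g ∈ F) := by
  classical
  rw [treeWeight, treeWeight, treeWeight, Finset.mul_sum, ← Finset.sum_add_distrib]
  refine Finset.sum_congr rfl fun F _ => ?_
  by_cases h1 : IsSpanningTree ends N F ∧ P F
  · obtain ⟨h1, h2⟩ := h1
    by_cases h3 : g ∈ F
    · rw [← Finset.mul_prod_erase F w h3, ← Finset.mul_prod_erase F _ h3]
      simp [h1, h2, h3, mul_assoc]
      left; left
      exact Finset.prod_congr rfl fun e he => by simp [Finset.ne_of_mem_erase he]
    · simp [h1, h2, h3]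
      exact Finset.prod_congr rfl fun e he => by
        rw [update_of_ne]; rintro rfl; exact h3 he
  · have h2 : ∀ Q : Prop, ¬ (IsSpanningTree ends N F ∧ P F ∧ Q) :=
      fun Q h => h1 ⟨h.1, h.2.1⟩
    simp [h1, h2]

theorem treeWeight_update_zero (w : E → ℝ) (P : Finset E → Prop) (g : E) :
    treeWeight ends N (update w g 0) P = treeWeight ends N w (fun F => P F ∧ g ∉ F) := by
  simpa using treeWeight_update (ends := ends) (N := N) w P g 0

theorem treeWeight_restrict (w : E → ℝ) (P : Finset E → Prop) :
    treeWeight ends N (fun e => if e ∈ edgesBetween ends N then w e else 0) P =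
      treeWeight ends N w P := by
  classical
  refine Finset.sum_congr rfl fun F _ => ?_
  split_ifs with h
  · exact Finset.prod_congr rfl fun e he => by simp [h.1.1 he]
  · rfl

/-- The square root absorbs the weight into the vector, so that the edge contributes an update of
the shape that `rayleigh_det` expects. -/
theorem gram_update {n : Type*} [Fintype n] [DecidableEq n] (b : E → n → ℝ) (w : E → ℝ) (g : E)
    (hg : 0 ≤ w g) :
    gram b w = gram b (update w g 0) +
      vecMulVec (Real.sqrt (w g) • b g) (Real.sqrt (w g) • b g) := by
  have h : vecMulVec (Real.sqrt (w g) • b g) (Real.sqrt (w g) • b g) =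
      w g • vecMulVec (b g) (b g) := by
    ext i j
    simp only [vecMulVec_apply, Pi.smul_apply, smul_eq_mul, Matrix.smul_apply]
    rw [mul_mul_mul_comm, Real.mul_self_sqrt hg]
  rw [h, gram, gram, ← Finset.add_sum_erase _ _ (Finset.mem_univ g),
    ← Finset.add_sum_erase _ _ (Finset.mem_univ g)]
  rw [update_self, zero_smul, zero_add, add_comm]
  congr 1
  exact Finset.sum_congr rfl fun e he => by rw [update_of_ne (Finset.ne_of_mem_erase he)]

/-- Weighted spanning trees have the **Rayleigh property**. -/
theorem treeWeight_rayleigh (hN : (N : Set (Finset V)).PairwiseDisjoint id) (hne : N.Nonempty)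
    {w : E → ℝ} (hw : ∀ e, 0 ≤ w e) {e f : E} (hef : e ≠ f) :
    treeWeight ends N w (fun F => e ∈ F ∧ f ∈ F) * treeWeight ends N w (fun F => e ∉ F ∧ f ∉ F) ≤
    treeWeight ends N w (fun F => e ∈ F ∧ f ∉ F) *
      treeWeight ends N w (fun F => e ∉ F ∧ f ∈ F) := by
  classical
  -- The determinant formula requires weights that vanish off the edges between nodes; truncation
  -- changes no tree weight.
  set w' : E → ℝ := fun e => if e ∈ edgesBetween ends N then w e else 0 with hw'
  have hw'0 : ∀ e, 0 ≤ w' e := fun e => by simp only [hw']; split_ifs; exacts [hw e, le_rfl]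
  simp only [← treeWeight_restrict (ends := ends) (N := N) w]
  obtain ⟨n, _, _, b, hb⟩ := exists_treeWeight_eq_det ends N hN hne
  have hz : ∀ e ∉ edgesBetween ends N, w' e = 0 := fun e he => by simp [hw', he]
  have hzu : ∀ (v : E → ℝ) (g : E), (∀ e ∉ edgesBetween ends N, v e = 0) →
      ∀ e ∉ edgesBetween ends N, update v g 0 e = 0 := by
    intro v g hv e he
    by_cases h : e = g
    · subst h; simp
    · rw [update_of_ne h]; exact hv e he
  set A := gram b (update (update w' f 0) e 0) with hA
  set u := Real.sqrt (w' e) • b e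
  set v := Real.sqrt (w' f) • b f
  have he : gram b (update w' f 0) = A + vecMulVec u u := by
    have := gram_update b (update w' f 0) e (by rw [update_of_ne hef]; exact hw'0 e)
    rw [this, update_of_ne hef]
  have hf : gram b (update w' e 0) = A + vecMulVec v v := by
    have := gram_update b (update w' e 0) f (by rw [update_of_ne hef.symm]; exact hw'0 f)
    rw [this, update_of_ne hef.symm, update_comm hef]
  have hall : gram b w' = A + vecMulVec u u + vecMulVec v v := by
    rw [gram_update b w' f (hw'0 f), he]
  have t0 := hb _ (hzu _ e (hzu _ f hz))
  have te := hb _ (hzu _ f hz)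
  have tf := hb _ (hzu _ e hz)
  have tt := hb _ hz
  rw [treeWeight_update_zero, treeWeight_update_zero, ← hA] at t0
  rw [treeWeight_update_zero, he, treeWeight_split _ _ (fun F => e ∈ F)] at te
  rw [treeWeight_update_zero, hf, treeWeight_split _ _ (fun F => f ∈ F)] at tf
  rw [hall, treeWeight_split _ _ (fun F => e ∈ F), treeWeight_split _ _ (fun F => f ∈ F),
    treeWeight_split _ (fun F => True ∧ e ∉ F) (fun F => f ∈ F)] at tt
  simp only [true_and] at t0 te tf tt
  -- The determinants of `A`, of its two rank-one updates and of its rank-two update are the weights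
  -- of the trees avoiding both edges, avoiding one of them, and unrestricted. Their second
  -- difference is the weight of the trees containing both.
  have hR := rayleigh_det A (gram_transpose _ _) u v
  rw [← t0, ← te, ← tf, ← tt] at hR
  have c1 : treeWeight ends N w' (fun F => f ∉ F ∧ e ∉ F) =
      treeWeight ends N w' (fun F => e ∉ F ∧ f ∉ F) := treeWeight_congr fun _ _ => and_comm
  have c2 : treeWeight ends N w' (fun F => f ∉ F ∧ e ∈ F) =
      treeWeight ends N w' (fun F => e ∈ F ∧ f ∉ F) := treeWeight_congr fun _ _ => and_comm
  rw [c1, c2] at hR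
  have n0 := fun P => treeWeight_nonneg (ends := ends) (N := N) hw'0 P
  have := hR (add_nonneg (n0 _) (n0 _)) (add_nonneg (n0 _) (n0 _))
  nlinarith [this]


theorem leading_coeff_nonneg {a b c : ℝ} (h : ∀ t : ℝ, 0 ≤ t → 0 ≤ a * t ^ 2 + b * t + c) :
    0 ≤ a := by
  by_contra! ha
  -- If the leading coefficient is negative, the quadratic is negative at `1 + s`.
  set s := (|b| + |c|) / (-a) with hs
  have hs0 : 0 ≤ s := div_nonneg (by positivity) (by linarith)
  have hsa : a * s = -(|b| + |c|) := by
    have := ha.ne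
    rw [hs, div_neg, mul_neg, mul_div_cancel₀ _ this]
  have h1 := h (1 + s) (by linarith)
  nlinarith [le_abs_self b, le_abs_self c, abs_nonneg c, mul_nonneg hs0 (abs_nonneg c),
    mul_nonneg hs0 (sub_nonneg.2 (le_abs_self b))]

theorem leading_coeff_le {a₁ b₁ a₀ b₀ a b a' b' : ℝ}
    (h : ∀ t : ℝ, 0 ≤ t → (a₁ + t * b₁) * (a₀ + t * b₀) ≤ (a + t * b) * (a' + t * b')) :
    b₁ * b₀ ≤ b * b' := by
  rw [← sub_nonneg]
  refine leading_coeff_nonneg (b := a * b' + b * a' - a₁ * b₀ - b₁ * a₀)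
    (c := a * a' - a₁ * a₀) fun t ht => (sub_nonneg.2 (h t ht)).trans_eq ?_
  ring

/-- Scaling the weight of `g` by `t ≥ 0` turns both sides of the Rayleigh inequality into quadratics
in `t`. Their leading coefficients come from the trees containing `g`, and they inherit the
inequality. -/
theorem treeWeight_rayleigh_of_mem (hN : (N : Set (Finset V)).PairwiseDisjoint id)
    (hne : N.Nonempty) {w : E → ℝ} (hw : ∀ e, 0 ≤ w e) {e f : E} (hef : e ≠ f) (g : E) :
    treeWeight ends N w (fun F => (e ∈ F ∧ f ∈ F) ∧ g ∈ F) *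
      treeWeight ends N w (fun F => (e ∉ F ∧ f ∉ F) ∧ g ∈ F) ≤
    treeWeight ends N w (fun F => (e ∈ F ∧ f ∉ F) ∧ g ∈ F) *
      treeWeight ends N w (fun F => (e ∉ F ∧ f ∈ F) ∧ g ∈ F) := by
  have hwt : ∀ t : ℝ, 0 ≤ t → ∀ e, 0 ≤ update w g (t * w g) e := by
    intro t ht e
    by_cases h : e = g
    · subst h; simpa using mul_nonneg ht (hw e)
    · rw [update_of_ne h]; exact hw e
  have h := fun t ht => treeWeight_rayleigh (ends := ends) hN hne (hwt t ht) hef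
  simp only [treeWeight_update] at h
  exact leading_coeff_le h

theorem treeWeight_rayleigh_of_mem_of_notMem (hN : (N : Set (Finset V)).PairwiseDisjoint id)
    (hne : N.Nonempty) {w : E → ℝ} (hw : ∀ e, 0 ≤ w e) {e f : E} (hef : e ≠ f) (g o : E) :
    treeWeight ends N w (fun F => ((e ∈ F ∧ f ∈ F) ∧ g ∈ F) ∧ o ∉ F) *
      treeWeight ends N w (fun F => ((e ∉ F ∧ f ∉ F) ∧ g ∈ F) ∧ o ∉ F) ≤
    treeWeight ends N w (fun F => ((e ∈ F ∧ f ∉ F) ∧ g ∈ F) ∧ o ∉ F) *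
      treeWeight ends N w (fun F => ((e ∉ F ∧ f ∈ F) ∧ g ∈ F) ∧ o ∉ F) := by
  have hwo : ∀ e, 0 ≤ update w o 0 e := by
    intro e
    by_cases h : e = o
    · subst h; simp
    · rw [update_of_ne h]; exact hw e
  have h := treeWeight_rayleigh_of_mem (ends := ends) hN hne hwo hef g
  simpa only [treeWeight_update_zero] using h

end Rayleigh


/-! ### Real-valued probabilities and unions of independent random sets -/

section Prob

variable {α β : Type*}

/-- The probability of `P` as a real number. -/
noncomputable def prob (p : PMF α) (P : α → Prop) : ℝ := (p.toOuterMeasure {x | P x}).toReal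

theorem toOuterMeasure_ne_top (p : PMF α) (s : Set α) : p.toOuterMeasure s ≠ ⊤ := by
  rw [PMF.toOuterMeasure_apply]; exact p.tsum_coe_indicator_ne_top s

theorem le_toOuterMeasure_of_le_prob {p : PMF α} {P : α → Prop} {c : ℝ≥0∞}
    (h : c.toReal ≤ prob p P) (hc : c ≠ ⊤) : c ≤ p.toOuterMeasure {x | P x} :=
  (ENNReal.toReal_le_toReal hc (toOuterMeasure_ne_top _ _)).1 h

theorem prob_nonneg (p : PMF α) (P : α → Prop) : 0 ≤ prob p P := ENNReal.toReal_nonneg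

theorem prob_mono {p : PMF α} {P Q : α → Prop} (h : ∀ x ∈ p.support, P x → Q x) :
    prob p P ≤ prob p Q :=
  ENNReal.toReal_mono (toOuterMeasure_ne_top _ _)
    (p.toOuterMeasure_mono fun x hx => h x hx.2 hx.1)

theorem prob_congr {p : PMF α} {P Q : α → Prop} (h : ∀ x ∈ p.support, (P x ↔ Q x)) :
    prob p P = prob p Q :=
  le_antisymm (prob_mono fun x hx => (h x hx).1) (prob_mono fun x hx => (h x hx).2)

theorem prob_eq_one {p : PMF α} {P : α → Prop} (h : ∀ x ∈ p.support, P x) : prob p P = 1 := by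
  rw [prob, (p.toOuterMeasure_apply_eq_one_iff {x | P x}).2 h, ENNReal.toReal_one]

theorem prob_eq_zero {p : PMF α} {P : α → Prop} (h : ∀ x ∈ p.support, ¬ P x) : prob p P = 0 := by
  rw [prob, (p.toOuterMeasure_apply_eq_zero_iff _).2, ENNReal.toReal_zero]
  exact Set.disjoint_left.2 h

variable [Fintype α]

open Classical in
theorem prob_eq_sum (p : PMF α) (P : α → Prop) :
    prob p P = ∑ x, if P x then (p x).toReal else 0 := by
  rw [prob, PMF.toOuterMeasure_apply_fintype, ENNReal.toReal_sum]
  · refine Finset.sum_congr rfl fun x _ => ?_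
    by_cases h : P x <;> simp [h]
  · intro x _
    by_cases h : P x <;> simp [h, p.apply_ne_top]

theorem prob_split (p : PMF α) (P Q : α → Prop) :
    prob p P = prob p (fun x => P x ∧ Q x) + prob p (fun x => P x ∧ ¬ Q x) := by
  classical
  rw [prob_eq_sum, prob_eq_sum, prob_eq_sum, ← Finset.sum_add_distrib]
  refine Finset.sum_congr rfl fun x _ => ?_
  by_cases h1 : P x <;> by_cases h2 : Q x <;> simp [h1, h2]

theorem prob_not (p : PMF α) (P : α → Prop) : prob p (fun x => ¬ P x) = 1 - prob p P := by
  have h := prob_split p (fun _ => True) P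
  rw [prob_eq_one fun _ _ => trivial] at h
  simp only [true_and] at h
  linarith

theorem prob_le_add {p : PMF α} {P Q R : α → Prop} (h : ∀ x ∈ p.support, P x → Q x ∨ R x) :
    prob p P ≤ prob p Q + prob p R := by
  rw [prob_split p P Q]
  refine add_le_add (prob_mono fun _ _ h => h.2) (prob_mono fun x hx h' => ?_)
  exact (h x hx h'.1).resolve_left h'.2

theorem prob_comp [Fintype β] [DecidableEq β] (p : PMF α) (f : α → β) (R : β → Prop)
    [DecidablePred R] :
    prob p (fun x => R (f x)) = ∑ y, if R y then prob p (fun x => f x = y) else 0 := by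
  classical
  have h : ∀ y, (if R y then prob p (fun x => f x = y) else 0) =
      ∑ x, if f x = y then (if R y then (p x).toReal else 0) else 0 := by
    intro y
    split_ifs with hR
    · rw [prob_eq_sum]
      exact Finset.sum_congr rfl fun x _ => by congr
    · simp
  rw [Finset.sum_congr rfl fun y _ => h y, Finset.sum_comm, prob_eq_sum]
  exact Finset.sum_congr rfl fun x _ => by simp

variable {E : Type*} [Fintype E] [DecidableEq E]

/-- The law of the union of two independent random sets. -/
noncomputable def unionLaw (p q : PMF (Finset E)) : PMF (Finset E) :=
  p.bind fun T => q.bind fun T' => PMF.pure (T ∪ T')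

theorem mem_support_unionLaw {p q : PMF (Finset E)} {T : Finset E} :
    T ∈ (unionLaw p q).support ↔ ∃ T₁ ∈ p.support, ∃ T₂ ∈ q.support, T = T₁ ∪ T₂ := by
  simp [unionLaw]

theorem prob_unionLaw (p q : PMF (Finset E)) (P : Finset E → Prop) :
    prob (unionLaw p q) P = ∑ T, (p T).toReal * prob q fun T' => P (T ∪ T') := by
  classical
  have hb : ∀ T, (q.bind fun T' => PMF.pure (T ∪ T')).toOuterMeasure {x | P x} =
      q.toOuterMeasure {T' | P (T ∪ T')} := by
    intro T
    rw [PMF.toOuterMeasure_bind_apply, PMF.toOuterMeasure_apply]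
    refine tsum_congr fun T' => ?_
    rw [PMF.toOuterMeasure_pure_apply]
    by_cases h : P (T ∪ T') <;> simp [h]
  rw [prob, unionLaw, PMF.toOuterMeasure_bind_apply, tsum_fintype, ENNReal.toReal_sum]
  · refine Finset.sum_congr rfl fun T _ => ?_
    rw [ENNReal.toReal_mul, hb, prob]
  · intro T _
    exact ENNReal.mul_ne_top (p.apply_ne_top T) (toOuterMeasure_ne_top _ _)

/-- Conditioning on the first set: each outcome in `G` contributes at least a fraction `c` of its
mass, and the other outcomes are dropped. -/
theorem mul_le_prob_unionLaw {p q : PMF (Finset E)} {G P : Finset E → Prop} {c : ℝ}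
    (h : ∀ T ∈ p.support, G T → c ≤ prob q fun T' => P (T ∪ T')) :
    prob p G * c ≤ prob (unionLaw p q) P := by
  classical
  rw [prob_unionLaw, prob_eq_sum, Finset.sum_mul]
  refine Finset.sum_le_sum fun T _ => ?_
  by_cases hT : T ∈ p.support
  · split_ifs with hG
    · exact mul_le_mul_of_nonneg_left (h T hT hG) ENNReal.toReal_nonneg
    · rw [zero_mul]; exact mul_nonneg ENNReal.toReal_nonneg (prob_nonneg _ _)
  · rw [(p.apply_eq_zero_iff T).2 hT]; simp

theorem le_prob_unionLaw {p q : PMF (Finset E)} {P : Finset E → Prop} {c : ℝ}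
    (h : ∀ T ∈ p.support, c ≤ prob q fun T' => P (T ∪ T')) : c ≤ prob (unionLaw p q) P := by
  have := mul_le_prob_unionLaw (G := fun _ => True) fun T hT _ => h T hT
  rwa [prob_eq_one fun _ _ => trivial, one_mul] at this

theorem prob_unionLaw_left {p q : PMF (Finset E)} {P G : Finset E → Prop}
    (h : ∀ T ∈ p.support, ∀ T' ∈ q.support, (P (T ∪ T') ↔ G T)) :
    prob (unionLaw p q) P = prob p G := by
  classical
  rw [prob_unionLaw, prob_eq_sum]
  refine Finset.sum_congr rfl fun T _ => ?_
  by_cases hT : T ∈ p.support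
  · split_ifs with hG
    · rw [prob_eq_one fun T' hT' => (h T hT T' hT').2 hG, mul_one]
    · rw [prob_eq_zero fun T' hT' h' => hG ((h T hT T' hT').1 h'), mul_zero]
  · rw [(p.apply_eq_zero_iff T).2 hT]; simp

/-- Allows any chosen level to be sampled last. -/
theorem unionLaw_right_comm (p q r : PMF (Finset E)) :
    unionLaw (unionLaw p q) r = unionLaw (unionLaw p r) q := by
  simp only [unionLaw, PMF.bind_bind, PMF.pure_bind]
  congr 1; funext T
  rw [PMF.bind_comm]
  simp only [Finset.union_right_comm]

end Prob

/-! ### The Rayleigh property for tree distributions with marginals one half -/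

section TreeLaw

variable {V E : Type*} [Fintype V] [DecidableEq V] [Fintype E] [DecidableEq E]
variable {ends : E → Sym2 V} {N : Finset (Finset V)} {μ : PMF (Finset E)}

/-- `μ` is the `λ`-uniform distribution on spanning trees with weights `c * ∏ w`. -/
def IsTreeLaw (ends : E → Sym2 V) (N : Finset (Finset V)) (μ : PMF (Finset E)) (w : E → ℝ)
    (c : ℝ) : Prop :=
  (∀ e, 0 ≤ w e) ∧ 0 ≤ c ∧ (∀ F, IsSpanningTree ends N F → (μ F).toReal = c * ∏ e ∈ F, w e) ∧
    ∀ F ∈ μ.support, IsSpanningTree ends N F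

theorem IsMaxEntropyTree.exists_isTreeLaw (h : IsMaxEntropyTree ends N μ) :
    ∃ w c, IsTreeLaw ends N μ w c := by
  obtain ⟨w, c, hwc⟩ := h.uniform
  refine ⟨fun e => w e, c, fun e => (w e).2, c.2, fun F hF => ?_, fun F hF => ?_⟩
  · rw [(hwc F).1 hF]; simp
  · by_contra hF'
    exact hF ((hwc F).2 hF')

theorem IsMaxEntropyTree.isSpanningTree (h : IsMaxEntropyTree ends N μ) {F : Finset E}
    (hF : F ∈ μ.support) : IsSpanningTree ends N F := by
  obtain ⟨w, c, -, -, -, hwc⟩ := h.exists_isTreeLaw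
  exact hwc F hF

theorem IsMaxEntropyTree.prob_mem (h : IsMaxEntropyTree ends N μ) {e : E}
    (he : e ∈ edgesBetween ends N) : prob μ (fun F => e ∈ F) = 1 / 2 := by
  rw [prob, h.marginal e he]; simp

theorem IsTreeLaw.prob_eq {w : E → ℝ} {c : ℝ} (h : IsTreeLaw ends N μ w c)
    (P : Finset E → Prop) : prob μ P = c * treeWeight ends N w P := by
  classical
  obtain ⟨-, -, h3, h4⟩ := h
  rw [prob_eq_sum, treeWeight, Finset.mul_sum]
  refine Finset.sum_congr rfl fun F _ => ?_
  by_cases hF : IsSpanningTree ends N F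
  · by_cases hP : P F <;> simp [hF, hP, h3 F hF]
  · have : μ F = 0 := (μ.apply_eq_zero_iff F).2 fun hs => hF (h4 F hs)
    simp [hF, this]

theorem IsMaxEntropyTree.rayleigh (hN : (N : Set (Finset V)).PairwiseDisjoint id)
    (hne : N.Nonempty) (h : IsMaxEntropyTree ends N μ) {e f : E} (hef : e ≠ f) :
    prob μ (fun F => e ∈ F ∧ f ∈ F) * prob μ (fun F => e ∉ F ∧ f ∉ F) ≤
      prob μ (fun F => e ∈ F ∧ f ∉ F) * prob μ (fun F => e ∉ F ∧ f ∈ F) := by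
  obtain ⟨w, c, hw⟩ := h.exists_isTreeLaw
  have := mul_le_mul_of_nonneg_left
    (treeWeight_rayleigh (ends := ends) hN hne hw.1 hef) (sq_nonneg c)
  simp only [hw.prob_eq]
  linarith

theorem IsMaxEntropyTree.rayleigh_of_mem (hN : (N : Set (Finset V)).PairwiseDisjoint id)
    (hne : N.Nonempty) (h : IsMaxEntropyTree ends N μ) {e f : E} (hef : e ≠ f)
    (g : E) :
    prob μ (fun F => (e ∈ F ∧ f ∈ F) ∧ g ∈ F) * prob μ (fun F => (e ∉ F ∧ f ∉ F) ∧ g ∈ F) ≤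
      prob μ (fun F => (e ∈ F ∧ f ∉ F) ∧ g ∈ F) * prob μ (fun F => (e ∉ F ∧ f ∈ F) ∧ g ∈ F) := by
  obtain ⟨w, c, hw⟩ := h.exists_isTreeLaw
  have := mul_le_mul_of_nonneg_left
    (treeWeight_rayleigh_of_mem (ends := ends) hN hne hw.1 hef g) (sq_nonneg c)
  simp only [hw.prob_eq]
  linarith

theorem IsMaxEntropyTree.rayleigh_of_mem_of_notMem (hN : (N : Set (Finset V)).PairwiseDisjoint id)
    (hne : N.Nonempty) (h : IsMaxEntropyTree ends N μ) {e f : E}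
    (hef : e ≠ f) (g o : E) :
    prob μ (fun F => ((e ∈ F ∧ f ∈ F) ∧ g ∈ F) ∧ o ∉ F) *
        prob μ (fun F => ((e ∉ F ∧ f ∉ F) ∧ g ∈ F) ∧ o ∉ F) ≤
      prob μ (fun F => ((e ∈ F ∧ f ∉ F) ∧ g ∈ F) ∧ o ∉ F) *
        prob μ (fun F => ((e ∉ F ∧ f ∈ F) ∧ g ∈ F) ∧ o ∉ F) := by
  obtain ⟨w, c, hw⟩ := h.exists_isTreeLaw
  have := mul_le_mul_of_nonneg_left
    (treeWeight_rayleigh_of_mem_of_notMem (ends := ends) hN hne hw.1 hef g o) (sq_nonneg c)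
  simp only [hw.prob_eq]
  linarith

/-- If both edges occur with probability `p`, then so does neither, and each edge alone occurs with
probability `1/2 - p`. The Rayleigh inequality becomes `p² ≤ (1/2 - p)²`. -/
theorem IsMaxEntropyTree.prob_mem_mem_le (hN : (N : Set (Finset V)).PairwiseDisjoint id)
    (hne : N.Nonempty) (h : IsMaxEntropyTree ends N μ) {e f : E} (hef : e ≠ f)
    (he : e ∈ edgesBetween ends N) (hf : f ∈ edgesBetween ends N) :
    prob μ (fun F => e ∈ F ∧ f ∈ F) ≤ 1 / 4 := by
  have hR := h.rayleigh hN hne hef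
  have h1 := prob_split μ (fun F => e ∈ F) (fun F => f ∈ F)
  have h2 := prob_split μ (fun F => f ∈ F) (fun F => e ∈ F)
  have h3 := prob_split μ (fun F => e ∉ F) (fun F => f ∈ F)
  have h4 := prob_not μ (fun F => e ∈ F)
  rw [h.prob_mem he] at h1 h4
  rw [h.prob_mem hf] at h2
  have c1 : prob μ (fun F => f ∈ F ∧ e ∈ F) = prob μ (fun F => e ∈ F ∧ f ∈ F) :=
    prob_congr fun _ _ => and_comm
  have c2 : prob μ (fun F => f ∈ F ∧ e ∉ F) = prob μ (fun F => e ∉ F ∧ f ∈ F) :=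
    prob_congr fun _ _ => and_comm
  rw [c1, c2] at h2
  have p1 := prob_nonneg μ (fun F => e ∈ F ∧ f ∈ F)
  nlinarith

end TreeLaw


/-! ### Numerical inequalities behind the constant one ninth -/

/-- In the application a first edge is absent, and `s`, `t`, `z` are the probabilities of the traces
of size one, two and three on the other edges. The Rayleigh inequalities add up to `z * (1/2 - t -
z) ≤ t ^ 2 / 3`, where `t` is the sum of the `t`'s. For `t < 1/9` this is violated, since `z` stays
between two positive constants. -/
theorem four_edge_bound {s₂ s₃ s₄ t₂₃ t₂₄ t₃₄ z : ℝ} (q₂₃ : 0 ≤ t₂₃) (q₂₄ : 0 ≤ t₂₄) (q₃₄ : 0 ≤ t₃₄) (hz : 0 ≤ z)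
    (hsum : s₂ + s₃ + s₄ + t₂₃ + t₂₄ + t₃₄ + z = 1 / 2)
    (h₂ : 1 / 4 ≤ s₂ + t₂₃ + t₂₄ + z) (h₃ : 1 / 4 ≤ s₃ + t₂₃ + t₃₄ + z)
    (h₄ : 1 / 4 ≤ s₄ + t₂₄ + t₃₄ + z) (hn : t₂₃ + z ≤ 1 / 4)
    (r₂ : z * s₂ ≤ t₂₃ * t₂₄) (r₃ : z * s₃ ≤ t₂₃ * t₃₄) (r₄ : z * s₄ ≤ t₂₄ * t₃₄) :
    1 / 9 ≤ t₂₃ + t₂₄ + t₃₄ := by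
  by_contra! ht
  set t := t₂₃ + t₂₄ + t₃₄ with ht'
  have h1 : z * (1 / 2 - t - z) ≤ t ^ 2 / 3 := by
    have : z * (1 / 2 - t - z) = z * s₂ + z * s₃ + z * s₄ := by
      rw [← mul_add, ← mul_add]; congr 1; linarith
    rw [this]
    nlinarith [sq_nonneg (t₂₃ - t₂₄), sq_nonneg (t₂₃ - t₃₄), sq_nonneg (t₂₄ - t₃₄)]
  have ht0 : 0 ≤ t := by positivity
  -- Adding `h₂`, `h₃`, `h₄` gives `1 / 8 - t / 2 ≤ z`; at `t = 1/9` this lower bound is `5/72`.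
  have hz1 : 5 / 72 ≤ z := by linarith
  have hz2 : z ≤ 1 / 4 := by linarith
  nlinarith [mul_nonneg (sub_nonneg.2 hz1) (sub_nonneg.2 hz2), mul_nonneg hz (sub_nonneg.2 ht.le),
    mul_nonneg ht0 (sub_nonneg.2 ht.le)]

/-- The marginals give `s₁ = t₂₃ + z` and `s₂ + s₃ = 1/2 - t₂₃`. As `s₁` is the largest of the
`s`'s, `z` is at least `1/4 - 3/2 * t₂₃`, while the Rayleigh inequalities force `z` to be small when
`t₂₃` is small. -/
theorem three_edge_bound {s₁ s₂ s₃ t₁₂ t₁₃ t₂₃ z : ℝ} (p₁ : 0 ≤ s₁) (p₂ : 0 ≤ s₂) (p₃ : 0 ≤ s₃)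
    (q₁₂ : 0 ≤ t₁₂) (q₁₃ : 0 ≤ t₁₃)
    (hsum : s₁ + s₂ + s₃ + t₁₂ + t₁₃ + t₂₃ + z = 1)
    (h₁ : s₁ + t₁₂ + t₁₃ + z = 1 / 2) (h₂ : s₂ + t₁₂ + t₂₃ + z = 1 / 2)
    (h₃ : s₃ + t₁₃ + t₂₃ + z = 1 / 2)
    (r₂ : z * s₂ ≤ t₁₂ * t₂₃) (r₃ : z * s₃ ≤ t₁₃ * t₂₃) (m₂ : s₂ ≤ s₁) (m₃ : s₃ ≤ s₁) :
    1 / 9 ≤ t₂₃ := by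
  by_contra! ht
  have h1 : z * (1 / 2 - t₂₃) ≤ t₂₃ * (1 / 2 - 2 * z - t₂₃) := by
    have e1 : s₂ + s₃ = 1 / 2 - t₂₃ := by linarith
    have e2 : t₁₂ + t₁₃ = 1 / 2 - 2 * z - t₂₃ := by linarith
    rw [← e1, ← e2]; linarith
  have hz1 : 1 / 4 - 3 / 2 * t₂₃ ≤ z := by linarith
  nlinarith

/-- Small `q₁ + q₂` would push both `x` and `y` close to `1/4`, whereas their product is at most
`(q₁ + q₂)² / 4`. -/
theorem three_edge_bound_of_mem {x y q₁ q₂ : ℝ} (hq₁ : 0 ≤ q₁) (hq₂ : 0 ≤ q₂)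
    (hsum : x + y + (q₁ + q₂) = 1 / 2) (hx4 : x ≤ 1 / 4) (hy4 : y ≤ 1 / 4)
    (r : y * x ≤ q₁ * q₂) : 1 / 9 ≤ q₁ + q₂ := by
  by_contra! h
  nlinarith [sq_nonneg (q₁ - q₂), mul_nonneg (sub_nonneg.2 hx4) (sub_nonneg.2 hy4)]

/-! ### Traces of a random tree on few edges -/

section Local

variable {V E : Type*} [Fintype V] [DecidableEq V] [Fintype E] [DecidableEq E]
variable {ends : E → Sym2 V} {N : Finset (Finset V)} {μ : PMF (Finset E)}

/-- The probabilities of the traces of a random set on three elements. -/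
noncomputable def trace₃ (μ : PMF (Finset E)) (a b c : E) (x y z : Bool) : ℝ :=
  prob μ fun F => (decide (a ∈ F), decide (b ∈ F), decide (c ∈ F)) = (x, y, z)

/-- The probabilities of the traces of a random set on four elements. -/
noncomputable def trace₄ (μ : PMF (Finset E)) (a b c d : E) (x y z w : Bool) : ℝ :=
  prob μ fun F => (decide (a ∈ F), decide (b ∈ F), decide (c ∈ F), decide (d ∈ F)) = (x, y, z, w)

theorem prob_trace₃ (μ : PMF (Finset E)) (a b c : E) (P : Finset E → Prop)
    (R : Bool × Bool × Bool → Prop) [DecidablePred R]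
    (h : ∀ F, P F ↔ R (decide (a ∈ F), decide (b ∈ F), decide (c ∈ F))) :
    prob μ P = ∑ x, ∑ y, ∑ z, if R (x, y, z) then trace₃ μ a b c x y z else 0 := by
  rw [prob_congr fun F _ => h F,
    prob_comp μ (fun F => (decide (a ∈ F), decide (b ∈ F), decide (c ∈ F))) R]
  simp only [Fintype.sum_prod_type, trace₃]

theorem prob_trace₄ (μ : PMF (Finset E)) (a b c d : E) (P : Finset E → Prop)
    (R : Bool × Bool × Bool × Bool → Prop) [DecidablePred R]
    (h : ∀ F, P F ↔ R (decide (a ∈ F), decide (b ∈ F), decide (c ∈ F), decide (d ∈ F))) :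
    prob μ P = ∑ x, ∑ y, ∑ z, ∑ w, if R (x, y, z, w) then trace₄ μ a b c d x y z w else 0 := by
  rw [prob_congr fun F _ => h F,
    prob_comp μ (fun F => (decide (a ∈ F), decide (b ∈ F), decide (c ∈ F), decide (d ∈ F))) R]
  simp only [Fintype.sum_prod_type, trace₄]

theorem trace₃_nonneg (μ : PMF (Finset E)) (a b c : E) (x y z : Bool) :
    0 ≤ trace₃ μ a b c x y z := prob_nonneg _ _

theorem trace₄_nonneg (μ : PMF (Finset E)) (a b c d : E) (x y z w : Bool) :
    0 ≤ trace₄ μ a b c d x y z w := prob_nonneg _ _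

/-- The edge `a` is absent with probability `1/2`, and by negative correlation each other edge is
then present with joint probability at least `1/4`. The Rayleigh inequalities with `a` forced out
and one of the other edges forced in complete the input of `four_edge_bound`. -/
theorem IsMaxEntropyTree.four_edges (hN : (N : Set (Finset V)).PairwiseDisjoint id)
    (hne : N.Nonempty) (h : IsMaxEntropyTree ends N μ) {a b c d : E}
    (ha : a ∈ edgesBetween ends N) (hb : b ∈ edgesBetween ends N) (hc : c ∈ edgesBetween ends N)
    (hd : d ∈ edgesBetween ends N) (hab : a ≠ b) (hac : a ≠ c) (had : a ≠ d) (hbc : b ≠ c)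
    (hbd : b ≠ d) (hcd : c ≠ d)
    (hD : ∀ F ∈ μ.support, a ∈ F ∨ b ∈ F ∨ c ∈ F ∨ d ∈ F) :
    1 / 9 ≤ prob μ (fun F => a ∉ F ∧
      ((b ∈ F ∧ c ∈ F ∧ d ∉ F) ∨ (b ∈ F ∧ c ∉ F ∧ d ∈ F) ∨ (b ∉ F ∧ c ∈ F ∧ d ∈ F))) := by
  have hp := fun x y z w => trace₄_nonneg μ a b c d x y z w
  have h0 : trace₄ μ a b c d false false false false = 0 := by
    refine prob_eq_zero fun F hF h => ?_
    simp at h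
    have := hD F hF
    tauto
  have h1 := prob_eq_one (p := μ) (P := fun _ => True) fun _ _ => trivial
  have ma := h.prob_mem ha
  have mb := h.prob_mem hb
  have mc := h.prob_mem hc
  have md := h.prob_mem hd
  have nab := h.prob_mem_mem_le hN hne hab ha hb
  have nac := h.prob_mem_mem_le hN hne hac ha hc
  have nad := h.prob_mem_mem_le hN hne had ha hd
  have nbc := h.prob_mem_mem_le hN hne hbc hb hc
  have r2 := h.rayleigh_of_mem_of_notMem hN hne hcd b a
  have r3 := h.rayleigh_of_mem_of_notMem hN hne hbd c a
  have r4 := h.rayleigh_of_mem_of_notMem hN hne hbc d a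
  rw [prob_trace₄ μ a b c d _ (fun _ => True) (by simp)] at h1
  rw [prob_trace₄ μ a b c d _ (fun x => x.1 = true) (by simp)] at ma
  rw [prob_trace₄ μ a b c d _ (fun x => x.2.1 = true) (by simp)] at mb
  rw [prob_trace₄ μ a b c d _ (fun x => x.2.2.1 = true) (by simp)] at mc
  rw [prob_trace₄ μ a b c d _ (fun x => x.2.2.2 = true) (by simp)] at md
  rw [prob_trace₄ μ a b c d _ (fun x => x.1 = true ∧ x.2.1 = true) (by simp)] at nab
  rw [prob_trace₄ μ a b c d _ (fun x => x.1 = true ∧ x.2.2.1 = true) (by simp)] at nac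
  rw [prob_trace₄ μ a b c d _ (fun x => x.1 = true ∧ x.2.2.2 = true) (by simp)] at nad
  rw [prob_trace₄ μ a b c d _ (fun x => x.2.1 = true ∧ x.2.2.1 = true) (by simp)] at nbc
  rw [prob_trace₄ μ a b c d _ (fun x => x = (false, true, true, true)) (by simp; tauto),
    prob_trace₄ μ a b c d _ (fun x => x = (false, true, false, false)) (by simp; tauto),
    prob_trace₄ μ a b c d _ (fun x => x = (false, true, true, false)) (by simp; tauto),
    prob_trace₄ μ a b c d _ (fun x => x = (false, true, false, true)) (by simp; tauto)] at r2
  rw [prob_trace₄ μ a b c d _ (fun x => x = (false, true, true, true)) (by simp; tauto),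
    prob_trace₄ μ a b c d _ (fun x => x = (false, false, true, false)) (by simp; tauto),
    prob_trace₄ μ a b c d _ (fun x => x = (false, true, true, false)) (by simp; tauto),
    prob_trace₄ μ a b c d _ (fun x => x = (false, false, true, true)) (by simp; tauto)] at r3
  rw [prob_trace₄ μ a b c d _ (fun x => x = (false, true, true, true)) (by simp; tauto),
    prob_trace₄ μ a b c d _ (fun x => x = (false, false, false, true)) (by simp; tauto),
    prob_trace₄ μ a b c d _ (fun x => x = (false, true, false, true)) (by simp; tauto),
    prob_trace₄ μ a b c d _ (fun x => x = (false, false, true, true)) (by simp; tauto)] at r4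
  rw [prob_trace₄ μ a b c d _ (fun x => x = (false, true, true, false) ∨
    x = (false, true, false, true) ∨ x = (false, false, true, true)) (by simp; tauto)]
  simp at h1 ma mb mc md nab nac nad nbc r2 r3 r4 ⊢
  generalize trace₄ μ a b c d = q at *
  have := four_edge_bound (s₂ := q false true false false)
    (s₃ := q false false true false) (s₄ := q false false false true) (hp false true true false) (hp false true false true)
    (hp false false true true) (hp false true true true) (by linarith) (by linarith) (by linarith)
    (by linarith) (by linarith [hp true true true true, hp true true true false]) r2 r3 (by linarith)
  linarith

end Local


/-! ### Exactly one edge of a pair -/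

section Local

variable {V E : Type*} [Fintype V] [DecidableEq V] [Fintype E] [DecidableEq E]
variable {ends : E → Sym2 V} {N : Finset (Finset V)} {μ : PMF (Finset E)}

/-- Within each pair, neither edge is as likely as both, hence at most `1/4`. As the empty trace is
impossible, inclusion–exclusion makes the desired event at least as likely as the trace `{c, d}`.
The other two traces counted by `four_edges` lie in the event, so it has at least half of that
`1/9`. -/
theorem IsMaxEntropyTree.pairs_of_four (hN : (N : Set (Finset V)).PairwiseDisjoint id)
    (hne : N.Nonempty) (h : IsMaxEntropyTree ends N μ) {a b c d : E}
    (ha : a ∈ edgesBetween ends N) (hb : b ∈ edgesBetween ends N) (hc : c ∈ edgesBetween ends N)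
    (hd : d ∈ edgesBetween ends N) (hab : a ≠ b) (hac : a ≠ c) (had : a ≠ d) (hbc : b ≠ c)
    (hbd : b ≠ d) (hcd : c ≠ d)
    (hD : ∀ F ∈ μ.support, a ∈ F ∨ b ∈ F ∨ c ∈ F ∨ d ∈ F) :
    1 / 18 ≤ prob μ (fun F => (a ∈ F ↔ b ∉ F) ∧ (c ∈ F ↔ d ∉ F)) := by
  have hp := fun x y z w => trace₄_nonneg μ a b c d x y z w
  have h0 : trace₄ μ a b c d false false false false = 0 := by
    refine prob_eq_zero fun F hF h => ?_
    simp at h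
    have := hD F hF
    tauto
  have h1 := prob_eq_one (p := μ) (P := fun _ => True) fun _ _ => trivial
  have ma := h.prob_mem ha
  have mb := h.prob_mem hb
  have mc := h.prob_mem hc
  have md := h.prob_mem hd
  have nab := h.prob_mem_mem_le hN hne hab ha hb
  have ncd := h.prob_mem_mem_le hN hne hcd hc hd
  have key := h.four_edges hN hne ha hb hc hd hab hac had hbc hbd hcd hD
  rw [prob_trace₄ μ a b c d _ (fun _ => True) (by simp)] at h1
  rw [prob_trace₄ μ a b c d _ (fun x => x.1 = true) (by simp)] at ma
  rw [prob_trace₄ μ a b c d _ (fun x => x.2.1 = true) (by simp)] at mb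
  rw [prob_trace₄ μ a b c d _ (fun x => x.2.2.1 = true) (by simp)] at mc
  rw [prob_trace₄ μ a b c d _ (fun x => x.2.2.2 = true) (by simp)] at md
  rw [prob_trace₄ μ a b c d _ (fun x => x.1 = true ∧ x.2.1 = true) (by simp)] at nab
  rw [prob_trace₄ μ a b c d _ (fun x => x.2.2.1 = true ∧ x.2.2.2 = true) (by simp)] at ncd
  rw [prob_trace₄ μ a b c d _ (fun x => x = (false, true, true, false) ∨
    x = (false, true, false, true) ∨ x = (false, false, true, true)) (by simp; tauto)] at key
  rw [prob_trace₄ μ a b c d _ (fun x => x.1 ≠ x.2.1 ∧ x.2.2.1 ≠ x.2.2.2)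
    (by intro F; by_cases a ∈ F <;> by_cases b ∈ F <;> by_cases c ∈ F <;> by_cases d ∈ F <;>
      simp [*])]
  simp at h1 ma mb mc md nab ncd key ⊢
  generalize trace₄ μ a b c d = q at *
  linarith [hp true true true true, hp true true false false, hp false false true true,
    hp true false true false, hp true false false true]

theorem IsMaxEntropyTree.half_le_prob_exactly_one
    (hN : (N : Set (Finset V)).PairwiseDisjoint id) (hne : N.Nonempty)
    (h : IsMaxEntropyTree ends N μ) {a b : E} (ha : a ∈ edgesBetween ends N)
    (hb : b ∈ edgesBetween ends N) (hab : a ≠ b) :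
    1 / 2 ≤ prob μ (fun F => a ∈ F ↔ b ∉ F) := by
  have ma := h.prob_mem ha
  have mb := h.prob_mem hb
  have nab := h.prob_mem_mem_le hN hne hab ha hb
  -- Only two edges matter; the third coordinate repeats `a`.
  rw [prob_trace₃ μ a b a _ (fun x => x.1 = true) (by simp)] at ma
  rw [prob_trace₃ μ a b a _ (fun x => x.2.1 = true) (by simp)] at mb
  rw [prob_trace₃ μ a b a _ (fun x => x.1 = true ∧ x.2.1 = true) (by simp)] at nab
  rw [prob_trace₃ μ a b a _ (fun x => x.1 ≠ x.2.1)
    (by intro F; by_cases a ∈ F <;> by_cases b ∈ F <;> simp [*])]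
  simp at ma mb nab ⊢
  linarith

/-- When `c` is absent, which has probability `1/2`, one of `a`, `b` has to be present, and both are
present with probability at most `1/4`. -/
theorem IsMaxEntropyTree.three_edges_notMem (hN : (N : Set (Finset V)).PairwiseDisjoint id)
    (hne : N.Nonempty) (h : IsMaxEntropyTree ends N μ) {a b c : E}
    (ha : a ∈ edgesBetween ends N) (hb : b ∈ edgesBetween ends N) (hc : c ∈ edgesBetween ends N)
    (hab : a ≠ b) (hD : ∀ F ∈ μ.support, a ∈ F ∨ b ∈ F ∨ c ∈ F) :
    1 / 4 ≤ prob μ (fun F => (a ∈ F ↔ b ∉ F) ∧ c ∉ F) := by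
  have hp := fun x y z => trace₃_nonneg μ a b c x y z
  have h0 : trace₃ μ a b c false false false = 0 := by
    refine prob_eq_zero fun F hF h => ?_
    simp at h
    have := hD F hF
    tauto
  have h1 := prob_eq_one (p := μ) (P := fun _ => True) fun _ _ => trivial
  have mc := h.prob_mem hc
  have nab := h.prob_mem_mem_le hN hne hab ha hb
  rw [prob_trace₃ μ a b c _ (fun _ => True) (by simp)] at h1
  rw [prob_trace₃ μ a b c _ (fun x => x.2.2 = true) (by simp)] at mc
  rw [prob_trace₃ μ a b c _ (fun x => x.1 = true ∧ x.2.1 = true) (by simp)] at nab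
  rw [prob_trace₃ μ a b c _ (fun x => x.1 ≠ x.2.1 ∧ x.2.2 = false)
    (by intro F; by_cases a ∈ F <;> by_cases b ∈ F <;> simp [*])]
  simp at h1 mc nab ⊢
  linarith [hp true true true]

/-- By `hD`, the trace `{c}` is the event that `a` and `b` are both absent, which is as likely as
both being present. Both bounds by `1/4` and the Rayleigh inequality with `c` forced in feed
`three_edge_bound_of_mem`. -/
theorem IsMaxEntropyTree.three_edges_mem (hN : (N : Set (Finset V)).PairwiseDisjoint id)
    (hne : N.Nonempty) (h : IsMaxEntropyTree ends N μ) {a b c : E}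
    (ha : a ∈ edgesBetween ends N) (hb : b ∈ edgesBetween ends N) (hc : c ∈ edgesBetween ends N)
    (hab : a ≠ b) (hD : ∀ F ∈ μ.support, a ∈ F ∨ b ∈ F ∨ c ∈ F) :
    1 / 9 ≤ prob μ (fun F => (a ∈ F ↔ b ∉ F) ∧ c ∈ F) := by
  have hp := fun x y z => trace₃_nonneg μ a b c x y z
  have h0 : trace₃ μ a b c false false false = 0 := by
    refine prob_eq_zero fun F hF h => ?_
    simp at h
    have := hD F hF
    tauto
  have h1 := prob_eq_one (p := μ) (P := fun _ => True) fun _ _ => trivial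
  have ma := h.prob_mem ha
  have mb := h.prob_mem hb
  have mc := h.prob_mem hc
  have nab := h.prob_mem_mem_le hN hne hab ha hb
  have r := h.rayleigh_of_mem hN hne hab c
  rw [prob_trace₃ μ a b c _ (fun _ => True) (by simp)] at h1
  rw [prob_trace₃ μ a b c _ (fun x => x.1 = true) (by simp)] at ma
  rw [prob_trace₃ μ a b c _ (fun x => x.2.1 = true) (by simp)] at mb
  rw [prob_trace₃ μ a b c _ (fun x => x.2.2 = true) (by simp)] at mc
  rw [prob_trace₃ μ a b c _ (fun x => x.1 = true ∧ x.2.1 = true) (by simp)] at nab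
  rw [prob_trace₃ μ a b c _ (fun x => x = (true, true, true)) (by simp; tauto),
    prob_trace₃ μ a b c _ (fun x => x = (false, false, true)) (by simp; tauto),
    prob_trace₃ μ a b c _ (fun x => x = (true, false, true)) (by simp; tauto),
    prob_trace₃ μ a b c _ (fun x => x = (false, true, true)) (by simp; tauto)] at r
  rw [prob_trace₃ μ a b c _ (fun x => x.1 ≠ x.2.1 ∧ x.2.2 = true)
    (by intro F; by_cases a ∈ F <;> by_cases b ∈ F <;> simp [*])]
  simp at h1 ma mb mc nab r ⊢
  generalize trace₃ μ a b c = q at *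
  have := three_edge_bound_of_mem (x := q false false true) (y := q true true true) (hp true false true)
    (hp false true true) (by linarith) (by linarith) (by linarith [hp true true false]) r
  linarith

end Local

/-! ### Edge exchanges in spanning trees -/

section Exchange

variable {V E : Type*} [Fintype V] [DecidableEq V] [Fintype E] [DecidableEq E]
variable {ends : E → Sym2 V} {N : Finset (Finset V)} {μ : PMF (Finset E)}

/-- The edge to remove is the one by which the tree path from `A` to `B` leaves `A`: the rest of the
path never returns to `A`, so together with `e` it reconnects the ends of the removed edge. Both
exchanged edges are at `A`, so the degree there is preserved. -/
theorem IsSpanningTree.exists_exchange (hN : (N : Set (Finset V)).PairwiseDisjoint id)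
    {F : Finset E} (hF : IsSpanningTree ends N F) {A B : Finset V} (hA : A ∈ N) (hB : B ∈ N)
    (hAB : A ≠ B) {e : E} (he : Joins ends A B e) (heF : e ∉ F) :
    ∃ f ∈ F, (∃ C ∈ N, A ≠ C ∧ Joins ends A C f) ∧
      IsSpanningTree ends N (insert e (F.erase f)) := by
  obtain ⟨hsub, hconn, hcard⟩ := hF
  obtain ⟨u, rfl⟩ : ∃ u : {A // A ∈ N}, u.1 = A := ⟨⟨A, hA⟩, rfl⟩
  obtain ⟨v, rfl⟩ : ∃ v : {A // A ∈ N}, v.1 = B := ⟨⟨B, hB⟩, rfl⟩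
  have huv : u ≠ v := fun h => hAB (congrArg Subtype.val h)
  obtain ⟨p, hp⟩ := (hconn.preconnected u v).exists_isPath
  cases p with
  | nil => exact absurd rfl huv
  | @cons _ w _ hadj q =>
    rw [SimpleGraph.Walk.cons_isPath_iff] at hp
    obtain ⟨-, hu⟩ := hp
    have hadj' := hadj
    simp only [nodeGraph, SimpleGraph.fromRel_adj] at hadj'
    obtain ⟨huw, hf⟩ := hadj'
    obtain ⟨f, hfF, hf⟩ : ∃ f ∈ F, Joins ends u.1 w.1 f := by
      rcases hf with ⟨f, h1, h2⟩ | ⟨f, h1, h2⟩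
      · exact ⟨f, h1, h2⟩
      · exact ⟨f, h1, h2.symm⟩
    set F' := insert e (F.erase f) with hF'
    have hmem : ∀ g ∈ F, g ≠ f → g ∈ F' := fun g hg hgf =>
      Finset.mem_insert_of_mem (Finset.mem_erase.2 ⟨hgf, hg⟩)
    have hadjF' : ∀ x y : {A // A ∈ N}, x ≠ y → (∃ g ∈ F', Joins ends x.1 y.1 g) →
        (nodeGraph ends N F').Adj x y := by
      intro x y hxy h
      simp only [nodeGraph, SimpleGraph.fromRel_adj]
      exact ⟨hxy, Or.inl h⟩
    -- A walk that avoids `u` does not use `f`, which has `u` as an end, so it survives the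
    -- exchange.
    have hqr : ∀ x y (q : (nodeGraph ends N F).Walk x y), u ∉ q.support →
        (nodeGraph ends N F').Reachable x y := by
      intro x y q
      induction q with
      | nil => exact fun _ => SimpleGraph.Reachable.refl _
      | @cons x y z h q ih =>
        intro hu
        rw [SimpleGraph.Walk.support_cons, List.mem_cons, not_or] at hu
        refine SimpleGraph.Reachable.trans (SimpleGraph.Adj.reachable ?_) (ih hu.2)
        simp only [nodeGraph, SimpleGraph.fromRel_adj] at h
        have hy : u ≠ y := fun h => hu.2 (h ▸ q.start_mem_support)
        have key : ∀ g, (Joins ends x.1 y.1 g ∨ Joins ends y.1 x.1 g) → g ≠ f := by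
          rintro g hg rfl
          have : (u.1 = x.1 ∨ u.1 = y.1) := by
            rcases hg with hg | hg
            · rcases Joins.unique hN x.2 y.2 u.2 w.2 hg hf with h | h
              exacts [Or.inl h.1, Or.inr h.1]
            · rcases Joins.unique hN y.2 x.2 u.2 w.2 hg hf with h | h
              exacts [Or.inr h.1, Or.inl h.1]
          rcases this with h | h
          · exact hu.1 (Subtype.ext h)
          · exact hy (Subtype.ext h)
        refine hadjF' _ _ h.1 ?_
        rcases h.2 with ⟨g, hg, hJ⟩ | ⟨g, hg, hJ⟩
        · exact ⟨g, hmem g hg (key g (Or.inl hJ)), hJ⟩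
        · exact ⟨g, hmem g hg (key g (Or.inr hJ)), hJ.symm⟩
    have hwu : (nodeGraph ends N F').Reachable u w :=
      (hadjF' u v huv ⟨e, Finset.mem_insert_self _ _, he⟩).reachable.trans (hqr w v q hu).symm
    have hstep : ∀ x y : {A // A ∈ N}, (nodeGraph ends N F).Adj x y →
        (nodeGraph ends N F').Reachable x y := by
      intro x y h
      simp only [nodeGraph, SimpleGraph.fromRel_adj] at h
      obtain ⟨g, hg, hJ⟩ : ∃ g ∈ F, Joins ends x.1 y.1 g := by
        rcases h.2 with ⟨g, h1, h2⟩ | ⟨g, h1, h2⟩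
        · exact ⟨g, h1, h2⟩
        · exact ⟨g, h1, h2.symm⟩
      by_cases hgf : g = f
      · subst hgf
        rcases Joins.unique hN u.2 w.2 x.2 y.2 hf hJ with ⟨h1, h2⟩ | ⟨h1, h2⟩
        · rw [Subtype.ext h1, Subtype.ext h2]; exact hwu
        · rw [Subtype.ext h1, Subtype.ext h2]; exact hwu.symm
      · exact (hadjF' x y h.1 ⟨g, hmem g hg hgf, hJ⟩).reachable
    refine ⟨f, hfF, ⟨w.1, w.2, fun h => huw (Subtype.ext h), hf⟩, ?_, ?_, ?_⟩
    · intro g hg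
      rcases Finset.mem_insert.1 hg with rfl | hg
      · simp only [edgesBetween, Finset.mem_filter, Finset.mem_univ, true_and]
        exact ⟨u.1, hA, v.1, hB, hAB, he⟩
      · exact hsub (Finset.mem_of_mem_erase hg)
    · rw [SimpleGraph.connected_iff_exists_forall_reachable]
      refine ⟨u, fun y => ?_⟩
      have : ∀ x y (q : (nodeGraph ends N F).Walk x y), (nodeGraph ends N F').Reachable x y := by
        intro x y q
        induction q with
        | nil => exact SimpleGraph.Reachable.refl _
        | cons h _ ih => exact (hstep _ _ h).trans ih
      obtain ⟨q⟩ := hconn.preconnected u y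
      exact this u y q
    · have : e ∉ F.erase f := fun h => heF (Finset.mem_of_mem_erase h)
      rw [Finset.card_insert_of_notMem this, Finset.card_erase_of_mem hfF]
      have : 0 < F.card := Finset.card_pos.2 ⟨f, hfF⟩
      omega

/-- Exchanging an edge for a heavier one does not decrease the probability. -/
theorem IsTreeLaw.prob_le_of_exchange {w : E → ℝ} {c : ℝ} (h : IsTreeLaw ends N μ w c)
    {e f : E} (hwf : w f ≤ w e) {P Q : Finset E → Prop}
    (hPQ : ∀ F, IsSpanningTree ends N F → P F → e ∉ F ∧ f ∈ F ∧
      IsSpanningTree ends N (insert e (F.erase f)) ∧ Q (insert e (F.erase f))) :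
    prob μ P ≤ prob μ Q := by
  classical
  obtain ⟨hw, hc, hμ, hs⟩ := h
  have hz : ∀ F, ¬ IsSpanningTree ends N F → (μ F).toReal = 0 := by
    intro F hF
    rw [(μ.apply_eq_zero_iff F).2 fun h => hF (hs F h), ENNReal.toReal_zero]
  rw [prob_eq_sum, prob_eq_sum, ← Finset.sum_filter, ← Finset.sum_filter]
  set φ : Finset E → Finset E := fun F => insert e (F.erase f)
  set S := Finset.univ.filter fun F => P F ∧ IsSpanningTree ends N F
  calc ∑ F with P F, (μ F).toReal = ∑ F ∈ S, (μ F).toReal := by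
        symm
        refine Finset.sum_subset (fun F hF => ?_) fun F hF hF' => hz F fun h => hF' ?_
        · simp only [S, Finset.mem_filter] at hF ⊢; exact ⟨hF.1, hF.2.1⟩
        · simp only [S, Finset.mem_filter] at hF ⊢; exact ⟨hF.1, hF.2, h⟩
    -- The weights of `F` and `φ F` differ only in that the factor `w f` is replaced by `w e`.
    _ ≤ ∑ F ∈ S, (μ (φ F)).toReal := by
        refine Finset.sum_le_sum fun F hF => ?_
        simp only [S, Finset.mem_filter, Finset.mem_univ, true_and] at hF
        obtain ⟨heF, hfF, hT, -⟩ := hPQ F hF.2 hF.1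
        rw [hμ F hF.2, hμ _ hT, Finset.prod_insert fun h => heF (Finset.mem_of_mem_erase h),
          ← Finset.mul_prod_erase F w hfF]
        exact mul_le_mul_of_nonneg_left (mul_le_mul_of_nonneg_right hwf
          (Finset.prod_nonneg fun _ _ => hw _)) hc
    -- Injectivity: `F` is recovered from `φ F` by removing `e` and restoring `f`.
    _ = ∑ F ∈ S.image φ, (μ F).toReal := by
        rw [Finset.sum_image]
        intro F hF F' hF' hφ
        simp only [S, Finset.coe_filter, Finset.mem_univ, true_and, Set.mem_ofPred_eq] at hF hF'
        obtain ⟨heF, hfF, -⟩ := hPQ F hF.2 hF.1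
        obtain ⟨heF', hfF', -⟩ := hPQ F' hF'.2 hF'.1
        have h1 : (φ F).erase e = F.erase f :=
          Finset.erase_insert fun h => heF (Finset.mem_of_mem_erase h)
        have h2 : (φ F').erase e = F'.erase f :=
          Finset.erase_insert fun h => heF' (Finset.mem_of_mem_erase h)
        rw [← Finset.insert_erase hfF, ← Finset.insert_erase hfF', ← h1, ← h2, hφ]
    _ ≤ ∑ F with Q F, (μ F).toReal := by
        refine Finset.sum_le_sum_of_subset_of_nonneg (fun F hF => ?_)
          fun _ _ _ => ENNReal.toReal_nonneg
        obtain ⟨F₀, hF₀, rfl⟩ := Finset.mem_image.1 hF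
        simp only [S, Finset.mem_filter, Finset.mem_univ, true_and] at hF₀ ⊢
        exact (hPQ F₀ hF₀.2 hF₀.1).2.2.2

end Exchange


theorem prob_le_sum {α ι : Type*} [Fintype α] {p : PMF α} {P : α → Prop} {Q : ι → α → Prop}
    {s : Finset ι} (h : ∀ x ∈ p.support, P x → ∃ i ∈ s, Q i x) :
    prob p P ≤ ∑ i ∈ s, prob p (Q i) := by
  classical
  induction s using Finset.induction_on generalizing P with
  | empty => rw [prob_eq_zero fun x hx hP => by simpa using h x hx hP]; simp
  | insert i s hi ih =>
    rw [Finset.sum_insert hi]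
    refine (prob_le_add (R := fun x => ∃ i ∈ s, Q i x) fun x hx hP => ?_).trans
      (add_le_add le_rfl (ih fun x _ hx => hx))
    obtain ⟨j, hj, hQ⟩ := h x hx hP
    rcases Finset.mem_insert.1 hj with rfl | hj
    · exact Or.inl hQ
    · exact Or.inr ⟨j, hj, hQ⟩

/-! ### The heaviest edge at a node -/

section Star

variable {V E : Type*} [Fintype V] [DecidableEq V] [Fintype E] [DecidableEq E]
variable {ends : E → Sym2 V} {N : Finset (Finset V)} {μ : PMF (Finset E)}

/-- The edges from the node `A` to the other nodes in `N`. -/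
def nodeStar (ends : E → Sym2 V) (N : Finset (Finset V)) (A : Finset V) : Finset E :=
  Finset.univ.filter fun e => ∃ C ∈ N, A ≠ C ∧ Joins ends A C e

theorem mem_nodeStar {A : Finset V} {e : E} :
    e ∈ nodeStar ends N A ↔ ∃ C ∈ N, A ≠ C ∧ Joins ends A C e := by
  simp [nodeStar]

theorem nodeStar_subset {A : Finset V} (hA : A ∈ N) : nodeStar ends N A ⊆ edgesBetween ends N := by
  intro e he
  obtain ⟨C, hC, hne, hJ⟩ := mem_nodeStar.1 he
  simp only [edgesBetween, Finset.mem_filter, Finset.mem_univ, true_and]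
  exact ⟨A, hA, C, hC, hne, hJ⟩

theorem IsSpanningTree.exists_mem_nodeStar {F : Finset E} (hF : IsSpanningTree ends N F)
    {A B : Finset V} (hA : A ∈ N) (hB : B ∈ N) (hAB : A ≠ B) : ∃ e ∈ F, e ∈ nodeStar ends N A := by
  obtain ⟨u, rfl⟩ : ∃ u : {A // A ∈ N}, u.1 = A := ⟨⟨A, hA⟩, rfl⟩
  obtain ⟨v, rfl⟩ : ∃ v : {A // A ∈ N}, v.1 = B := ⟨⟨B, hB⟩, rfl⟩
  obtain ⟨p⟩ := hF.2.1.preconnected u v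
  cases p with
  | nil => exact absurd rfl hAB
  | @cons _ w _ h _ =>
    simp only [nodeGraph, SimpleGraph.fromRel_adj] at h
    have hne : u.1 ≠ w.1 := fun h' => h.1 (Subtype.ext h')
    rcases h.2 with ⟨e, he, hJ⟩ | ⟨e, he, hJ⟩
    · exact ⟨e, he, mem_nodeStar.2 ⟨w.1, w.2, hne, hJ⟩⟩
    · exact ⟨e, he, mem_nodeStar.2 ⟨w.1, w.2, hne, hJ.symm⟩⟩

/-- If `b` is the only tree edge at `A`, exchanging in the heavier edge `a` has to remove `b`. -/
theorem IsTreeLaw.prob_only_le {w : E → ℝ} {c₀ : ℝ} (hw : IsTreeLaw ends N μ w c₀)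
    (hN : (N : Set (Finset V)).PairwiseDisjoint id) {A : Finset V} (hA : A ∈ N) {a b c : E}
    (hab : a ≠ b) (hac : a ≠ c) (hbc : b ≠ c) (ha : a ∈ nodeStar ends N A)
    (hstar : ∀ f ∈ nodeStar ends N A, f = a ∨ f = b ∨ f = c) (hwb : w b ≤ w a) :
    prob μ (fun F => a ∉ F ∧ b ∈ F ∧ c ∉ F) ≤ prob μ (fun F => a ∈ F ∧ b ∉ F ∧ c ∉ F) := by
  refine hw.prob_le_of_exchange hwb fun F hF ⟨h1, h2, h3⟩ => ⟨h1, h2, ?_⟩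
  obtain ⟨B, hB, hAB, hJ⟩ := mem_nodeStar.1 ha
  obtain ⟨f, hfF, hf, hT⟩ := hF.exists_exchange hN hA hB hAB hJ h1
  obtain rfl : f = b := by
    rcases hstar f (mem_nodeStar.2 hf) with rfl | rfl | rfl
    exacts [absurd hfF h1, rfl, absurd hfF h3]
  refine ⟨hT, Finset.mem_insert_self _ _, ?_, ?_⟩
  · simp [hab.symm]
  · simp [hac.symm, h3]

/-- Since `a` is heaviest, the trace `{a}` is at least as likely as `{b}` and `{c}`. This supplies
the comparison hypotheses of `three_edge_bound`, in addition to the marginals and the Rayleigh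
inequalities. -/
theorem IsMaxEntropyTree.three_edges_of_max (hN : (N : Set (Finset V)).PairwiseDisjoint id)
    (hne : N.Nonempty) (h : IsMaxEntropyTree ends N μ) {w : E → ℝ} {c₀ : ℝ}
    (hw : IsTreeLaw ends N μ w c₀) {A : Finset V} (hA : A ∈ N) {a b c : E}
    (hab : a ≠ b) (hac : a ≠ c) (hbc : b ≠ c) (hstar : nodeStar ends N A = {a, b, c})
    (hwb : w b ≤ w a) (hwc : w c ≤ w a) (hD : ∀ F ∈ μ.support, a ∈ F ∨ b ∈ F ∨ c ∈ F) :
    1 / 9 ≤ prob μ (fun F => a ∉ F ∧ b ∈ F ∧ c ∈ F) := by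
  have hp := fun x y z => trace₃_nonneg μ a b c x y z
  have h0 : trace₃ μ a b c false false false = 0 := by
    refine prob_eq_zero fun F hF h => ?_
    simp at h
    have := hD F hF
    tauto
  have ha : a ∈ nodeStar ends N A := by simp [hstar]
  have hsub := nodeStar_subset (ends := ends) hA
  have h1 := prob_eq_one (p := μ) (P := fun _ => True) fun _ _ => trivial
  have ma := h.prob_mem (hsub ha)
  have mb := h.prob_mem (e := b) (hsub (by simp [hstar]))
  have mc := h.prob_mem (e := c) (hsub (by simp [hstar]))
  have m2 := hw.prob_only_le hN hA hab hac hbc ha (by simp [hstar]) hwb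
  have m3 := hw.prob_only_le hN hA hac hab hbc.symm ha (by simp [hstar]) hwc
  have r2 := h.rayleigh_of_mem hN hne hac b
  have r3 := h.rayleigh_of_mem hN hne hab c
  rw [prob_trace₃ μ a b c _ (fun _ => True) (by simp)] at h1
  rw [prob_trace₃ μ a b c _ (fun x => x.1 = true) (by simp)] at ma
  rw [prob_trace₃ μ a b c _ (fun x => x.2.1 = true) (by simp)] at mb
  rw [prob_trace₃ μ a b c _ (fun x => x.2.2 = true) (by simp)] at mc
  rw [prob_trace₃ μ a b c _ (fun x => x = (false, true, false)) (by simp),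
    prob_trace₃ μ a b c _ (fun x => x = (true, false, false)) (by simp)] at m2
  rw [prob_trace₃ μ a b c _ (fun x => x = (false, false, true)) (by simp; tauto),
    prob_trace₃ μ a b c _ (fun x => x = (true, false, false)) (by simp; tauto)] at m3
  rw [prob_trace₃ μ a b c _ (fun x => x = (true, true, true)) (by simp; tauto),
    prob_trace₃ μ a b c _ (fun x => x = (false, true, false)) (by simp; tauto),
    prob_trace₃ μ a b c _ (fun x => x = (true, true, false)) (by simp; tauto),
    prob_trace₃ μ a b c _ (fun x => x = (false, true, true)) (by simp; tauto)] at r2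
  rw [prob_trace₃ μ a b c _ (fun x => x = (true, true, true)) (by simp; tauto),
    prob_trace₃ μ a b c _ (fun x => x = (false, false, true)) (by simp; tauto),
    prob_trace₃ μ a b c _ (fun x => x = (true, false, true)) (by simp; tauto),
    prob_trace₃ μ a b c _ (fun x => x = (false, true, true)) (by simp; tauto)] at r3
  rw [prob_trace₃ μ a b c _ (fun x => x = (false, true, true)) (by simp)]
  simp at h1 ma mb mc m2 m3 r2 r3 ⊢
  generalize trace₃ μ a b c = q at *
  have := three_edge_bound (s₁ := q true false false) (s₂ := q false true false)
    (s₃ := q false false true) (z := q true true true) (hp _ _ _) (hp _ _ _) (hp _ _ _)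
    (hp true true false) (hp true false true) (by linarith) (by linarith) (by linarith)
    (by linarith) r2 r3 m2 m3
  linarith

/-- Exchanging the heaviest edge `e` at a node flips the parity of the degree of its other
endpoint. -/
theorem IsTreeLaw.prob_le_three_mul {w : E → ℝ} {c₀ : ℝ} (hw : IsTreeLaw ends N μ w c₀)
    (hN : (N : Set (Finset V)).PairwiseDisjoint id) {A B : Finset V} (hA : A ∈ N) (hB : B ∈ N)
    (hAB : A ≠ B) {e : E} (he : Joins ends A B e) (hcard : (nodeStar ends N A).card ≤ 4)
    (hother : ∀ f ∈ nodeStar ends N A, f ≠ e → f ∉ cut ends B) (heB : e ∈ cut ends B)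
    (hmax : ∀ f ∈ nodeStar ends N A, w f ≤ w e) (G : ℕ → Prop) (β : ℕ) (hβ : β < 2) :
    prob μ (fun F => e ∉ F ∧ G (F ∩ nodeStar ends N A).card) ≤
      3 * prob μ (fun F => G (F ∩ nodeStar ends N A).card ∧ (F ∩ cut ends B).card % 2 = β) := by
  classical
  set S := nodeStar ends N A
  have heS : e ∈ S := mem_nodeStar.2 ⟨B, hB, hAB, he⟩
  set Q : Finset E → Prop := fun F => G (F ∩ S).card ∧ (F ∩ cut ends B).card % 2 = β
  set P : E → Finset E → Prop := fun f F => (e ∉ F ∧ G (F ∩ S).card ∧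
    (F ∩ cut ends B).card % 2 ≠ β) ∧ f ∈ F ∧ IsSpanningTree ends N (insert e (F.erase f))
  -- Trees with the wrong parity at `B` are sorted by an edge `f` that can be exchanged for `e`; the
  -- same tree may be counted for several `f`, which only weakens the bound.
  have h1 : prob μ (fun F => (e ∉ F ∧ G (F ∩ S).card) ∧ ¬ (F ∩ cut ends B).card % 2 = β) ≤
      ∑ f ∈ S.erase e, prob μ (P f) := by
    refine prob_le_sum fun F hF ⟨⟨heF, hG⟩, hpar⟩ => ?_
    obtain ⟨f, hfF, hf, hT⟩ := (hw.2.2.2 F hF).exists_exchange hN hA hB hAB he heF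
    refine ⟨f, Finset.mem_erase.2 ⟨?_, mem_nodeStar.2 hf⟩, ⟨heF, hG, hpar⟩, hfF, hT⟩
    rintro rfl; exact heF hfF
  have h2 : ∀ f ∈ S.erase e, prob μ (P f) ≤ prob μ (fun F => Q F ∧ e ∈ F) := by
    intro f hf
    obtain ⟨hfe, hfS⟩ := Finset.mem_erase.1 hf
    refine hw.prob_le_of_exchange (hmax f hfS) fun F _ ⟨⟨heF, hG, hpar⟩, hfF, hT⟩ =>
      ⟨heF, hfF, hT, ⟨?_, ?_⟩, Finset.mem_insert_self _ _⟩
    · have : (insert e (F.erase f) ∩ S).card = (F ∩ S).card := by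
        rw [Finset.insert_inter_of_mem heS, Finset.erase_inter, Finset.card_insert_of_notMem,
          Finset.card_erase_of_mem (Finset.mem_inter.2 ⟨hfF, hfS⟩)]
        · have : 0 < (F ∩ S).card := Finset.card_pos.2 ⟨f, Finset.mem_inter.2 ⟨hfF, hfS⟩⟩
          omega
        · simp [heF]
      rw [this]; exact hG
    -- The edge `e` lies in the cut of `B` and `f` does not, so the exchange corrects the parity.
    · have : (insert e (F.erase f) ∩ cut ends B).card = (F ∩ cut ends B).card + 1 := by
        rw [Finset.insert_inter_of_mem heB, Finset.erase_inter, Finset.card_insert_of_notMem,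
          Finset.erase_eq_of_notMem]
        · simp [hother f hfS hfe]
        · simp [heF]
      rw [this]; omega
  have h3 : ∑ f ∈ S.erase e, prob μ (P f) ≤ 3 * prob μ (fun F => Q F ∧ e ∈ F) := by
    refine (Finset.sum_le_card_nsmul _ _ _ h2).trans ?_
    rw [nsmul_eq_mul]
    refine mul_le_mul_of_nonneg_right ?_ (prob_nonneg _ _)
    rw [Finset.card_erase_of_mem heS]
    exact_mod_cast (by omega : S.card - 1 ≤ 3)
  have h4 := prob_split μ (fun F => e ∉ F ∧ G (F ∩ S).card)
    (fun F => (F ∩ cut ends B).card % 2 = β)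
  have h5 := prob_split μ Q (fun F => e ∈ F)
  have h6 : prob μ (fun F => (e ∉ F ∧ G (F ∩ S).card) ∧ (F ∩ cut ends B).card % 2 = β) =
      prob μ (fun F => Q F ∧ e ∉ F) := prob_congr fun F _ => by simp only [Q]; tauto
  have h7 := prob_nonneg μ (fun F => Q F ∧ e ∉ F)
  -- Trees that already had the right parity are charged once to trees without `e`; the others are
  -- charged at most three times to trees with `e`.
  rw [h4, h5]
  linarith

theorem card_inter_eq_sum {E : Type*} [DecidableEq E] (F S : Finset E) :
    (F ∩ S).card = ∑ x ∈ S, if x ∈ F then 1 else 0 := by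
  rw [Finset.inter_comm, ← Finset.filter_mem_eq_inter, Finset.card_filter]

/-- Without `e`, even degree in a star of three means both other edges, the only case where the
maximality of `e` is needed; odd degree means exactly one of them. In a star of four, two of the
other three edges give even degree. Odd parity for four edges is not required: in the application no
edge of another level then meets the node cut. -/
theorem IsMaxEntropyTree.prob_parity_of_max (hN : (N : Set (Finset V)).PairwiseDisjoint id)
    (h : IsMaxEntropyTree ends N μ) {w : E → ℝ} {c₀ : ℝ}
    (hw : IsTreeLaw ends N μ w c₀) {A : Finset V} (hA : A ∈ N) {e : E}
    (he : e ∈ nodeStar ends N A) (hmax : ∀ f ∈ nodeStar ends N A, w f ≤ w e) (α : ℕ) (hα : α < 2)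
    (hcard : (nodeStar ends N A).card = 3 ∨ (nodeStar ends N A).card = 4 ∧ α = 0) :
    1 / 9 ≤ prob μ (fun F => e ∉ F ∧ (F ∩ nodeStar ends N A).card % 2 = α) := by
  have hne : N.Nonempty := ⟨A, hA⟩
  obtain ⟨B, hB, hAB, -⟩ := mem_nodeStar.1 he
  have hD : ∀ F ∈ μ.support, ∃ f ∈ F, f ∈ nodeStar ends N A := fun F hF =>
    (h.isSpanningTree hF).exists_mem_nodeStar hA hB hAB
  have hsub := nodeStar_subset (ends := ends) hA
  have herase := Finset.card_erase_of_mem he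
  have hins := Finset.insert_erase he
  rcases hcard with hcard | ⟨hcard, rfl⟩
  · rw [hcard] at herase
    obtain ⟨b, c, hbc, hS⟩ := Finset.card_eq_two.1 herase
    rw [hS] at hins
    have hb : b ∈ (nodeStar ends N A).erase e := by simp [hS]
    have hc : c ∈ (nodeStar ends N A).erase e := by simp [hS]
    have heb := (Finset.ne_of_mem_erase hb).symm
    have hec := (Finset.ne_of_mem_erase hc).symm
    replace hb := Finset.mem_of_mem_erase hb
    replace hc := Finset.mem_of_mem_erase hc
    have hc3 : ∀ F : Finset E, (F ∩ nodeStar ends N A).card =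
        (if e ∈ F then 1 else 0) + ((if b ∈ F then 1 else 0) + if c ∈ F then 1 else 0) := by
      intro F
      rw [card_inter_eq_sum, ← hins, Finset.sum_insert (by simp [heb, hec]),
        Finset.sum_insert (by simp [hbc]), Finset.sum_singleton]
    have hD' : ∀ F ∈ μ.support, e ∈ F ∨ b ∈ F ∨ c ∈ F := by
      intro F hF
      obtain ⟨f, hfF, hf⟩ := hD F hF
      rw [← hins] at hf
      simp only [Finset.mem_insert, Finset.mem_singleton] at hf
      rcases hf with rfl | rfl | rfl <;> simp [hfF]
    interval_cases α
    · refine (h.three_edges_of_max hN hne hw hA heb hec hbc hins.symm (hmax b hb) (hmax c hc)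
        hD').trans (prob_mono fun F _ ⟨h1, h2, h3⟩ => ⟨h1, ?_⟩)
      rw [hc3]; simp [h1, h2, h3]
    · refine le_trans (by norm_num) ((h.three_edges_notMem hN hne (hsub hb) (hsub hc) (hsub he)
        hbc fun F hF => ?_).trans (prob_mono fun F _ ⟨h1, h2⟩ => ⟨h2, ?_⟩))
      · have := hD' F hF; tauto
      · rw [hc3]
        by_cases h3 : b ∈ F
        · simp [h2, h3, h1.1 h3]
        · have : c ∈ F := by tauto
          simp [h2, h3, this]
  · rw [hcard] at herase
    obtain ⟨b, c, d, hbc, hbd, hcd, hS⟩ := Finset.card_eq_three.1 herase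
    rw [hS] at hins
    have hb : b ∈ (nodeStar ends N A).erase e := by simp [hS]
    have hc : c ∈ (nodeStar ends N A).erase e := by simp [hS]
    have hd : d ∈ (nodeStar ends N A).erase e := by simp [hS]
    have heb := (Finset.ne_of_mem_erase hb).symm
    have hec := (Finset.ne_of_mem_erase hc).symm
    have hed := (Finset.ne_of_mem_erase hd).symm
    replace hb := Finset.mem_of_mem_erase hb
    replace hc := Finset.mem_of_mem_erase hc
    replace hd := Finset.mem_of_mem_erase hd
    refine (h.four_edges hN hne (hsub he) (hsub hb) (hsub hc) (hsub hd) heb hec hed hbc hbd hcd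
      fun F hF => ?_).trans (prob_mono fun F _ ⟨h1, h2⟩ => ⟨h1, ?_⟩)
    · obtain ⟨f, hfF, hf⟩ := hD F hF
      rw [← hins] at hf
      simp only [Finset.mem_insert, Finset.mem_singleton] at hf
      rcases hf with rfl | rfl | rfl | rfl <;> simp [hfF]
    · rw [card_inter_eq_sum, ← hins, Finset.sum_insert (by simp [heb, hec, hed]),
        Finset.sum_insert (by simp [hbc, hbd]), Finset.sum_insert (by simp [hcd]),
        Finset.sum_singleton]
      rcases h2 with ⟨h2, h3, h4⟩ | ⟨h2, h3, h4⟩ | ⟨h2, h3, h4⟩ <;> simp [h1, h2, h3, h4]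

theorem IsMaxEntropyTree.prob_two_parities (hN : (N : Set (Finset V)).PairwiseDisjoint id)
    (h : IsMaxEntropyTree ends N μ) {w : E → ℝ} {c₀ : ℝ}
    (hw : IsTreeLaw ends N μ w c₀) {A B : Finset V} (hA : A ∈ N) (hB : B ∈ N) (hAB : A ≠ B)
    {e : E} (he : Joins ends A B e) (hmax : ∀ f ∈ nodeStar ends N A, w f ≤ w e)
    (hother : ∀ f ∈ nodeStar ends N A, f ≠ e → f ∉ cut ends B) (heB : e ∈ cut ends B)
    {α β : ℕ} (hα : α < 2) (hβ : β < 2)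
    (hcard : (nodeStar ends N A).card = 3 ∨ (nodeStar ends N A).card = 4 ∧ α = 0) :
    1 / 27 ≤ prob μ (fun F => (F ∩ nodeStar ends N A).card % 2 = α ∧
      (F ∩ cut ends B).card % 2 = β) := by
  have h1 := h.prob_parity_of_max hN hw hA (mem_nodeStar.2 ⟨B, hB, hAB, he⟩) hmax α hα hcard
  have h2 := hw.prob_le_three_mul hN hA hB hAB he (by omega) hother heB hmax (fun n => n % 2 = α)
    β hβ
  linarith

end Star


/-! ### Counting edges in cuts, and uncrossing -/

section Cuts

variable {V E : Type*} [Fintype V] [DecidableEq V] [Fintype E] [DecidableEq E]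

/-- The number of edges that join `A` and `B`. -/
def edgeCount (ends : E → Sym2 V) (A B : Finset V) : ℕ :=
  (Finset.univ.filter (Joins ends A B)).card

theorem joins_comm {ends : E → Sym2 V} {A B : Finset V} {e : E} :
    Joins ends A B e ↔ Joins ends B A e := ⟨Joins.symm, Joins.symm⟩

theorem edgeCount_comm (ends : E → Sym2 V) (A B : Finset V) :
    edgeCount ends A B = edgeCount ends B A := by
  simp only [edgeCount, joins_comm (A := A)]

theorem card_cut (ends : E → Sym2 V) (S : Finset V) :
    (cut ends S).card = edgeCount ends S Sᶜ := rfl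

theorem mem_cut {ends : E → Sym2 V} {S : Finset V} {e : E} {u v : V} (h : ends e = s(u, v)) :
    e ∈ cut ends S ↔ (u ∈ S ∧ v ∉ S) ∨ (u ∉ S ∧ v ∈ S) := by
  simp only [cut, Finset.mem_filter, Finset.mem_univ, true_and, Joins, Finset.mem_compl]
  constructor
  · rintro ⟨a, ha, b, hb, h'⟩
    rw [h, Sym2.eq_iff] at h'
    rcases h' with ⟨rfl, rfl⟩ | ⟨rfl, rfl⟩
    · exact Or.inl ⟨ha, hb⟩
    · exact Or.inr ⟨hb, ha⟩
  · rintro (⟨hu, hv⟩ | ⟨hu, hv⟩)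
    · exact ⟨u, hu, v, hv, h⟩
    · exact ⟨v, hv, u, hu, by rw [h, Sym2.eq_swap]⟩

theorem joins_union_right {ends : E → Sym2 V} {A B C : Finset V} {e : E} :
    Joins ends A (B ∪ C) e ↔ Joins ends A B e ∨ Joins ends A C e := by
  simp only [Joins, Finset.mem_union]
  constructor
  · rintro ⟨a, ha, b, hb | hb, h⟩
    · exact Or.inl ⟨a, ha, b, hb, h⟩
    · exact Or.inr ⟨a, ha, b, hb, h⟩
  · rintro (⟨a, ha, b, hb, h⟩ | ⟨a, ha, b, hb, h⟩)
    · exact ⟨a, ha, b, Or.inl hb, h⟩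
    · exact ⟨a, ha, b, Or.inr hb, h⟩

theorem not_joins_and_joins {ends : E → Sym2 V} {A B C : Finset V} (hAB : Disjoint A B)
    (hBC : Disjoint B C) {e : E} (h : Joins ends A B e) : ¬ Joins ends A C e := by
  rintro ⟨a', ha', c, hc, h'⟩
  obtain ⟨a, ha, b, hb, h⟩ := h
  rw [h, Sym2.eq_iff] at h'
  rcases h' with ⟨rfl, rfl⟩ | ⟨rfl, rfl⟩
  · exact Finset.disjoint_left.1 hBC hb hc
  · exact Finset.disjoint_left.1 hAB ha' hb

theorem edgeCount_union_right (ends : E → Sym2 V) {A B C : Finset V} (hAB : Disjoint A B)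
    (hBC : Disjoint B C) :
    edgeCount ends A (B ∪ C) = edgeCount ends A B + edgeCount ends A C := by
  rw [edgeCount, edgeCount, edgeCount, ← Finset.card_union_of_disjoint]
  · congr 1; ext e; simp [joins_union_right]
  · rw [Finset.disjoint_filter]
    exact fun e _ h => not_joins_and_joins hAB hBC h

theorem edgeCount_union_left (ends : E → Sym2 V) {A B C : Finset V} (hBC : Disjoint B C)
    (hAB : Disjoint A B) :
    edgeCount ends (B ∪ C) A = edgeCount ends B A + edgeCount ends C A := by
  rw [edgeCount_comm, edgeCount_union_right ends hAB hBC, edgeCount_comm ends A B,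
    edgeCount_comm ends A C]

theorem edgeCount_mono_right (ends : E → Sym2 V) (A : Finset V) {B C : Finset V} (h : B ⊆ C) :
    edgeCount ends A B ≤ edgeCount ends A C := by
  refine Finset.card_le_card fun e => ?_
  simp only [Finset.mem_filter, Finset.mem_univ, true_and]
  rintro ⟨a, ha, b, hb, h'⟩
  exact ⟨a, ha, b, h hb, h'⟩

theorem cut_compl (ends : E → Sym2 V) (S : Finset V) : cut ends Sᶜ = cut ends S := by
  ext e
  simp only [cut, Finset.mem_filter, Finset.mem_univ, true_and, compl_compl]
  exact joins_comm

theorem edgeCount_eq_sum (ends : E → Sym2 V) {A B : Finset V} (hAB : Disjoint A B) :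
    edgeCount ends A B =
      ∑ u ∈ A, ∑ w ∈ B, (Finset.univ.filter fun e => ends e = s(u, w)).card := by
  rw [← Finset.sum_product', edgeCount, ← Finset.card_biUnion]
  · congr 1
    ext e
    simp only [Finset.mem_filter, Finset.mem_univ, true_and, Finset.mem_biUnion,
      Finset.mem_product, Prod.exists, Joins]
    exact ⟨fun ⟨a, ha, b, hb, h⟩ => ⟨a, b, ⟨ha, hb⟩, h⟩, fun ⟨a, b, ⟨ha, hb⟩, h⟩ => ⟨a, ha, b, hb, h⟩⟩
  · rintro ⟨u, w⟩ h ⟨u', w'⟩ h' hne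
    simp only [Finset.coe_product, Set.mem_prod, Finset.mem_coe] at h h'
    rw [Function.onFun, Finset.disjoint_filter]
    rintro e - he he'
    rw [he, Sym2.eq_iff] at he'
    rcases he' with ⟨rfl, rfl⟩ | ⟨rfl, rfl⟩
    · exact hne rfl
    · exact Finset.disjoint_left.1 hAB h.1 h'.2

/-- A 4-regular, 4-edge-connected multigraph. -/
structure IsFourConnected (ends : E → Sym2 V) : Prop where
  four_le : ∀ S : Finset V, S.Nonempty → S ≠ Finset.univ → 4 ≤ (cut ends S).card
  degree : ∀ v, IsTight ends {v}

theorem IsHalfIntegralHeldKarp.isFourConnected {x : Sym2 V → ℝ} (hx : IsHalfIntegralHeldKarp x)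
    {ends : E → Sym2 V} (hG : IsSupportGraph x ends) : IsFourConnected ends := by
  have key : ∀ S : Finset V, ((cut ends S).card : ℝ) = 2 * ∑ u ∈ S, ∑ w ∈ Sᶜ, x s(u, w) := by
    intro S
    rw [card_cut, edgeCount_eq_sum ends disjoint_compl_right]
    push_cast
    rw [Finset.mul_sum]
    refine Finset.sum_congr rfl fun u _ => ?_
    rw [Finset.mul_sum]
    exact Finset.sum_congr rfl fun w _ => hG _
  refine ⟨fun S h1 h2 => ?_, fun v => ?_⟩
  · have := key S
    have := hx.subtour S h1 h2
    exact_mod_cast (by linarith : (4 : ℝ) ≤ (cut ends S).card)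
  · have h1 := key {v}
    have h2 := hx.degree v
    rw [← Finset.add_sum_erase _ _ (Finset.mem_univ v), hx.diag, zero_add] at h2
    rw [Finset.sum_singleton, Finset.compl_eq_univ_sdiff,
      Finset.sdiff_singleton_eq_erase, h2] at h1
    unfold IsTight
    exact_mod_cast (by linarith : ((cut ends {v}).card : ℝ) = 4)

variable {ends : E → Sym2 V}

theorem IsTight.compl {S : Finset V} (h : IsTight ends S) : IsTight ends Sᶜ := by
  rw [IsTight, cut_compl]; exact h

/-- The cut sizes of `X` and `Y` add up to those of `X ∩ Y` and `(X ∪ Y)ᶜ` plus twice the number of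
edges between the two differences. The total is eight and each of the two corners needs four. -/
theorem uncross (hG : IsFourConnected ends) {X Y : Finset V} (hX : IsTight ends X)
    (hY : IsTight ends Y) (hXY : Crosses X Y) :
    IsTight ends (X ∩ Y) ∧ edgeCount ends (X \ Y) (Y \ X) = 0 := by
  obtain ⟨h1, h2, h3, h4⟩ := hXY
  set P := X ∩ Y with hP
  set Q := X \ Y with hQ
  set R := Y \ X with hR
  set W := (X ∪ Y)ᶜ with hW
  have dPQ : Disjoint P Q := Finset.disjoint_left.2 fun v => by simp [P, Q]; tauto
  have dPR : Disjoint P R := Finset.disjoint_left.2 fun v => by simp [P, R]; tauto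
  have dPW : Disjoint P W := Finset.disjoint_left.2 fun v => by simp [P, W]; tauto
  have dQR : Disjoint Q R := Finset.disjoint_left.2 fun v => by simp [Q, R]; tauto
  have dQW : Disjoint Q W := Finset.disjoint_left.2 fun v => by simp [Q, W]; tauto
  have dRW : Disjoint R W := Finset.disjoint_left.2 fun v => by simp [R, W]; tauto
  have eX : X = P ∪ Q := by ext v; simp [P, Q]; tauto
  have eXc : Xᶜ = R ∪ W := by ext v; simp [R, W]; tauto
  have eY : Y = P ∪ R := by ext v; simp [P, R]; tauto
  have eYc : Yᶜ = Q ∪ W := by ext v; simp [Q, W]; tauto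
  have eP : Pᶜ = Q ∪ (R ∪ W) := by ext v; simp [P, Q, R, W]; tauto
  have eQ : Qᶜ = P ∪ (R ∪ W) := by ext v; simp [P, Q, R, W]; tauto
  have eR : Rᶜ = P ∪ (Q ∪ W) := by ext v; simp [P, Q, R, W]; tauto
  have eW : Wᶜ = P ∪ (Q ∪ R) := by ext v; simp [P, Q, R, W]; tauto
  have nu : ∀ {S : Finset V}, Sᶜ.Nonempty → S ≠ Finset.univ := by
    rintro S h rfl; simp at h
  have cP := hG.four_le P h3 (nu (by rw [eP]; exact h1.mono Finset.subset_union_left))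
  have cQ := hG.four_le Q h1 (nu (by rw [eQ]; exact h3.mono Finset.subset_union_left))
  have cR := hG.four_le R h2 (nu (by rw [eR]; exact h3.mono Finset.subset_union_left))
  have cW := hG.four_le W h4 (nu (by rw [eW]; exact h3.mono Finset.subset_union_left))
  have tX : edgeCount ends (P ∪ Q) (R ∪ W) = 4 := by rw [← eX, ← eXc]; exact hX
  have tY : edgeCount ends (P ∪ R) (Q ∪ W) = 4 := by rw [← eY, ← eYc]; exact hY
  rw [card_cut, eP, edgeCount_union_right ends dPQ (Finset.disjoint_union_right.2 ⟨dQR, dQW⟩),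
    edgeCount_union_right ends dPR dRW] at cP
  rw [card_cut, eQ, edgeCount_union_right ends dPQ.symm (Finset.disjoint_union_right.2 ⟨dPR, dPW⟩),
    edgeCount_union_right ends dQR dRW, edgeCount_comm ends Q P] at cQ
  rw [card_cut, eR, edgeCount_union_right ends dPR.symm (Finset.disjoint_union_right.2 ⟨dPQ, dPW⟩),
    edgeCount_union_right ends dQR.symm dQW, edgeCount_comm ends R P, edgeCount_comm ends R Q] at cR
  rw [card_cut, eW, edgeCount_union_right ends dPW.symm (Finset.disjoint_union_right.2 ⟨dPQ, dPR⟩),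
    edgeCount_union_right ends dQW.symm dQR, edgeCount_comm ends W P, edgeCount_comm ends W Q,
    edgeCount_comm ends W R] at cW
  rw [edgeCount_union_right ends (Finset.disjoint_union_left.2 ⟨dPR, dQR⟩) dRW,
    edgeCount_union_left ends dPQ dPR.symm, edgeCount_union_left ends dPQ dPW.symm] at tX
  rw [edgeCount_union_right ends (Finset.disjoint_union_left.2 ⟨dPQ, dQR.symm⟩) dQW,
    edgeCount_union_left ends dPR dPQ.symm, edgeCount_union_left ends dPR dPW.symm,
    edgeCount_comm ends R Q] at tY
  refine ⟨?_, by omega⟩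
  rw [IsTight, card_cut, eP, edgeCount_union_right ends dPQ (Finset.disjoint_union_right.2 ⟨dQR, dQW⟩),
    edgeCount_union_right ends dPR dRW]
  omega

end Cuts


/-! ### Partitions into tight sets: simple or doubled multigraphs, and parity -/

section Partition

variable {V E : Type*} [Fintype V] [DecidableEq V] [Fintype E] [DecidableEq E]

/-- `N` is a partition of the vertex set into tight sets. -/
structure IsTightPartition (ends : E → Sym2 V) (N : Finset (Finset V)) : Prop where
  disj : (N : Set (Finset V)).PairwiseDisjoint id
  nonempty : ∀ A ∈ N, A.Nonempty
  cover : ∀ v, ∃ A ∈ N, v ∈ A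
  tight : ∀ A ∈ N, IsTight ends A

variable {ends : E → Sym2 V} {N : Finset (Finset V)}

theorem IsTightPartition.eq_of_mem (h : IsTightPartition ends N) {A B : Finset V} (hA : A ∈ N)
    (hB : B ∈ N) {v : V} (hvA : v ∈ A) (hvB : v ∈ B) : A = B := by
  by_contra hne
  exact Finset.disjoint_left.1 (h.disj hA hB hne) hvA hvB

theorem IsTightPartition.disjoint (h : IsTightPartition ends N) {A B : Finset V} (hA : A ∈ N)
    (hB : B ∈ N) (hne : A ≠ B) : Disjoint A B := h.disj hA hB hne

theorem IsTightPartition.exists_subset (h : IsTightPartition ends N) {X : Finset V}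
    (hX : IsNodeSet N X) {v : V} (hv : v ∈ X) : ∃ A ∈ N, v ∈ A ∧ A ⊆ X := by
  obtain ⟨A, hA, hvA⟩ := h.cover v
  refine ⟨A, hA, hvA, (hX A hA).resolve_right fun hd => Finset.disjoint_left.1 hd hvA hv⟩

theorem IsNodeSet.compl {X : Finset V} (hX : IsNodeSet N X) : IsNodeSet N Xᶜ := by
  intro A hA
  rcases hX A hA with h | h
  · exact Or.inr (Finset.disjoint_left.2 fun v hv => by simpa using h hv)
  · exact Or.inl fun v hv => Finset.mem_compl.2 (Finset.disjoint_left.1 h hv)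

theorem IsNodeSet.inter {X Y : Finset V} (hX : IsNodeSet N X) (hY : IsNodeSet N Y) :
    IsNodeSet N (X ∩ Y) := by
  intro A hA
  rcases hX A hA with h | h
  · rcases hY A hA with h' | h'
    · exact Or.inl (Finset.subset_inter h h')
    · exact Or.inr (h'.mono_right Finset.inter_subset_right)
  · exact Or.inr (h.mono_right Finset.inter_subset_left)

theorem IsTightPartition.isNodeSet (h : IsTightPartition ends N) {A : Finset V} (hA : A ∈ N) :
    IsNodeSet N A := by
  intro B hB
  by_cases hne : B = A
  · exact Or.inl hne.le
  · exact Or.inr (h.disjoint hB hA hne)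

theorem Crosses.compl_right {X Y : Finset V} (h : Crosses X Y) : Crosses X Yᶜ := by
  obtain ⟨h1, h2, h3, h4⟩ := h
  refine ⟨?_, ?_, ?_, ?_⟩
  · obtain ⟨v, hv⟩ := h3; exact ⟨v, by simp at hv ⊢; tauto⟩
  · obtain ⟨v, hv⟩ := h4; exact ⟨v, by simp at hv ⊢; tauto⟩
  · obtain ⟨v, hv⟩ := h1; exact ⟨v, by simp at hv ⊢; tauto⟩
  · obtain ⟨v, hv⟩ := h2; exact ⟨v, by simp at hv ⊢; tauto⟩

/-- Every proper minimum cut of the multigraph on the node set `N` is crossed by another one. -/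
def AllCrossed (ends : E → Sym2 V) (N : Finset (Finset V)) : Prop :=
  ∀ X, IsNodeSet N X → IsTight ends X → IsProper N X →
    ∃ Y, IsNodeSet N Y ∧ IsTight ends Y ∧ Crosses X Y

theorem IsTightPartition.card_cut_union (h : IsTightPartition ends N) {A B : Finset V}
    (hA : A ∈ N) (hB : B ∈ N) (hAB : A ≠ B) :
    edgeCount ends A (A ∪ B)ᶜ + edgeCount ends A B = 4 ∧
    (cut ends (A ∪ B)).card + 2 * edgeCount ends A B = 8 := by
  have hd := h.disjoint hA hB hAB
  have dA : Disjoint A (A ∪ B)ᶜ := Finset.disjoint_left.2 fun v => by simp; tauto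
  have dB : Disjoint B (A ∪ B)ᶜ := Finset.disjoint_left.2 fun v => by simp; tauto
  have eA : Aᶜ = B ∪ (A ∪ B)ᶜ := by
    ext v; have : v ∈ A → v ∉ B := fun h => Finset.disjoint_left.1 hd h
    simp; tauto
  have eB : Bᶜ = A ∪ (A ∪ B)ᶜ := by
    ext v; have : v ∈ A → v ∉ B := fun h => Finset.disjoint_left.1 hd h
    simp; tauto
  have tA : edgeCount ends A Aᶜ = 4 := h.tight A hA
  have tB : edgeCount ends B Bᶜ = 4 := h.tight B hB
  rw [eA, edgeCount_union_right ends hd dB] at tA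
  rw [eB, edgeCount_union_right ends hd.symm dA, edgeCount_comm ends B A] at tB
  rw [card_cut, edgeCount_union_left ends hd dA.symm]
  omega

theorem IsTightPartition.edgeCount_add_le (h : IsTightPartition ends N) {A B C D : Finset V}
    (hA : A ∈ N) (hB : B ∈ N) (hC : C ∈ N) (hD : D ∈ N) (hAB : A ≠ B) (hAC : A ≠ C) (hAD : A ≠ D)
    (hBC : B ≠ C) (hBD : B ≠ D) (hCD : C ≠ D) :
    edgeCount ends A B + edgeCount ends A C + edgeCount ends A D ≤ 4 := by
  have t : edgeCount ends A Aᶜ = 4 := h.tight A hA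
  rw [← edgeCount_union_right ends (h.disjoint hA hB hAB) (h.disjoint hB hC hBC),
    ← edgeCount_union_right ends (Finset.disjoint_union_right.2
      ⟨h.disjoint hA hB hAB, h.disjoint hA hC hAC⟩) (Finset.disjoint_union_left.2
      ⟨h.disjoint hB hD hBD, h.disjoint hC hD hCD⟩), ← t]
  refine edgeCount_mono_right _ _ fun v hv => Finset.mem_compl.2 fun hvA => ?_
  simp only [Finset.mem_union] at hv
  rcases hv with (hv | hv) | hv
  · exact hAB (h.eq_of_mem hA hB hvA hv)
  · exact hAC (h.eq_of_mem hA hC hvA hv)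
  · exact hAD (h.eq_of_mem hA hD hvA hv)

/-- The double edge makes `A ∪ B` tight, and the complement receives the other two edges at `A`.
Among the tight node sets avoiding `A` and `B` and receiving exactly two edges from `A`, a smallest
one must be a single node: otherwise it is crossed, and uncrossing yields a smaller one. -/
theorem IsTightPartition.exists_next (h : IsTightPartition ends N) (hG : IsFourConnected ends)
    (hN : 3 ≤ N.card) (hcr : AllCrossed ends N) {A B : Finset V} (hA : A ∈ N) (hB : B ∈ N)
    (hAB : A ≠ B) (hd : 2 ≤ edgeCount ends A B) :
    edgeCount ends A B = 2 ∧ ∃ C ∈ N, C ≠ A ∧ C ≠ B ∧ edgeCount ends A C = 2 := by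
  classical
  obtain ⟨h1, h2⟩ := h.card_cut_union hA hB hAB
  obtain ⟨D, hD, hDAB⟩ : ∃ D ∈ N, D ∉ ({A, B} : Finset (Finset V)) := by
    by_contra! hsub
    have := Finset.card_le_card hsub
    have := Finset.card_le_two (a := A) (b := B)
    omega
  simp only [Finset.mem_insert, Finset.mem_singleton, not_or] at hDAB
  set Z₀ := (A ∪ B)ᶜ with hZ₀
  have hDZ : D ⊆ Z₀ := by
    intro v hv
    simp only [Z₀, Finset.mem_compl, Finset.mem_union, not_or]
    exact ⟨fun hvA => hDAB.1 (h.eq_of_mem hD hA hv hvA), fun hvB => hDAB.2 (h.eq_of_mem hD hB hv hvB)⟩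
  have hZne : Z₀.Nonempty := (h.nonempty D hD).mono hDZ
  have hcut : 4 ≤ (cut ends (A ∪ B)).card := by
    refine hG.four_le _ ((h.nonempty A hA).mono Finset.subset_union_left) fun he => ?_
    rw [hZ₀, he] at hZne
    simp at hZne
  have hd2 : edgeCount ends A B = 2 := by omega
  refine ⟨hd2, ?_⟩
  set 𝒵 : Finset (Finset V) := Finset.univ.filter fun Z => Z.Nonempty ∧ IsNodeSet N Z ∧
    Disjoint A Z ∧ Disjoint B Z ∧ edgeCount ends A Z = 2 ∧ IsTight ends Z with h𝒵
  have hne : 𝒵.Nonempty := by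
    refine ⟨Z₀, ?_⟩
    simp only [h𝒵, Finset.mem_filter, Finset.mem_univ, true_and]
    refine ⟨hZne, ?_, ?_, ?_, by omega, ?_⟩
    · rw [hZ₀, Finset.compl_union]
      exact (h.isNodeSet hA).compl.inter (h.isNodeSet hB).compl
    · exact Finset.disjoint_left.2 fun v => by simp [Z₀]; tauto
    · exact Finset.disjoint_left.2 fun v => by simp [Z₀]; tauto
    · have : IsTight ends (A ∪ B) := by unfold IsTight; omega
      exact this.compl
  obtain ⟨Z, hZ, hmin⟩ := Finset.exists_min_image 𝒵 Finset.card hne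
  simp only [h𝒵, Finset.mem_filter, Finset.mem_univ, true_and] at hZ hmin
  obtain ⟨⟨v, hv⟩, hZN, hAZ, hBZ, hdZ, hZt⟩ := hZ
  obtain ⟨C, hC, hvC, hCZ⟩ := h.exists_subset hZN hv
  have hCA : C ≠ A := by rintro rfl; exact Finset.disjoint_left.1 hAZ hvC hv
  have hCB : C ≠ B := by rintro rfl; exact Finset.disjoint_left.1 hBZ hvC hv
  by_cases hZC : Z ⊆ C
  · obtain rfl : Z = C := Finset.Subset.antisymm hZC hCZ
    exact ⟨Z, hC, hCA, hCB, hdZ⟩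
  exfalso
  obtain ⟨v', hv', hv'C⟩ := Finset.not_subset.1 hZC
  obtain ⟨C', hC', hvC', hCZ'⟩ := h.exists_subset hZN hv'
  have hCC' : C ≠ C' := by rintro rfl; exact hv'C hvC'
  have hprop : IsProper N Z := by
    constructor
    · rw [← Finset.card_pair hCC']
      exact Finset.card_le_card fun X hX => by
        simp only [Finset.mem_insert, Finset.mem_singleton] at hX
        rcases hX with rfl | rfl <;> simp [*]
    · rw [← Finset.card_pair hAB]
      exact Finset.card_le_card fun X hX => by
        simp only [Finset.mem_insert, Finset.mem_singleton] at hX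
        rcases hX with rfl | rfl <;> simp [*]
  -- Complementing `Y` preserves crossing, so `A` may be assumed to lie inside it.
  obtain ⟨Y, hYN, hYt, hY, hAY⟩ : ∃ Y, IsNodeSet N Y ∧ IsTight ends Y ∧ Crosses Z Y ∧ A ⊆ Y := by
    obtain ⟨Y, hYN, hYt, hY⟩ := hcr Z hZN hZt hprop
    rcases hYN A hA with h' | h'
    · exact ⟨Y, hYN, hYt, hY, h'⟩
    · refine ⟨Yᶜ, hYN.compl, hYt.compl, hY.compl_right, fun v hv => ?_⟩
      exact Finset.mem_compl.2 (Finset.disjoint_left.1 h' hv)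
  obtain ⟨hPt, hQR⟩ := uncross hG hZt hYt hY
  -- As `A` lies in `Y \ Z`, uncrossing excludes edges from `A` to `Z \ Y`; both edges from `A` to
  -- `Z` therefore end in `Z ∩ Y`.
  have hQA : edgeCount ends A (Z \ Y) = 0 := by
    have : A ⊆ Y \ Z := fun v hv =>
      Finset.mem_sdiff.2 ⟨hAY hv, Finset.disjoint_left.1 hAZ hv⟩
    have := edgeCount_mono_right ends (Z \ Y) this
    rw [edgeCount_comm]; omega
  have hsplit : edgeCount ends A Z = edgeCount ends A (Z ∩ Y) + edgeCount ends A (Z \ Y) := by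
    rw [← edgeCount_union_right ends (hAZ.mono_right Finset.inter_subset_left)]
    · congr 1; ext v; simp; tauto
    · exact Finset.disjoint_left.2 fun v => by simp; tauto
  have := hmin (Z ∩ Y) ⟨hY.2.2.1, hZN.inter hYN, hAZ.mono_right Finset.inter_subset_left,
    hBZ.mono_right Finset.inter_subset_left, by omega, hPt⟩
  have hlt : (Z ∩ Y).card < Z.card := by
    refine Finset.card_lt_card ⟨Finset.inter_subset_left, fun hsub => ?_⟩
    obtain ⟨v, hv⟩ := hY.1
    simp only [Finset.mem_sdiff] at hv
    exact hv.2 (Finset.mem_inter.1 (hsub hv.1)).2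
  omega

/-- A node on a double edge has two double neighbours, which use up its degree four. So having a
double edge propagates to all neighbours, and by connectivity to all nodes. -/
theorem IsTightPartition.dichotomy (h : IsTightPartition ends N) (hG : IsFourConnected ends)
    (hN : 3 ≤ N.card) (hcr : AllCrossed ends N) :
    (∀ A ∈ N, ∀ B ∈ N, A ≠ B → edgeCount ends A B ≤ 1) ∨
      ∀ A ∈ N, ∀ B ∈ N, A ≠ B → edgeCount ends A B = 0 ∨ edgeCount ends A B = 2 := by
  classical
  by_cases hpar : ∃ A ∈ N, ∃ B ∈ N, A ≠ B ∧ 2 ≤ edgeCount ends A B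
  swap
  · left
    intro A hA B hB hAB
    by_contra! hlt
    exact hpar ⟨A, hA, B, hB, hAB, hlt⟩
  right
  have good : ∀ A ∈ N, (∃ B ∈ N, A ≠ B ∧ 2 ≤ edgeCount ends A B) → ∀ D ∈ N, A ≠ D →
      edgeCount ends A D = 0 ∨ edgeCount ends A D = 2 := by
    rintro A hA ⟨B, hB, hAB, hd⟩ D hD hAD
    obtain ⟨hd2, C, hC, hCA, hCB, hdC⟩ := h.exists_next hG hN hcr hA hB hAB hd
    by_cases hDB : D = B
    · subst hDB; exact Or.inr hd2
    by_cases hDC : D = C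
    · subst hDC; exact Or.inr hdC
    have := h.edgeCount_add_le hA hB hC hD hAB hCA.symm hAD hCB.symm (Ne.symm hDB) (Ne.symm hDC)
    omega
  set H := N.filter fun A => ∃ B ∈ N, A ≠ B ∧ 2 ≤ edgeCount ends A B with hH
  have hall : ∀ A ∈ N, A ∈ H := by
    by_contra! hex
    obtain ⟨A₁, hA₁, hA₁H⟩ := hex
    obtain ⟨A₀, hA₀, hp⟩ := hpar
    have hA₀H : A₀ ∈ H := Finset.mem_filter.2 ⟨hA₀, hp⟩
    set X := H.biUnion id with hX
    have hmem : ∀ A ∈ N, ∀ v ∈ A, v ∈ X → A ∈ H := by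
      intro A hA v hv hvX
      obtain ⟨A', hA', hv'⟩ := Finset.mem_biUnion.1 hvX
      rwa [h.eq_of_mem hA (Finset.mem_filter.1 hA').1 hv hv']
    have hcut : 4 ≤ (cut ends X).card := by
      refine hG.four_le X ((h.nonempty A₀ hA₀).mono fun v hv => Finset.mem_biUnion.2
        ⟨A₀, hA₀H, hv⟩) fun hu => ?_
      obtain ⟨v, hv⟩ := h.nonempty A₁ hA₁
      exact hA₁H (hmem A₁ hA₁ v hv (hu ▸ Finset.mem_univ v))
    obtain ⟨e, he⟩ := Finset.card_pos.1 (by omega : 0 < (cut ends X).card)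
    simp only [cut, Finset.mem_filter, Finset.mem_univ, true_and] at he
    obtain ⟨a, ha, b, hb, hab⟩ := he
    obtain ⟨A, hA, haA⟩ := Finset.mem_biUnion.1 ha
    obtain ⟨B, hB, hbB⟩ := h.cover b
    obtain ⟨hAN, hAp⟩ := Finset.mem_filter.1 hA
    have hAB : A ≠ B := by
      rintro rfl
      exact Finset.mem_compl.1 hb (Finset.mem_biUnion.2 ⟨A, hA, hbB⟩)
    have hpos : 0 < edgeCount ends A B := Finset.card_pos.2
      ⟨e, by simp only [Finset.mem_filter, Finset.mem_univ, true_and]; exact ⟨a, haA, b, hbB, hab⟩⟩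
    have h2 := good A hAN hAp B hB hAB
    have hBH : B ∈ H := Finset.mem_filter.2 ⟨hB, A, hAN, hAB.symm, by
      rw [edgeCount_comm]; omega⟩
    exact Finset.mem_compl.1 hb (Finset.mem_biUnion.2 ⟨B, hBH, hbB⟩)
  exact fun A hA => good A hA (Finset.mem_filter.1 (hall A hA)).2

/-- A cut at a node consists of the edges to the other nodes. -/
theorem IsTightPartition.card_inter_cut (h : IsTightPartition ends N) (T : Finset E) {A : Finset V}
    (hA : A ∈ N) : (T ∩ cut ends A).card =
      ∑ B ∈ N.erase A, (T ∩ Finset.univ.filter (Joins ends A B)).card := by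
  rw [← Finset.card_biUnion]
  · congr 1
    ext e
    simp only [cut, Finset.mem_inter, Finset.mem_filter, Finset.mem_univ, true_and,
      Finset.mem_biUnion, Finset.mem_erase]
    constructor
    · rintro ⟨heT, a, ha, b, hb, hab⟩
      obtain ⟨B, hB, hbB⟩ := h.cover b
      refine ⟨B, ⟨?_, hB⟩, heT, a, ha, b, hbB, hab⟩
      rintro rfl; exact Finset.mem_compl.1 hb hbB
    · rintro ⟨B, ⟨hBA, hB⟩, heT, a, ha, b, hb, hab⟩
      refine ⟨heT, a, ha, b, Finset.mem_compl.2 fun hbA => hBA (h.eq_of_mem hB hA hb hbA), hab⟩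
  · intro B hB C hC hBC
    simp only [Finset.coe_erase, Set.mem_sdiff, Finset.mem_coe, Set.mem_singleton_iff] at hB hC
    rw [Function.onFun, Finset.disjoint_left]
    intro e he he'
    simp only [Finset.mem_inter, Finset.mem_filter, Finset.mem_univ, true_and] at he he'
    exact not_joins_and_joins (h.disjoint hA hB.1 (Ne.symm hB.2)) (h.disjoint hB.1 hC.1 hBC)
      he.2 he'.2

/-- In a doubled cycle, all cuts at nodes are even if the set contains an odd number of edges of
each parallel pair. -/
theorem IsTightPartition.even_inter_cut (h : IsTightPartition ends N)
    (hdbl : ∀ A ∈ N, ∀ B ∈ N, A ≠ B → edgeCount ends A B = 0 ∨ edgeCount ends A B = 2)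
    {T : Finset E} {A : Finset V} (hA : A ∈ N)
    (hT : ∀ B ∈ N, A ≠ B → edgeCount ends A B = 2 →
      Odd (T ∩ Finset.univ.filter (Joins ends A B)).card) :
    Even (T ∩ cut ends A).card := by
  classical
  have h4 := h.card_inter_cut Finset.univ hA
  rw [Finset.univ_inter, h.tight A hA] at h4
  simp only [Finset.univ_inter] at h4
  have hsum : ∀ B ∈ N.erase A, (T ∩ Finset.univ.filter (Joins ends A B)).card % 2 =
      if edgeCount ends A B = 2 then 1 else 0 := by
    intro B hB
    obtain ⟨hBA, hB⟩ := Finset.mem_erase.1 hB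
    split_ifs with hc
    · exact Nat.odd_iff.1 (hT B hB (Ne.symm hBA) hc)
    · have h0 := (hdbl A hA B hB (Ne.symm hBA)).resolve_right hc
      rw [edgeCount, Finset.card_eq_zero] at h0
      simp [h0]
  -- Degree four means exactly two double neighbours; two odd numbers have an even sum.
  have hcnt : 4 = 2 * ∑ B ∈ N.erase A, if edgeCount ends A B = 2 then 1 else 0 := by
    rw [h4, Finset.mul_sum]
    refine Finset.sum_congr rfl fun B hB => ?_
    obtain ⟨hBA, hB⟩ := Finset.mem_erase.1 hB
    have := hdbl A hA B hB (Ne.symm hBA)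
    simp only [edgeCount] at this ⊢
    rcases this with hc | hc <;> simp [hc]
  rw [Nat.even_iff, h.card_inter_cut T hA, Finset.sum_nat_mod, Finset.sum_congr rfl hsum]
  omega

/-- An edge is in the cut iff exactly one end is in `S`. Modulo two this is a sum of indicators of
`S`, so the parity of a cut is additive over disjoint unions. -/
theorem card_inter_cut_mod_two (T : Finset E) (S : Finset V) (p q : E → V)
    (hpq : ∀ e, ends e = s(p e, q e)) :
    ((T ∩ cut ends S).card : ZMod 2) =
      ∑ e ∈ T, ((if p e ∈ S then 1 else 0) + if q e ∈ S then 1 else 0) := by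
  rw [← Finset.filter_mem_eq_inter, Finset.card_filter]
  push_cast
  refine Finset.sum_congr rfl fun e _ => ?_
  have := mem_cut (S := S) (hpq e)
  by_cases h1 : p e ∈ S <;> by_cases h2 : q e ∈ S <;> simp [this, h1, h2]
  decide

/-- A cut is even if the cuts at all nodes are even. -/
theorem IsTightPartition.isEvenCut_of_forall (h : IsTightPartition ends N) {T : Finset E}
    (hT : ∀ A ∈ N, IsEvenCut ends T A) {X : Finset V} (hX : IsNodeSet N X) :
    IsEvenCut ends T X := by
  classical
  have hex : ∀ e, ∃ p : V × V, ends e = s(p.1, p.2) := fun e => by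
    induction h : ends e with | _ u v => exact ⟨(u, v), rfl⟩
  choose p hp using hex
  have key := fun S => card_inter_cut_mod_two (ends := ends) T S (fun e => (p e).1)
    (fun e => (p e).2) hp
  have hv : ∀ v, ((if v ∈ X then 1 else 0 : ZMod 2)) =
      ∑ A ∈ N.filter (· ⊆ X), if v ∈ A then 1 else 0 := by
    intro v
    by_cases hvX : v ∈ X
    · obtain ⟨A, hA, hvA, hAX⟩ := h.exists_subset hX hvX
      rw [Finset.sum_eq_single A]
      · simp [hvX, hvA]
      · intro B hB hBA
        rw [if_neg]
        exact fun hvB => hBA (h.eq_of_mem (Finset.mem_filter.1 hB).1 hA hvB hvA)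
      · intro hA'
        exact absurd (Finset.mem_filter.2 ⟨hA, hAX⟩) hA'
    · rw [Finset.sum_eq_zero, if_neg hvX]
      intro B hB
      rw [if_neg]
      exact fun hvB => hvX ((Finset.mem_filter.1 hB).2 hvB)
  have h0 : ((T ∩ cut ends X).card : ZMod 2) = 0 := by
    rw [key X]
    simp_rw [hv, ← Finset.sum_add_distrib]
    rw [Finset.sum_comm]
    refine Finset.sum_eq_zero fun A hA => ?_
    rw [← key A]
    exact (ZMod.natCast_eq_zero_iff_even).2 (hT A (Finset.mem_filter.1 hA).1)
  exact (ZMod.natCast_eq_zero_iff_even).1 h0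

end Partition


/-! ### The laminar family of critical sets -/

section Hierarchy

variable {V E : Type*} [Fintype V] [DecidableEq V] [Fintype E] [DecidableEq E]

theorem mem_criticalSets {L : List (Finset V)} {A : Finset V} :
    A ∈ criticalSets L ↔ A ∈ L ∨ ∃ v, A = {v} := by
  simp only [criticalSets, Finset.mem_union, List.mem_toFinset, Finset.mem_image, Finset.mem_univ,
    true_and, eq_comm]

theorem mem_nodesIn {L : List (Finset V)} {A R : Finset V} :
    A ∈ nodesIn L R ↔ A ∈ criticalSets L ∧ A ⊂ R ∧ ∀ B ∈ criticalSets L, A ⊂ B → ¬ B ⊂ R := by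
  simp [nodesIn]

theorem exists_node_above {L : List (Finset V)} {A R : Finset V} (hA : A ∈ criticalSets L)
    (hAR : A ⊂ R) : ∃ B ∈ nodesIn L R, A ⊆ B := by
  obtain ⟨B, hB, hmax⟩ := Finset.exists_max_image
    ((criticalSets L).filter fun B => A ⊆ B ∧ B ⊂ R) Finset.card
    ⟨A, Finset.mem_filter.2 ⟨hA, Finset.Subset.refl _, hAR⟩⟩
  obtain ⟨hBc, hAB, hBR⟩ := Finset.mem_filter.1 hB
  refine ⟨B, mem_nodesIn.2 ⟨hBc, hBR, fun C hC hBC hCR => ?_⟩, hAB⟩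
  have := hmax C (Finset.mem_filter.2 ⟨hC, hAB.trans hBC.1, hCR⟩)
  have := Finset.card_lt_card hBC
  omega

theorem exists_node_mem {L : List (Finset V)} {R : Finset V} (hR : 2 ≤ R.card) {v : V}
    (hv : v ∈ R) : ∃ A ∈ nodesIn L R, v ∈ A := by
  obtain ⟨B, hB, hvB⟩ := exists_node_above (L := L) (A := {v}) (R := R)
    (mem_criticalSets.2 (Or.inr ⟨v, rfl⟩)) ⟨by simpa using hv, fun h => by
      have := Finset.card_le_card h
      simp at this; omega⟩
  exact ⟨B, hB, by simpa using hvB⟩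

/-- The invariants of the family of selected sets. -/
structure IsHierarchy (ends : E → Sym2 V) (ePlus : E) (L : List (Finset V)) : Prop where
  ne_univ : ∀ A ∈ criticalSets L, A ≠ Finset.univ
  nonempty : ∀ A ∈ criticalSets L, A.Nonempty
  tight : ∀ A ∈ criticalSets L, IsTight ends A
  laminar : ∀ A ∈ criticalSets L, ∀ B ∈ criticalSets L, A ⊆ B ∨ B ⊆ A ∨ Disjoint A B
  nodup : L.Nodup
  avoid : ∀ S ∈ L, ePlus ∉ edgesIn ends S
  two_le : ∀ S ∈ L, 2 ≤ S.card

variable {ends : E → Sym2 V} {ePlus : E} {L : List (Finset V)}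

theorem IsHierarchy.nodes_disjoint (h : IsHierarchy ends ePlus L) {R A B : Finset V}
    (hA : A ∈ nodesIn L R) (hB : B ∈ nodesIn L R) (hAB : A ≠ B) : Disjoint A B := by
  obtain ⟨hA1, hA2, hA3⟩ := mem_nodesIn.1 hA
  obtain ⟨hB1, hB2, hB3⟩ := mem_nodesIn.1 hB
  rcases h.laminar A hA1 B hB1 with h' | h' | h'
  · exact absurd hB2 (hA3 B hB1 (h'.ssubset_of_ne hAB))
  · exact absurd hA2 (hB3 A hA1 (h'.ssubset_of_ne hAB.symm))
  · exact h'

theorem IsHierarchy.pairwiseDisjoint (h : IsHierarchy ends ePlus L) (R : Finset V) :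
    (nodesIn L R : Set (Finset V)).PairwiseDisjoint id :=
  fun _ hA _ hB hAB => h.nodes_disjoint hA hB hAB

theorem IsHierarchy.isTightPartition_currentNodes (h : IsHierarchy ends ePlus L)
    (hV : 3 ≤ Fintype.card V) : IsTightPartition ends (currentNodes L) where
  disj := h.pairwiseDisjoint _
  nonempty A hA := h.nonempty A (mem_nodesIn.1 hA).1
  cover v := exists_node_mem (by rw [Finset.card_univ]; omega) (Finset.mem_univ v)
  tight A hA := h.tight A (mem_nodesIn.1 hA).1

/-- A set of current nodes contains or avoids every critical set. -/
theorem IsHierarchy.subset_or_disjoint (h : IsHierarchy ends ePlus L) {S A : Finset V}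
    (hS : IsNodeSet (currentNodes L) S) (hA : A ∈ criticalSets L) : A ⊆ S ∨ Disjoint A S := by
  obtain ⟨B, hB, hAB⟩ := exists_node_above hA
    ((Finset.subset_univ A).ssubset_of_ne (h.ne_univ A hA))
  rcases hS B hB with h' | h'
  · exact Or.inl (hAB.trans h')
  · exact Or.inr (h'.mono_left hAB)

/-- A critical set lies inside a single current node, whereas a proper set contains two. -/
theorem IsHierarchy.notMem_criticalSets (h : IsHierarchy ends ePlus L) {S : Finset V}
    (hS : IsNodeSet (currentNodes L) S) (hp : IsProper (currentNodes L) S) :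
    S ∉ criticalSets L := by
  intro hSc
  obtain ⟨B, hB, hSB⟩ := exists_node_above hSc
    ((Finset.subset_univ S).ssubset_of_ne (h.ne_univ S hSc))
  have hBS : B ⊆ S := (hS B hB).resolve_right fun hd => by
    obtain ⟨v, hv⟩ := h.nonempty S hSc
    exact Finset.disjoint_left.1 hd (hSB hv) hv
  have hsub : (currentNodes L).filter (· ⊆ S) ⊆ {B} := by
    intro A hA
    obtain ⟨hA, hAS⟩ := Finset.mem_filter.1 hA
    rw [Finset.mem_singleton]
    by_contra hne
    obtain ⟨v, hv⟩ := h.nonempty A (mem_nodesIn.1 hA).1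
    exact Finset.disjoint_left.1 (h.nodes_disjoint hA hB hne) hv (hSB (hAS hv))
  have := Finset.card_le_card hsub
  have := hp.1
  simp at *
  omega

theorem criticalSets_cons (S : Finset V) (L : List (Finset V)) :
    criticalSets (S :: L) = insert S (criticalSets L) := by
  ext A; simp [mem_criticalSets, or_assoc]

theorem IsHierarchy.cons (h : IsHierarchy ends ePlus L) {S : Finset V}
    (hS : IsUncrossedProperTight ends L S) (he : ePlus ∉ edgesIn ends S) :
    IsHierarchy ends ePlus (S :: L) := by
  obtain ⟨hN, hp, ht, -⟩ := hS
  have hnode : ∀ A ∈ currentNodes L, A.Nonempty := fun A hA => h.nonempty A (mem_nodesIn.1 hA).1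
  obtain ⟨A, hA, B, hB, hAB⟩ := Finset.one_lt_card.1 (show 1 < _ from hp.1)
  obtain ⟨hA, hAS⟩ := Finset.mem_filter.1 hA
  obtain ⟨hB, hBS⟩ := Finset.mem_filter.1 hB
  obtain ⟨C, hC⟩ := Finset.card_pos.1 (lt_of_lt_of_le two_pos hp.2)
  obtain ⟨hC, hCS⟩ := Finset.mem_filter.1 hC
  obtain ⟨a, ha⟩ := hnode A hA
  obtain ⟨b, hb⟩ := hnode B hB
  obtain ⟨c, hc⟩ := hnode C hC
  have hab : a ≠ b := by
    rintro rfl; exact Finset.disjoint_left.1 (h.nodes_disjoint hA hB hAB) ha hb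
  constructor
  · intro X hX
    rw [criticalSets_cons, Finset.mem_insert] at hX
    rcases hX with rfl | hX
    · rintro rfl
      exact Finset.disjoint_left.1 hCS hc (Finset.mem_univ c)
    · exact h.ne_univ X hX
  · intro X hX
    rw [criticalSets_cons, Finset.mem_insert] at hX
    rcases hX with rfl | hX
    · exact ⟨a, hAS ha⟩
    · exact h.nonempty X hX
  · intro X hX
    rw [criticalSets_cons, Finset.mem_insert] at hX
    rcases hX with rfl | hX
    · exact ht
    · exact h.tight X hX
  · intro X hX Y hY
    rw [criticalSets_cons, Finset.mem_insert] at hX hY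
    rcases hX with rfl | hX <;> rcases hY with rfl | hY
    · exact Or.inl (Finset.Subset.refl _)
    · rcases h.subset_or_disjoint hN hY with h' | h'
      exacts [Or.inr (Or.inl h'), Or.inr (Or.inr h'.symm)]
    · rcases h.subset_or_disjoint hN hX with h' | h'
      exacts [Or.inl h', Or.inr (Or.inr h')]
    · exact h.laminar X hX Y hY
  · refine List.nodup_cons.2 ⟨fun hSL => ?_, h.nodup⟩
    exact h.notMem_criticalSets hN hp (mem_criticalSets.2 (Or.inl hSL))
  · intro X hX
    rcases List.mem_cons.1 hX with rfl | hX
    exacts [he, h.avoid X hX]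
  · intro X hX
    rcases List.mem_cons.1 hX with rfl | hX
    · rw [← Finset.card_pair hab]
      refine Finset.card_le_card fun v hv => ?_
      simp only [Finset.mem_insert, Finset.mem_singleton] at hv
      rcases hv with rfl | rfl
      exacts [hAS ha, hBS hb]
    · exact h.two_le X hX

theorem IsRun.isHierarchy (hG : IsFourConnected ends) (hV : 3 ≤ Fintype.card V) :
    ∀ {L : List (Finset V)}, IsRun ends ePlus L → IsHierarchy ends ePlus L
  | [], _ => by
    have hc : ∀ A ∈ criticalSets ([] : List (Finset V)), ∃ v, A = {v} := fun A hA => by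
      simpa [mem_criticalSets] using hA
    refine ⟨?_, ?_, ?_, ?_, List.nodup_nil, by simp, by simp⟩
    · intro A hA hu
      obtain ⟨v, rfl⟩ := hc A hA
      have := congrArg Finset.card hu
      rw [Finset.card_univ, Finset.card_singleton] at this
      omega
    · intro A hA
      obtain ⟨v, rfl⟩ := hc A hA
      simp
    · intro A hA
      obtain ⟨v, rfl⟩ := hc A hA
      exact hG.degree v
    · intro A hA B hB
      obtain ⟨v, rfl⟩ := hc A hA
      obtain ⟨w, rfl⟩ := hc B hB
      by_cases h : v = w <;> simp [h]
  | S :: L, h => (IsRun.isHierarchy hG hV h.1).cons h.2.prop.1 h.2.prop.2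

/-- The situation in which the set `R` was selected. -/
theorem IsRun.exists_selection (hG : IsFourConnected ends) (hV : 3 ≤ Fintype.card V)
    {R : Finset V} : ∀ {L : List (Finset V)}, IsRun ends ePlus L → R ∈ L →
      ∃ L₂, IsRun ends ePlus L₂ ∧ Minimal (fun S' => IsUncrossedProperTight ends L₂ S' ∧
        ePlus ∉ edgesIn ends S') R ∧ nodesIn L R = (currentNodes L₂).filter (· ⊆ R)
  | S :: L, h, hR => by
    have hL := IsRun.isHierarchy hG hV h.1
    have hSL := IsRun.isHierarchy hG hV h
    obtain ⟨hN, hp, -⟩ := h.2.prop.1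
    have hSc : S ∈ criticalSets (S :: L) := mem_criticalSets.2 (Or.inl (List.mem_cons_self))
    rcases List.mem_cons.1 hR with rfl | hR'
    · refine ⟨L, h.1, h.2, ?_⟩
      have hRc := hL.notMem_criticalSets hN hp
      ext A
      simp only [Finset.mem_filter, mem_nodesIn, currentNodes, criticalSets_cons,
        Finset.mem_insert]
      constructor
      · rintro ⟨hA, hAR, hmax⟩
        have hA : A ∈ criticalSets L := hA.resolve_left hAR.ne
        refine ⟨⟨hA, (Finset.subset_univ A).ssubset_of_ne (hL.ne_univ A hA), ?_⟩, hAR.1⟩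
        intro B hB hAB _
        have hBR : B ⊆ R := (hL.subset_or_disjoint hN hB).resolve_right fun hd => by
          obtain ⟨v, hv⟩ := hL.nonempty A hA
          exact Finset.disjoint_left.1 hd (hAB.1 hv) (hAR.1 hv)
        refine hmax B (Or.inr hB) hAB (hBR.ssubset_of_ne ?_)
        rintro rfl; exact hRc hB
      · rintro ⟨⟨hA, -, hmax⟩, hAR⟩
        refine ⟨Or.inr hA, hAR.ssubset_of_ne (by rintro rfl; exact hRc hA), ?_⟩
        rintro B (rfl | hB) hAB hBR
        · exact hBR.ne rfl
        · exact hmax B hB hAB ((Finset.subset_univ B).ssubset_of_ne (hL.ne_univ B hB))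
    · obtain ⟨L₂, h1, h2, h3⟩ := IsRun.exists_selection hG hV h.1 hR'
      refine ⟨L₂, h1, h2, ?_⟩
      rw [← h3]
      -- A set selected after `R` contains or avoids `R`, so it is never strictly inside, and the
      -- children of `R` remain those at the time of its selection.
      have hSR : ¬ S ⊂ R := by
        intro hSR
        rcases hL.subset_or_disjoint hN (mem_criticalSets.2 (Or.inl hR')) with h' | h'
        · exact hSR.2 h'
        · obtain ⟨v, hv⟩ := hSL.nonempty S hSc
          exact Finset.disjoint_left.1 h' (hSR.1 hv) hv
      ext A
      simp only [mem_nodesIn, criticalSets_cons, Finset.mem_insert]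
      constructor
      · rintro ⟨hA, hAR, hmax⟩
        refine ⟨hA.resolve_left ?_, hAR, fun B hB => hmax B (Or.inr hB)⟩
        rintro rfl; exact hSR hAR
      · rintro ⟨hA, hAR, hmax⟩
        refine ⟨Or.inr hA, hAR, ?_⟩
        rintro B (rfl | hB) hAB hBR
        exacts [hSR hBR, hmax B hB hAB hBR]

theorem IsHierarchy.exists_parent (h : IsHierarchy ends ePlus L) {S : Finset V}
    (hS : S ∈ criticalSets L) : ∃ R, (R ∈ L ∨ R = Finset.univ) ∧ S ∈ nodesIn L R := by
  obtain ⟨R, hR, hmin⟩ := Finset.exists_min_image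
    (Finset.univ.filter fun R => (R ∈ L ∨ R = Finset.univ) ∧ S ⊂ R) Finset.card
    ⟨Finset.univ, by simpa using (Finset.subset_univ S).ssubset_of_ne (h.ne_univ S hS)⟩
  simp only [Finset.mem_filter, Finset.mem_univ, true_and] at hR hmin
  refine ⟨R, hR.1, mem_nodesIn.2 ⟨hS, hR.2, fun B hB hSB hBR => ?_⟩⟩
  -- A singleton has no nonempty proper subset, so a critical set strictly above `S` is a selected
  -- one.
  have hBL : B ∈ L := (mem_criticalSets.1 hB).resolve_right fun ⟨v, hv⟩ => by
    subst hv
    obtain ⟨w, hw⟩ := h.nonempty S hS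
    exact hSB.2 (by simpa [← Finset.mem_singleton.1 (hSB.1 hw)] using hw)
  have := hmin B ⟨Or.inl hBL, hSB⟩
  have := Finset.card_lt_card hBR
  omega

theorem IsHierarchy.laminar_root (h : IsHierarchy ends ePlus L) {A R : Finset V}
    (hA : A ∈ criticalSets L) (hR : R ∈ L ∨ R = Finset.univ) : A ⊆ R ∨ R ⊆ A ∨ Disjoint A R := by
  rcases hR with hR | rfl
  · exact h.laminar A hA R (mem_criticalSets.2 (Or.inl hR))
  · exact Or.inl (Finset.subset_univ A)

/-- A critical set strictly above the child `A` contains all of `R` by the maximality of `A`, and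
hence contains `v` as well. -/
theorem IsHierarchy.isHighest (h : IsHierarchy ends ePlus L) {R A B : Finset V}
    (hR : R ∈ L ∨ R = Finset.univ) (hA : A ∈ nodesIn L R) (hB : B ∈ nodesIn L R) (hAB : A ≠ B)
    {u v : V} (hu : u ∈ A) (hv : v ∈ B) : IsHighest L u v A := by
  obtain ⟨hA1, hA2, hA3⟩ := mem_nodesIn.1 hA
  obtain ⟨hB1, hB2, hB3⟩ := mem_nodesIn.1 hB
  refine ⟨⟨hA1, hu, fun hvA => Finset.disjoint_left.1 (h.nodes_disjoint hA hB hAB) hvA hv⟩, ?_⟩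
  rintro S ⟨hS, huS, hvS⟩
  rcases h.laminar S hS A hA1 with h' | h' | h'
  · exact h'
  · by_cases hne : A = S
    · exact hne ▸ le_rfl
    have hAS := h'.ssubset_of_ne hne
    rcases h.laminar_root hS hR with h'' | h'' | h''
    · by_cases hSR : S = R
      · exact absurd (hSR ▸ hB2.1 hv) hvS
      · exact absurd (h''.ssubset_of_ne hSR) (hA3 S hS hAS)
    · exact absurd (h'' (hB2.1 hv)) hvS
    · exact absurd (hA2.1 hu) (Finset.disjoint_left.1 h'' huS)
  · exact absurd hu (Finset.disjoint_left.1 h' huS)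

theorem IsHierarchy.isLowestCommon (h : IsHierarchy ends ePlus L) {R A B : Finset V}
    (hR : R ∈ L ∨ R = Finset.univ) (hA : A ∈ nodesIn L R) (hB : B ∈ nodesIn L R) :
    IsLowestCommon L A B R := by
  refine ⟨⟨hR, hA, hB⟩, ?_⟩
  rintro R' ⟨hR', hA', hB'⟩
  obtain ⟨hA1, hA2, hA3⟩ := mem_nodesIn.1 hA
  obtain ⟨-, hA2', hA3'⟩ := mem_nodesIn.1 hA'
  rcases hR' with hR'L | rfl
  swap
  · exact Finset.subset_univ R
  have hR'c : R' ∈ criticalSets L := mem_criticalSets.2 (Or.inl hR'L)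
  rcases h.laminar_root hR'c hR with h' | h' | h'
  · by_cases hne : R' = R
    · exact hne ▸ le_rfl
    · exact absurd (h'.ssubset_of_ne hne) (hA3 R' hR'c hA2')
  · exact h'
  · obtain ⟨v, hv⟩ := h.nonempty A hA1
    exact absurd (hA2.1 hv) (Finset.disjoint_left.1 h' (hA2'.1 hv))

theorem mem_edgesBetween {N : Finset (Finset V)} {e : E} :
    e ∈ edgesBetween ends N ↔ ∃ A ∈ N, ∃ B ∈ N, A ≠ B ∧ Joins ends A B e := by
  simp [edgesBetween]

/-- Every edge belongs to one level of the hierarchy. -/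
theorem IsHierarchy.level_unique (h : IsHierarchy ends ePlus L) {R R' : Finset V}
    (hR : R ∈ L ∨ R = Finset.univ) (hR' : R' ∈ L ∨ R' = Finset.univ) {e : E}
    (he : e ∈ edgesBetween ends (nodesIn L R)) (he' : e ∈ edgesBetween ends (nodesIn L R')) :
    R = R' := by
  obtain ⟨A, hA, B, hB, hAB, a, ha, b, hb, hab⟩ := mem_edgesBetween.1 he
  have key : ∀ A' ∈ nodesIn L R', ∀ B' ∈ nodesIn L R', A' ≠ B' → a ∈ A' → b ∈ B' → R = R' := by
    intro A' hA' B' hB' hAB' ha' hb'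
    obtain rfl := (h.isHighest hR hA hB hAB ha hb).unique (h.isHighest hR' hA' hB' hAB' ha' hb')
    obtain rfl := (h.isHighest hR hB hA hAB.symm hb ha).unique
      (h.isHighest hR' hB' hA' hAB'.symm hb' ha')
    exact (h.isLowestCommon hR hA hB).unique (h.isLowestCommon hR' hA' hB')
  obtain ⟨A', hA', B', hB', hAB', a', ha', b', hb', hab'⟩ := mem_edgesBetween.1 he'
  rw [hab, Sym2.eq_iff] at hab'
  rcases hab' with ⟨rfl, rfl⟩ | ⟨rfl, rfl⟩
  · exact key A' hA' B' hB' hAB' ha' hb'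
  · exact key B' hB' A' hA' hAB'.symm hb' ha'

end Hierarchy


/-! ### Local graphs: crossing of minimum cuts and the dichotomy -/

section LocalGraph

variable {V E : Type*} [Fintype V] [DecidableEq V] [Fintype E] [DecidableEq E]
variable {x : Sym2 V → ℝ} {ends : E → Sym2 V} {ePlus : E} {L : List (Finset V)}

theorem IsHalfIntegralHeldKarp.three_le_card (hx : IsHalfIntegralHeldKarp x) [Nonempty V] :
    3 ≤ Fintype.card V := by
  obtain ⟨v⟩ := ‹Nonempty V›
  have h1 := hx.degree v
  rw [← Finset.add_sum_erase _ _ (Finset.mem_univ v), hx.diag, zero_add] at h1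
  have h2 : ∑ w ∈ Finset.univ.erase v, x s(v, w) ≤ ∑ w ∈ Finset.univ.erase v, 1 :=
    Finset.sum_le_sum fun w _ => by rcases hx.half s(v, w) with h | h | h <;> rw [h] <;> norm_num
  rw [h1, Finset.sum_const, Finset.card_erase_of_mem (Finset.mem_univ v), Finset.card_univ,
    nsmul_eq_mul, mul_one] at h2
  have : 2 ≤ Fintype.card V - 1 := by exact_mod_cast h2
  omega

theorem localNodes_univ (h : IsHierarchy ends ePlus L) :
    localNodes L Finset.univ = currentNodes L := by
  rw [localNodes, Finset.compl_univ, Finset.erase_insert, currentNodes]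
  intro h'
  exact (h.nonempty ∅ (mem_nodesIn.1 h').1).ne_empty rfl

theorem mem_localNodes (h : IsHierarchy ends ePlus L) {R : Finset V} (hR : R ∈ L) {A : Finset V} :
    A ∈ localNodes L R ↔ A = Rᶜ ∨ A ∈ nodesIn L R := by
  have hRc : R ∈ criticalSets L := mem_criticalSets.2 (Or.inl hR)
  simp only [localNodes, Finset.mem_erase, Finset.mem_insert]
  refine ⟨fun h => h.2, fun h' => ⟨?_, h'⟩⟩
  rcases h' with rfl | h'
  · intro h0
    exact h.ne_univ R hRc (by simpa using h0)
  · exact (h.nonempty A (mem_nodesIn.1 h').1).ne_empty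

theorem nodesIn_subset_localNodes (h : IsHierarchy ends ePlus L) {R : Finset V}
    (hR : R ∈ L ∨ R = Finset.univ) : nodesIn L R ⊆ localNodes L R := by
  intro A hA
  rcases hR with hR | rfl
  · exact (mem_localNodes h hR).2 (Or.inr hA)
  · rw [localNodes_univ h]; exact hA

theorem IsHierarchy.isTightPartition_localNodes (h : IsHierarchy ends ePlus L) {R : Finset V}
    (hR : R ∈ L) : IsTightPartition ends (localNodes L R) := by
  have hRc : R ∈ criticalSets L := mem_criticalSets.2 (Or.inl hR)
  constructor
  · intro A hA B hB hAB
    rw [Finset.mem_coe, mem_localNodes h hR] at hA hB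
    have key : ∀ C ∈ nodesIn L R, Disjoint Rᶜ C := fun C hC =>
      Finset.disjoint_left.2 fun v hv hvC => Finset.mem_compl.1 hv ((mem_nodesIn.1 hC).2.1.1 hvC)
    rcases hA with rfl | hA <;> rcases hB with rfl | hB
    · exact absurd rfl hAB
    · exact key B hB
    · exact (key A hA).symm
    · exact h.nodes_disjoint hA hB hAB
  · intro A hA
    rw [mem_localNodes h hR] at hA
    rcases hA with rfl | hA
    · rw [Finset.nonempty_iff_ne_empty]
      intro h0
      exact h.ne_univ R hRc (by simpa using h0)
    · exact h.nonempty A (mem_nodesIn.1 hA).1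
  · intro v
    by_cases hv : v ∈ R
    · obtain ⟨A, hA, hvA⟩ := exists_node_mem (L := L) (h.two_le R hR) hv
      exact ⟨A, (mem_localNodes h hR).2 (Or.inr hA), hvA⟩
    · exact ⟨Rᶜ, (mem_localNodes h hR).2 (Or.inl rfl), Finset.mem_compl.2 hv⟩
  · intro A hA
    rw [mem_localNodes h hR] at hA
    rcases hA with rfl | hA
    · exact (h.tight R hRc).compl
    · exact h.tight A (mem_nodesIn.1 hA).1

theorem one_lt_card_nodesIn {R : Finset V}
    (hR : 2 ≤ R.card) : 1 < (nodesIn L R).card := by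
  obtain ⟨v, hv⟩ := Finset.card_pos.1 (by omega : 0 < R.card)
  obtain ⟨A, hA, hvA⟩ := exists_node_mem (L := L) hR hv
  obtain ⟨-, hAR, -⟩ := mem_nodesIn.1 hA
  obtain ⟨w, hw, hwA⟩ := Finset.exists_of_ssubset hAR
  obtain ⟨B, hB, hwB⟩ := exists_node_mem (L := L) hR hw
  exact Finset.one_lt_card.2 ⟨A, hA, B, hB, fun hAB => hwA (hAB ▸ hwB)⟩

theorem IsHierarchy.three_le_card_localNodes (h : IsHierarchy ends ePlus L) {R : Finset V}
    (hR : R ∈ L) : 3 ≤ (localNodes L R).card := by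
  have h1 : localNodes L R = insert Rᶜ (nodesIn L R) := by
    ext A; rw [mem_localNodes h hR, Finset.mem_insert]
  have h2 : Rᶜ ∉ nodesIn L R := by
    intro hc
    obtain ⟨hRc, hsub, -⟩ := mem_nodesIn.1 hc
    obtain ⟨v, hv⟩ := h.nonempty _ hRc
    exact Finset.mem_compl.1 hv (hsub.1 hv)
  rw [h1, Finset.card_insert_of_notMem h2]
  have := one_lt_card_nodesIn (L := L) (h.two_le R hR)
  omega

/-- By minimality of `R`, a smaller proper tight set inside it must have been crossed when `R` was
selected. Since `R` itself was uncrossed, the crossing set does not split `Rᶜ`, and so it also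
exists in the local graph. -/
theorem IsRun.allCrossed_localNodes (hG : IsFourConnected ends) (hV : 3 ≤ Fintype.card V)
    (hL : IsRun ends ePlus L) {R : Finset V} (hR : R ∈ L) :
    AllCrossed ends (localNodes L R) := by
  have h := hL.isHierarchy hG hV
  have hP := h.isTightPartition_localNodes hR
  obtain ⟨L₂, hL₂, hmin, hnodes⟩ := hL.exists_selection hG hV hR
  have h₂ := hL₂.isHierarchy hG hV
  have hP₂ := h₂.isTightPartition_currentNodes hV
  obtain ⟨⟨⟨hRN, hRp, hRt, hRcr⟩, hRe⟩, hRmin⟩ := hmin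
  have hcross : ∀ X, X ⊆ R → IsNodeSet (localNodes L R) X → IsTight ends X →
      IsProper (localNodes L R) X →
      ∃ Y, IsNodeSet (localNodes L R) Y ∧ IsTight ends Y ∧ Crosses X Y := by
    intro X hXR hX hXt hXp
    have hXN : IsNodeSet (currentNodes L₂) X := by
      intro A hA
      rcases hRN A hA with hAR | hAR
      · refine hX A ((mem_localNodes h hR).2 (Or.inr ?_))
        rw [hnodes]; exact Finset.mem_filter.2 ⟨hA, hAR⟩
      · exact Or.inr (hAR.mono_right hXR)
    have hXp₂ : IsProper (currentNodes L₂) X := by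
      constructor
      · refine hXp.1.trans (Finset.card_le_card fun A hA => ?_)
        obtain ⟨hA, hAX⟩ := Finset.mem_filter.1 hA
        rcases (mem_localNodes h hR).1 hA with rfl | hA'
        · obtain ⟨v, hv⟩ := hP.nonempty _ hA
          exact absurd (hXR (hAX hv)) (Finset.mem_compl.1 hv)
        · rw [hnodes] at hA'
          exact Finset.mem_filter.2 ⟨(Finset.mem_filter.1 hA').1, hAX⟩
      · refine hRp.2.trans (Finset.card_le_card fun A hA => ?_)
        obtain ⟨hA, hAR⟩ := Finset.mem_filter.1 hA
        exact Finset.mem_filter.2 ⟨hA, hAR.mono_right hXR⟩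
    -- Properness requires a second node besides `Rᶜ` outside `X`.
    have hnX : ¬ R ⊆ X := by
      intro hRX
      have hsub : (localNodes L R).filter (Disjoint · X) ⊆ {Rᶜ} := by
        intro A hA
        obtain ⟨hA, hAX⟩ := Finset.mem_filter.1 hA
        rcases (mem_localNodes h hR).1 hA with rfl | hA'
        · simp
        · obtain ⟨v, hv⟩ := hP.nonempty _ hA
          exact absurd (hRX ((mem_nodesIn.1 hA').2.1.1 hv)) (Finset.disjoint_left.1 hAX hv)
      have := Finset.card_le_card hsub
      have := hXp.2
      simp at *
      omega
    have hXun : ¬ IsUncrossedProperTight ends L₂ X := by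
      intro hXu
      refine hnX (hRmin ⟨hXu, fun he => hRe ?_⟩ hXR)
      simp only [edgesIn, Finset.mem_filter, Finset.mem_univ, true_and] at he ⊢
      obtain ⟨a, ha, b, hb, hab⟩ := he
      exact ⟨a, hXR ha, b, hXR hb, hab⟩
    obtain ⟨Y, hYN, hYt, hXY⟩ : ∃ Y, IsNodeSet (currentNodes L₂) Y ∧ IsTight ends Y ∧
        Crosses X Y := by
      by_contra! hno
      exact hXun ⟨hXN, hXp₂, hXt, fun Y h1 h2 => hno Y h1 h2⟩
    refine ⟨Y, fun A hA => ?_, hYt, hXY⟩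
    rcases (mem_localNodes h hR).1 hA with rfl | hA'
    · have hRY := hRcr Y hYN hYt
      obtain ⟨⟨a, ha⟩, -, ⟨b, hb⟩, -⟩ := hXY
      simp only [Finset.mem_sdiff, Finset.mem_inter] at ha hb
      have h1 : (R \ Y).Nonempty := ⟨a, by simp [hXR ha.1, ha.2]⟩
      have h3 : (R ∩ Y).Nonempty := ⟨b, by simp [hXR hb.1, hb.2]⟩
      by_cases h2 : (Y \ R).Nonempty
      · have h4 : ¬ ((R ∪ Y)ᶜ).Nonempty := fun h4 => hRY ⟨h1, h2, h3, h4⟩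
        rw [Finset.not_nonempty_iff_eq_empty] at h4
        left
        intro v hv
        by_contra hvY
        have : v ∈ (R ∪ Y)ᶜ := by simp at hv ⊢; tauto
        rw [h4] at this; simp at this
      · right
        rw [Finset.not_nonempty_iff_eq_empty, Finset.sdiff_eq_empty_iff_subset] at h2
        exact Finset.disjoint_left.2 fun v hv hvY => Finset.mem_compl.1 hv (h2 hvY)
    · rw [hnodes] at hA'
      exact hYN A (Finset.mem_filter.1 hA').1
  intro X hX hXt hXp
  -- Up to taking the complement, the cut is given by its side inside `R`.
  rcases hX Rᶜ ((mem_localNodes h hR).2 (Or.inl rfl)) with h' | h'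
  · have hXcp : IsProper (localNodes L R) Xᶜ := by
      constructor
      · refine hXp.2.trans (Finset.card_le_card fun A hA => ?_)
        obtain ⟨hA, hAX⟩ := Finset.mem_filter.1 hA
        exact Finset.mem_filter.2 ⟨hA, fun v hv =>
          Finset.mem_compl.2 (Finset.disjoint_left.1 hAX hv)⟩
      · refine hXp.1.trans (Finset.card_le_card fun A hA => ?_)
        obtain ⟨hA, hAX⟩ := Finset.mem_filter.1 hA
        exact Finset.mem_filter.2 ⟨hA, Finset.disjoint_left.2 fun v hv hv' =>
          Finset.mem_compl.1 hv' (hAX hv)⟩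
    obtain ⟨Y, hY, hYt, h1, h2, h3, h4⟩ := hcross Xᶜ (fun v hv => by
      by_contra hvR
      exact Finset.mem_compl.1 hv (h' (Finset.mem_compl.2 hvR))) hX.compl
      hXt.compl hXcp
    refine ⟨Y, hY, hYt, ?_, ?_, ?_, ?_⟩
    · obtain ⟨v, hv⟩ := h4; exact ⟨v, by simpa using hv⟩
    · obtain ⟨v, hv⟩ := h3; exact ⟨v, by simp at hv ⊢; tauto⟩
    · obtain ⟨v, hv⟩ := h2; exact ⟨v, by simp at hv ⊢; tauto⟩
    · obtain ⟨v, hv⟩ := h1; exact ⟨v, by simpa using hv⟩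
  · refine hcross X (fun v hv => ?_) hX hXt hXp
    by_contra hvR
    exact Finset.disjoint_left.1 h' (Finset.mem_compl.2 hvR) hv

theorem IsRun.dichotomy (hG : IsFourConnected ends) (hV : 3 ≤ Fintype.card V)
    (hL : IsRun ends ePlus L) {R : Finset V} (hR : R ∈ L) :
    (∀ A ∈ localNodes L R, ∀ B ∈ localNodes L R, A ≠ B → edgeCount ends A B ≤ 1) ∨
      ∀ A ∈ localNodes L R, ∀ B ∈ localNodes L R, A ≠ B →
        edgeCount ends A B = 0 ∨ edgeCount ends A B = 2 :=
  ((hL.isHierarchy hG hV).isTightPartition_localNodes hR).dichotomy hG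
    ((hL.isHierarchy hG hV).three_le_card_localNodes hR) (hL.allCrossed_localNodes hG hV hR)

/-- The set contracted last was proper, so at least two nodes remain outside the node containing it.
-/
theorem IsRun.three_le_card_currentNodes (hG : IsFourConnected ends) (hV : 3 ≤ Fintype.card V)
    (hL : IsRun ends ePlus L) : 3 ≤ (currentNodes L).card := by
  have h := hL.isHierarchy hG hV
  have hP := h.isTightPartition_currentNodes hV
  suffices ∃ A ∈ currentNodes L, ∃ B ∈ currentNodes L, ∃ C ∈ currentNodes L,
      A ≠ B ∧ A ≠ C ∧ B ≠ C by
    obtain ⟨A, hA, B, hB, C, hC, hAB, hAC, hBC⟩ := this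
    exact Finset.two_lt_card.2 ⟨A, hA, B, hB, C, hC, hAB, hAC, hBC⟩
  cases L with
  | nil =>
    obtain ⟨a, b, c, hab, hac, hbc⟩ := Fintype.two_lt_card_iff.1 (show 2 < Fintype.card V from hV)
    have hnode : ∀ v : V, {v} ∈ currentNodes ([] : List (Finset V)) := by
      intro v
      obtain ⟨A, hA, hvA⟩ := hP.cover v
      obtain ⟨w, rfl⟩ : ∃ w, A = {w} := by
        simpa [mem_criticalSets] using (mem_nodesIn.1 hA).1
      rwa [Finset.mem_singleton.1 hvA]
    exact ⟨{a}, hnode a, {b}, hnode b, {c}, hnode c, by simpa, by simpa, by simpa⟩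
  | cons S L' =>
    have h' := IsRun.isHierarchy hG hV hL.1
    obtain ⟨hSN, hSp, -⟩ := hL.2.prop.1
    obtain ⟨A, hA, B, hB, hAB⟩ := Finset.one_lt_card.1 (show 1 < _ from hSp.2)
    obtain ⟨hA, hAS⟩ := Finset.mem_filter.1 hA
    obtain ⟨hB, hBS⟩ := Finset.mem_filter.1 hB
    obtain ⟨s, hs⟩ := h.nonempty S (mem_criticalSets.2 (Or.inl List.mem_cons_self))
    obtain ⟨a, ha⟩ := h'.nonempty A (mem_nodesIn.1 hA).1
    obtain ⟨b, hb⟩ := h'.nonempty B (mem_nodesIn.1 hB).1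
    have key : ∀ A ∈ currentNodes L', Disjoint A S → ∀ a ∈ A, ∀ A' ∈ currentNodes (S :: L'),
        a ∈ A' → A' ⊆ A ∧ Disjoint A' S := by
      intro A hA hAS a ha A' hA' ha'
      have hc := (mem_nodesIn.1 hA').1
      rw [criticalSets_cons, Finset.mem_insert] at hc
      rcases hc with rfl | hc
      · exact absurd ha' (Finset.disjoint_left.1 hAS ha)
      obtain ⟨D, hD, hAD⟩ := exists_node_above hc
        ((Finset.subset_univ A').ssubset_of_ne (h'.ne_univ A' hc))
      have hDA : D = A := by
        by_contra hne
        exact Finset.disjoint_left.1 (h'.nodes_disjoint hD hA hne) (hAD ha') ha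
      subst hDA
      exact ⟨hAD, hAS.mono_left hAD⟩
    obtain ⟨A', hA', haA'⟩ := hP.cover a
    obtain ⟨B', hB', hbB'⟩ := hP.cover b
    obtain ⟨C', hC', hsC'⟩ := hP.cover s
    obtain ⟨hA1, hA2⟩ := key A hA hAS a ha A' hA' haA'
    obtain ⟨hB1, hB2⟩ := key B hB hBS b hb B' hB' hbB'
    refine ⟨A', hA', B', hB', C', hC', ?_, ?_, ?_⟩
    · rintro rfl
      exact Finset.disjoint_left.1 (h'.nodes_disjoint hA hB hAB) (hA1 haA') (hB1 haA')
    · rintro rfl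
      exact Finset.disjoint_left.1 hA2 hsC' hs
    · rintro rfl
      exact Finset.disjoint_left.1 hB2 hsC' hs

/-- The graph that remains at the end is a doubled cycle. -/
theorem IsExecution.doubled (hG : IsFourConnected ends) (hV : 3 ≤ Fintype.card V)
    (hL : IsExecution ends ePlus L) (hx : IsHalfIntegralHeldKarp x) (hxG : IsSupportGraph x ends)
    (hePlus : x (ends ePlus) = 1) :
    ∀ A ∈ currentNodes L, ∀ B ∈ currentNodes L, A ≠ B →
      edgeCount ends A B = 0 ∨ edgeCount ends A B = 2 := by
  have h := hL.1.isHierarchy hG hV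
  have hP := h.isTightPartition_currentNodes hV
  refine (hP.dichotomy hG (hL.1.three_le_card_currentNodes hG hV) fun X hX hXt hXp => ?_).resolve_left
    fun hle => ?_
  · by_contra! hno
    exact hL.2 ⟨X, hX, hXp, hXt, fun Y h1 h2 => hno Y h1 h2⟩
  · obtain ⟨u, v, huv⟩ : ∃ u v, ends ePlus = s(u, v) := by
      induction h : ends ePlus with | _ u v => exact ⟨u, v, rfl⟩
    have hne : u ≠ v := by
      rintro rfl
      rw [huv, hx.diag] at hePlus
      norm_num at hePlus
    obtain ⟨A, hA, huA⟩ := hP.cover u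
    obtain ⟨B, hB, hvB⟩ := hP.cover v
    -- No selected set contains both ends of `e⁺`. Hence its two parallel copies still join
    -- different nodes, which rules out the simple alternative.
    have hAB : A ≠ B := by
      rintro rfl
      rcases mem_criticalSets.1 (mem_nodesIn.1 hA).1 with hAL | ⟨w, rfl⟩
      · refine h.avoid A hAL ?_
        simp only [edgesIn, Finset.mem_filter, Finset.mem_univ, true_and]
        exact ⟨u, huA, v, hvB, huv⟩
      · exact hne ((Finset.mem_singleton.1 huA).trans (Finset.mem_singleton.1 hvB).symm)
    have h1 := hle A hA B hB hAB
    have h2 : (Finset.univ.filter fun e => ends e = ends ePlus).card = 2 := by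
      have := hxG (ends ePlus)
      rw [hePlus] at this
      exact_mod_cast (by linarith : ((Finset.univ.filter fun e => ends e = ends ePlus).card : ℝ) = 2)
    have h3 : (Finset.univ.filter fun e => ends e = ends ePlus).card ≤ edgeCount ends A B := by
      refine Finset.card_le_card fun e he => ?_
      simp only [Finset.mem_filter, Finset.mem_univ, true_and] at he ⊢
      exact ⟨u, huA, v, hvB, he.trans huv⟩
    omega

end LocalGraph


/-! ### Independence of the levels, and parallel edges in trees -/

section Level

variable {V E : Type*} [Fintype V] [DecidableEq V] [Fintype E] [DecidableEq E]
variable {ends : E → Sym2 V} {ePlus : E} {L : List (Finset V)}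
variable {μ : Finset V → PMF (Finset E)} {ν : PMF (Finset E)}

theorem treesLaw_erase {S : Finset V} : ∀ {L : List (Finset V)}, S ∈ L →
    treesLaw μ L = unionLaw (treesLaw μ (L.erase S)) (μ S)
  | S' :: L, h => by
    by_cases hS : S' = S
    · subst hS
      rw [List.erase_cons_head]; rfl
    · have h' : S ∈ L := (List.mem_cons.1 h).resolve_left (Ne.symm hS)
      rw [List.erase_cons_tail (by simpa using hS)]
      change unionLaw (treesLaw μ L) (μ S') =
        unionLaw (unionLaw (treesLaw μ (L.erase S)) (μ S')) (μ S)
      rw [treesLaw_erase h', unionLaw_right_comm]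

theorem oneTreeLaw_eq (L : List (Finset V)) :
    oneTreeLaw μ ν L = unionLaw (treesLaw μ L) ν := rfl

/-- Samples the level of `S` last, so that the union of all other samples can be treated as fixed.
-/
theorem oneTreeLaw_erase {S : Finset V} (h : S ∈ L) :
    oneTreeLaw μ ν L = unionLaw (oneTreeLaw μ ν (L.erase S)) (μ S) := by
  rw [oneTreeLaw_eq, oneTreeLaw_eq, treesLaw_erase h, unionLaw_right_comm]

theorem exists_level_of_mem_treesLaw {N : Finset V → Finset (Finset V)} :
    ∀ {L' : List (Finset V)}, (∀ S ∈ L', IsMaxEntropyTree ends (N S) (μ S)) →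
    ∀ {T : Finset E}, T ∈ (treesLaw μ L').support → ∀ {e : E}, e ∈ T →
      ∃ S ∈ L', e ∈ edgesBetween ends (N S)
  | [], _, T, hT, e, he => by
    rw [treesLaw, PMF.mem_support_pure_iff] at hT
    subst hT; simp at he
  | S :: L', hμ, T, hT, e, he => by
    obtain ⟨T₁, hT₁, T₂, hT₂, rfl⟩ := mem_support_unionLaw.1 hT
    rcases Finset.mem_union.1 he with he | he
    · obtain ⟨S', hS', h⟩ := exists_level_of_mem_treesLaw
        (fun S hS => hμ S (List.mem_cons_of_mem _ hS)) hT₁ he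
      exact ⟨S', List.mem_cons_of_mem _ hS', h⟩
    · exact ⟨S, List.mem_cons_self, ((hμ S List.mem_cons_self).isSpanningTree hT₂).1 he⟩

/-- The data of a complete execution of the algorithm. -/
structure IsSampling (ends : E → Sym2 V) (ePlus : E) (L : List (Finset V))
    (μ : Finset V → PMF (Finset E)) (ν : PMF (Finset E)) : Prop where
  graph : IsFourConnected ends
  card : 3 ≤ Fintype.card V
  run : IsRun ends ePlus L
  hier : IsHierarchy ends ePlus L
  tree : ∀ S ∈ L, IsMaxEntropyTree ends (nodesIn L S) (μ S)
  cycle : IsUniformCycle ends (currentNodes L) ePlus ν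
  root : ∀ A ∈ currentNodes L, ∀ B ∈ currentNodes L, A ≠ B →
    edgeCount ends A B = 0 ∨ edgeCount ends A B = 2

theorem IsUniformCycle.isSpanningCycle {N : Finset (Finset V)} (h : IsUniformCycle ends N ePlus ν)
    {C : Finset E} (hC : C ∈ ν.support) : IsSpanningCycle ends N C ∧ ePlus ∈ C := by
  obtain ⟨c, hc⟩ := h
  by_contra h'
  exact hC ((hc C).2 h')

/-- By `level_unique`, the other samples cannot contain an edge of the level of `R`; membership of
such edges is decided by `μ R` alone. -/
theorem IsSampling.notMem_edgesBetween (h : IsSampling ends ePlus L μ ν) {R : Finset V}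
    (hR : R ∈ L) {T : Finset E} (hT : T ∈ (oneTreeLaw μ ν (L.erase R)).support) {e : E}
    (he : e ∈ T) : e ∉ edgesBetween ends (nodesIn L R) := by
  intro heR
  rw [oneTreeLaw_eq] at hT
  obtain ⟨T₁, hT₁, T₂, hT₂, rfl⟩ := mem_support_unionLaw.1 hT
  rcases Finset.mem_union.1 he with he | he
  · obtain ⟨S, hS, heS⟩ := exists_level_of_mem_treesLaw (N := nodesIn L)
      (fun S hS => h.tree S (List.mem_of_mem_erase hS)) hT₁ he
    have := h.hier.level_unique (Or.inl hR) (Or.inl (List.mem_of_mem_erase hS)) heR heS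
    subst this
    exact (h.hier.nodup.mem_erase_iff.1 hS).1 rfl
  · have := h.hier.level_unique (Or.inl hR) (Or.inr rfl) heR
      ((h.cycle.isSpanningCycle hT₂).1.1 he)
    subst this
    exact h.hier.ne_univ _ (mem_criticalSets.2 (Or.inl hR)) rfl

theorem IsSampling.notMem_edgesBetween_root (h : IsSampling ends ePlus L μ ν)
    {T : Finset E} (hT : T ∈ (treesLaw μ L).support) {e : E}
    (he : e ∈ T) : e ∉ edgesBetween ends (currentNodes L) := by
  intro heR
  obtain ⟨S, hS, heS⟩ := exists_level_of_mem_treesLaw (N := nodesIn L) h.tree hT he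
  have := h.hier.level_unique (Or.inr rfl) (Or.inl hS) heR heS
  subst this
  exact h.hier.ne_univ _ (mem_criticalSets.2 (Or.inl hS)) rfl

theorem IsHierarchy.nodeStar_subset_cut (h : IsHierarchy ends ePlus L) {R S : Finset V}
    (hS : S ∈ nodesIn L R) : nodeStar ends (nodesIn L R) S ⊆ cut ends S := by
  intro e he
  obtain ⟨C, hC, hne, a, ha, c, hc, hac⟩ := mem_nodeStar.1 he
  exact (mem_cut hac).2 (Or.inl ⟨ha, Finset.disjoint_left.1 (h.nodes_disjoint hC hS hne.symm) hc⟩)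

theorem mem_nodeStar_or_mem_cut {R S : Finset V}
    (hR : 2 ≤ R.card) (hS : S ∈ nodesIn L R) {e : E} (he : e ∈ cut ends S) :
    e ∈ nodeStar ends (nodesIn L R) S ∨ e ∈ cut ends R := by
  simp only [cut, Finset.mem_filter, Finset.mem_univ, true_and] at he
  obtain ⟨a, ha, b, hb, hab⟩ := he
  have haR : a ∈ R := (mem_nodesIn.1 hS).2.1.1 ha
  by_cases hbR : b ∈ R
  · left
    obtain ⟨C, hC, hbC⟩ := exists_node_mem (L := L) hR hbR
    refine mem_nodeStar.2 ⟨C, hC, ?_, a, ha, b, hbC, hab⟩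
    rintro rfl
    exact Finset.mem_compl.1 hb hbC
  · exact Or.inr ((mem_cut hab).2 (Or.inl ⟨haR, hbR⟩))

theorem notMem_cut_of_mem_edgesBetween {R : Finset V} {e : E}
    (he : e ∈ edgesBetween ends (nodesIn L R)) : e ∉ cut ends R := by
  obtain ⟨A, hA, B, hB, -, a, ha, b, hb, hab⟩ := mem_edgesBetween.1 he
  have haR := (mem_nodesIn.1 hA).2.1.1 ha
  have hbR := (mem_nodesIn.1 hB).2.1.1 hb
  rw [mem_cut hab]
  tauto

theorem IsHierarchy.mem_nodeStar_iff (h : IsHierarchy ends ePlus L) {R S : Finset V}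
    (hR : 2 ≤ R.card) (hS : S ∈ nodesIn L R) {e : E} :
    e ∈ nodeStar ends (nodesIn L R) S ↔ e ∈ cut ends S ∧ e ∈ edgesBetween ends (nodesIn L R) := by
  refine ⟨fun he => ⟨h.nodeStar_subset_cut hS he, nodeStar_subset hS he⟩, fun ⟨h1, h2⟩ => ?_⟩
  exact (mem_nodeStar_or_mem_cut hR hS h1).resolve_right (notMem_cut_of_mem_edgesBetween h2)

theorem cut_inter_cut {R S : Finset V}
    (hS : S ∈ nodesIn L R) :
    cut ends S ∩ cut ends R = Finset.univ.filter (Joins ends S Rᶜ) := by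
  ext e
  simp only [Finset.mem_inter, Finset.mem_filter, Finset.mem_univ, true_and]
  have hsub := (mem_nodesIn.1 hS).2.1.1
  constructor
  · rintro ⟨h1, h2⟩
    simp only [cut, Finset.mem_filter, Finset.mem_univ, true_and] at h1
    obtain ⟨a, ha, b, hb, hab⟩ := h1
    refine ⟨a, ha, b, ?_, hab⟩
    have haR := hsub ha
    rw [mem_cut hab] at h2
    rw [Finset.mem_compl]
    tauto
  · rintro ⟨a, ha, b, hb, hab⟩
    rw [Finset.mem_compl] at hb
    rw [mem_cut hab, mem_cut hab]
    exact ⟨Or.inl ⟨ha, fun h => hb (hsub h)⟩, Or.inl ⟨hsub ha, hb⟩⟩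

theorem IsHierarchy.card_nodeStar (h : IsHierarchy ends ePlus L) {R S : Finset V}
    (hR : 2 ≤ R.card) (hS : S ∈ nodesIn L R) :
    (nodeStar ends (nodesIn L R) S).card + edgeCount ends S Rᶜ = 4 := by
  rw [← h.tight S (mem_nodesIn.1 hS).1, edgeCount, ← cut_inter_cut hS,
    ← Finset.card_union_of_disjoint]
  · congr 1
    ext e
    simp only [Finset.mem_union, Finset.mem_inter]
    constructor
    · rintro (he | he)
      exacts [h.nodeStar_subset_cut hS he, he.1]
    · intro he
      rcases mem_nodeStar_or_mem_cut hR hS he with h' | h'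
      exacts [Or.inl h', Or.inr ⟨he, h'⟩]
  · exact Finset.disjoint_left.2 fun e he he' =>
      notMem_cut_of_mem_edgesBetween (nodeStar_subset hS he) (Finset.mem_inter.1 he').2

/-- Removing one of two parallel edges leaves the node graph unchanged, hence connected, with one
edge too few. -/
theorem IsSpanningTree.not_parallel {N : Finset (Finset V)}
    (hN : (N : Set (Finset V)).PairwiseDisjoint id) {F : Finset E} (hF : IsSpanningTree ends N F)
    {A B : Finset V} (hA : A ∈ N) (hB : B ∈ N) {e f : E} (he : Joins ends A B e)
    (hf : Joins ends A B f) (hef : e ≠ f) : ¬ (e ∈ F ∧ f ∈ F) := by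
  classical
  rintro ⟨heF, hfF⟩
  obtain ⟨hsub, hconn, hcard⟩ := hF
  have hgraph : nodeGraph ends N F = nodeGraph ends N (F.erase f) := by
    ext x y
    simp only [nodeGraph, SimpleGraph.fromRel_adj]
    refine and_congr_right fun _ => ?_
    have key : ∀ X Y : {A // A ∈ N}, (∃ g ∈ F, Joins ends X.1 Y.1 g) ↔
        ∃ g ∈ F.erase f, Joins ends X.1 Y.1 g := by
      intro X Y
      constructor
      · rintro ⟨g, hg, hJ⟩
        by_cases hgf : g = f
        · subst hgf
          refine ⟨e, Finset.mem_erase.2 ⟨hef, heF⟩, ?_⟩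
          rcases Joins.unique hN hA hB X.2 Y.2 hf hJ with ⟨h1, h2⟩ | ⟨h1, h2⟩
          · rw [h1, h2]; exact he
          · rw [h1, h2]; exact he.symm
        · exact ⟨g, Finset.mem_erase.2 ⟨hgf, hg⟩, hJ⟩
      · rintro ⟨g, hg, hJ⟩
        exact ⟨g, Finset.mem_of_mem_erase hg, hJ⟩
    rw [key, key]
  rw [hgraph] at hconn
  have h1 := hconn.card_vert_le_card_edgeSet_add_one
  have hex : ∀ s : (nodeGraph ends N (F.erase f)).edgeSet, ∃ g : F.erase f,
      ∃ X Y : {A // A ∈ N}, s.1 = s(X, Y) ∧ Joins ends X.1 Y.1 g := by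
    rintro ⟨s, hs⟩
    induction s with | _ X Y =>
    rw [SimpleGraph.mem_edgeSet] at hs
    simp only [nodeGraph, SimpleGraph.fromRel_adj] at hs
    rcases hs.2 with ⟨g, hg, hJ⟩ | ⟨g, hg, hJ⟩
    · exact ⟨⟨g, hg⟩, X, Y, rfl, hJ⟩
    · exact ⟨⟨g, hg⟩, X, Y, rfl, hJ.symm⟩
  choose φ hφ using hex
  have hinj : Function.Injective φ := by
    intro s t hst
    obtain ⟨X, Y, hs, hJ⟩ := hφ s
    obtain ⟨X', Y', ht, hJ'⟩ := hφ t
    rw [← hst] at hJ'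
    apply Subtype.ext
    rw [hs, ht, Sym2.eq_iff]
    rcases Joins.unique hN X.2 Y.2 X'.2 Y'.2 hJ hJ' with ⟨h1, h2⟩ | ⟨h1, h2⟩
    · exact Or.inl ⟨Subtype.ext h1.symm, Subtype.ext h2.symm⟩
    · exact Or.inr ⟨Subtype.ext h2.symm, Subtype.ext h1.symm⟩
  have h2 := Nat.card_le_card_of_injective φ hinj
  have h3 : Nat.card (F.erase f) = F.card - 1 := by
    rw [Nat.card_eq_fintype_card, Fintype.card_coe, Finset.card_erase_of_mem hfF]
  have h4 : Nat.card {A // A ∈ N} = N.card := by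
    rw [Nat.card_eq_fintype_card, Fintype.card_coe]
  have : 0 < F.card := Finset.card_pos.2 ⟨f, hfF⟩
  omega

theorem prob_pos_of_mem {α : Type*} {p : PMF α} {P : α → Prop} {x : α} (hx : x ∈ p.support)
    (hP : P x) : prob p P ≠ 0 := by
  intro h
  rcases (ENNReal.toReal_eq_zero_iff _).1 h with h | h
  · exact Set.disjoint_left.1 ((p.toOuterMeasure_apply_eq_zero_iff _).1 h) hx hP
  · exact toOuterMeasure_ne_top _ _ h

/-- A tree contains exactly one edge of each parallel pair. -/
theorem IsMaxEntropyTree.mem_iff_notMem_of_parallel {N : Finset (Finset V)} {μ : PMF (Finset E)}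
    (hN : (N : Set (Finset V)).PairwiseDisjoint id) (h : IsMaxEntropyTree ends N μ)
    {A B : Finset V} (hA : A ∈ N) (hB : B ∈ N) (hAB : A ≠ B) {e f : E} (he : Joins ends A B e)
    (hf : Joins ends A B f) (hef : e ≠ f) {F : Finset E} (hF : F ∈ μ.support) :
    e ∈ F ↔ f ∉ F := by
  have hnot := (h.isSpanningTree hF).not_parallel hN hA hB he hf hef
  refine ⟨fun h1 h2 => hnot ⟨h1, h2⟩, fun hfF => ?_⟩
  by_contra heF
  have heE : e ∈ edgesBetween ends N := mem_edgesBetween.2 ⟨A, hA, B, hB, hAB, he⟩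
  have hfE : f ∈ edgesBetween ends N := mem_edgesBetween.2 ⟨A, hA, B, hB, hAB, hf⟩
  have h1 : prob μ (fun F => e ∈ F ∧ f ∈ F) = 0 := prob_eq_zero fun F hF =>
    (h.isSpanningTree hF).not_parallel hN hA hB he hf hef
  have h2 := prob_split μ (fun F => f ∈ F) (fun F => e ∈ F)
  have h3 := prob_split μ (fun F => e ∉ F) (fun F => f ∈ F)
  have h4 := prob_not μ (fun F => e ∈ F)
  have h5 : prob μ (fun F => f ∈ F ∧ e ∈ F) = 0 := by
    rw [← h1]; exact prob_congr fun _ _ => and_comm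
  have h6 : prob μ (fun F => f ∈ F ∧ e ∉ F) = prob μ (fun F => e ∉ F ∧ f ∈ F) :=
    prob_congr fun _ _ => and_comm
  rw [h.prob_mem heE] at h4
  rw [h.prob_mem hfE] at h2
  -- Two exclusive events of probability `1/2` exhaust the total mass, so no tree in the support
  -- avoids both edges.
  exact prob_pos_of_mem (P := fun F => e ∉ F ∧ f ∉ F) hF ⟨heF, hfF⟩ (by linarith)

end Level


/-! ### The uniform cycle in the final doubled graph -/

section RootCycle

variable {V E : Type*} [Fintype V] [DecidableEq V] [Fintype E] [DecidableEq E]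
variable {ends : E → Sym2 V} {N : Finset (Finset V)} {ePlus : E} {ν : PMF (Finset E)}

theorem IsTightPartition.mem_cut_iff (h : IsTightPartition ends N) {A : Finset V} (hA : A ∈ N)
    {e : E} : e ∈ cut ends A ↔ ∃ B ∈ N, B ≠ A ∧ Joins ends A B e := by
  constructor
  · intro he
    simp only [cut, Finset.mem_filter, Finset.mem_univ, true_and] at he
    obtain ⟨a, ha, b, hb, hab⟩ := he
    obtain ⟨B, hB, hbB⟩ := h.cover b
    refine ⟨B, hB, ?_, a, ha, b, hbB, hab⟩
    rintro rfl
    exact Finset.mem_compl.1 hb hbB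
  · rintro ⟨B, hB, hBA, a, ha, b, hb, hab⟩
    exact (mem_cut hab).2 (Or.inl ⟨ha, fun hbA => hBA (h.eq_of_mem hB hA hb hbA)⟩)

/-- Two parallel edges would use up the degree of both ends and cut them off from a third node. -/
theorem IsSpanningCycle.card_inter_joins_le (h : IsTightPartition ends N) (hN : 3 ≤ N.card)
    {C : Finset E} (hC : IsSpanningCycle ends N C) {A B : Finset V} (hA : A ∈ N) (hB : B ∈ N)
    (hAB : A ≠ B) : (C ∩ Finset.univ.filter (Joins ends A B)).card ≤ 1 := by
  classical
  by_contra! hlt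
  have key : ∀ X ∈ N, ∀ Y ∈ N, X ≠ Y →
      2 ≤ (C ∩ Finset.univ.filter (Joins ends X Y)).card →
      ∀ Z ∈ N, ∀ e ∈ C, X ≠ Z → Joins ends X Z e → Z = Y := by
    intro X hX Y hY hXY h2 Z hZ e he hXZ hJ
    have hsub : C ∩ Finset.univ.filter (Joins ends X Y) ⊆ C ∩ cut ends X := by
      refine Finset.inter_subset_inter_left fun f hf => (h.mem_cut_iff hX).2 ⟨Y, hY, hXY.symm, ?_⟩
      simpa using hf
    have heq := Finset.eq_of_subset_of_card_le hsub (by rw [hC.2.2 X hX]; exact h2)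
    have hmem : e ∈ C ∩ cut ends X :=
      Finset.mem_inter.2 ⟨he, (h.mem_cut_iff hX).2 ⟨Z, hZ, hXZ.symm, hJ⟩⟩
    rw [← heq] at hmem
    simp only [Finset.mem_inter, Finset.mem_filter, Finset.mem_univ, true_and] at hmem
    rcases Joins.unique h.disj hX hY hX hZ hmem.2 hJ with ⟨-, h'⟩ | ⟨h', -⟩
    · exact h'
    · exact absurd h' hXY
  have hlt' : 2 ≤ (C ∩ Finset.univ.filter (Joins ends B A)).card := by
    simp only [joins_comm (A := B)]
    exact hlt
  obtain ⟨D, hD, hDAB⟩ : ∃ D ∈ N, D ∉ ({A, B} : Finset (Finset V)) := by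
    by_contra! hsub
    have := Finset.card_le_card hsub
    have := Finset.card_le_two (a := A) (b := B)
    omega
  simp only [Finset.mem_insert, Finset.mem_singleton, not_or] at hDAB
  have hreach := hC.2.1.preconnected ⟨A, hA⟩ ⟨D, hD⟩
  rw [SimpleGraph.reachable_iff_reflTransGen] at hreach
  have : D = A ∨ D = B := by
    have : ∀ Y : {A // A ∈ N}, Relation.ReflTransGen (nodeGraph ends N C).Adj ⟨A, hA⟩ Y →
        Y.1 = A ∨ Y.1 = B := by
      intro Y hY
      induction hY with
      | refl => exact Or.inl rfl
      | @tail Y Z _ hadj ih =>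
        simp only [nodeGraph, SimpleGraph.fromRel_adj] at hadj
        obtain ⟨hne, hadj⟩ := hadj
        have hne' : Y.1 ≠ Z.1 := fun h' => hne (Subtype.ext h')
        obtain ⟨e, he, hJ⟩ : ∃ e ∈ C, Joins ends Y.1 Z.1 e := by
          rcases hadj with h' | ⟨e, he, hJ⟩
          · exact h'
          · exact ⟨e, he, hJ.symm⟩
        rcases ih with ih | ih
        · rw [ih] at hne' hJ
          exact Or.inr (key A hA B hB hAB hlt Z.1 Z.2 e he hne' hJ)
        · rw [ih] at hne' hJ
          exact Or.inl (key B hB A hA hAB.symm hlt' Z.1 Z.2 e he hne' hJ)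
    exact this _ hreach
  tauto

/-- In a doubled cycle, a spanning cycle contains exactly one edge of each parallel pair. -/
theorem IsSpanningCycle.card_inter_joins (h : IsTightPartition ends N) (hN : 3 ≤ N.card)
    (hdbl : ∀ A ∈ N, ∀ B ∈ N, A ≠ B → edgeCount ends A B = 0 ∨ edgeCount ends A B = 2)
    {C : Finset E} (hC : IsSpanningCycle ends N C) {A B : Finset V} (hA : A ∈ N) (hB : B ∈ N)
    (hAB : A ≠ B) (h2 : edgeCount ends A B = 2) :
    (C ∩ Finset.univ.filter (Joins ends A B)).card = 1 := by
  classical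
  have hle : ∀ B ∈ N.erase A, 2 * (C ∩ Finset.univ.filter (Joins ends A B)).card ≤
      edgeCount ends A B := by
    intro B hB
    obtain ⟨hBA, hB⟩ := Finset.mem_erase.1 hB
    have h1 := hC.card_inter_joins_le h hN hA hB hBA.symm
    rcases hdbl A hA B hB hBA.symm with h0 | h0
    · have : (C ∩ Finset.univ.filter (Joins ends A B)).card ≤ edgeCount ends A B :=
        Finset.card_le_card Finset.inter_subset_right
      omega
    · omega
  have hs1 := h.card_inter_cut C hA
  have hs2 := h.card_inter_cut Finset.univ hA
  rw [hC.2.2 A hA] at hs1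
  simp only [Finset.univ_inter] at hs2
  rw [h.tight A hA] at hs2
  -- The cycle takes at most half of the edges to each neighbour, but in total two of the four at
  -- `A`, so equality holds for every neighbour.
  have heq : ∑ B ∈ N.erase A, 2 * (C ∩ Finset.univ.filter (Joins ends A B)).card =
      ∑ B ∈ N.erase A, edgeCount ends A B := by
    rw [← Finset.mul_sum, ← hs1]
    exact hs2
  have := (Finset.sum_eq_sum_iff_of_le hle).1 heq B (Finset.mem_erase.2 ⟨hAB.symm, hB⟩)
  omega

theorem Joins.of_parallel (h : IsTightPartition ends N) {A B X Y : Finset V} (hA : A ∈ N)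
    (hB : B ∈ N) (hX : X ∈ N) (hY : Y ∈ N) {d d' : E} (hd : Joins ends A B d)
    (hd' : Joins ends A B d') (hJ : Joins ends X Y d) : Joins ends X Y d' := by
  rcases Joins.unique h.disj hA hB hX hY hd hJ with ⟨h1, h2⟩ | ⟨h1, h2⟩
  · rw [h1, h2]; exact hd'
  · rw [h1, h2]; exact hd'.symm

theorem IsSpanningCycle.map {σ : Equiv.Perm E} (h : IsTightPartition ends N)
    (hσ : ∀ X ∈ N, ∀ Y ∈ N, ∀ e, Joins ends X Y (σ e) ↔ Joins ends X Y e)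
    {C : Finset E} (hC : IsSpanningCycle ends N C) :
    IsSpanningCycle ends N (C.map σ.toEmbedding) := by
  refine ⟨?_, ?_, ?_⟩
  · intro e he
    obtain ⟨f, hf, rfl⟩ := Finset.mem_map.1 he
    obtain ⟨A, hA, B, hB, hAB, hJ⟩ := mem_edgesBetween.1 (hC.1 hf)
    exact mem_edgesBetween.2 ⟨A, hA, B, hB, hAB, (hσ A hA B hB f).2 hJ⟩
  · have : nodeGraph ends N (C.map σ.toEmbedding) = nodeGraph ends N C := by
      ext X Y
      simp only [nodeGraph, SimpleGraph.fromRel_adj, Finset.mem_map, Equiv.coe_toEmbedding,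
        exists_exists_and_eq_and]
      rw [show (∃ a ∈ C, Joins ends X.1 Y.1 (σ a)) ↔ ∃ a ∈ C, Joins ends X.1 Y.1 a by
          simp only [hσ X.1 X.2 Y.1 Y.2],
        show (∃ a ∈ C, Joins ends Y.1 X.1 (σ a)) ↔ ∃ a ∈ C, Joins ends Y.1 X.1 a by
          simp only [hσ Y.1 Y.2 X.1 X.2]]
    rw [this]
    exact hC.2.1
  · intro A hA
    rw [← hC.2.2 A hA, ← Finset.card_map (s := C ∩ cut ends A) σ.toEmbedding]
    congr 1
    ext e
    simp only [Finset.mem_inter, Finset.mem_map, Equiv.coe_toEmbedding]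
    constructor
    · rintro ⟨⟨f, hf, rfl⟩, he⟩
      refine ⟨f, ⟨hf, ?_⟩, rfl⟩
      obtain ⟨B, hB, hBA, hJ⟩ := (h.mem_cut_iff hA).1 he
      exact (h.mem_cut_iff hA).2 ⟨B, hB, hBA, (hσ A hA B hB f).1 hJ⟩
    · rintro ⟨f, ⟨hf, hf'⟩, rfl⟩
      refine ⟨⟨f, hf, rfl⟩, ?_⟩
      obtain ⟨B, hB, hBA, hJ⟩ := (h.mem_cut_iff hA).1 hf'
      exact (h.mem_cut_iff hA).2 ⟨B, hB, hBA, (hσ A hA B hB f).2 hJ⟩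

/-- Swapping two parallel edges different from `e⁺` permutes the admissible cycles, and the law is
uniform on these. -/
theorem IsUniformCycle.prob_map_swap (h : IsTightPartition ends N)
    (hν : IsUniformCycle ends N ePlus ν) {A B : Finset V} (hA : A ∈ N) (hB : B ∈ N) {d d' : E}
    (hd : Joins ends A B d) (hd' : Joins ends A B d') (hpd : ePlus ≠ d) (hpd' : ePlus ≠ d')
    (P : Finset E → Prop) :
    prob ν (fun C => P (C.map (Equiv.swap d d').toEmbedding)) = prob ν P := by
  classical
  set σ := Equiv.swap d d' with hσdef
  have hσ : ∀ X ∈ N, ∀ Y ∈ N, ∀ e, Joins ends X Y (σ e) ↔ Joins ends X Y e := by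
    intro X hX Y hY e
    rcases eq_or_ne e d with rfl | h1
    · rw [hσdef, Equiv.swap_apply_left]
      exact ⟨Joins.of_parallel h hA hB hX hY hd' hd, Joins.of_parallel h hA hB hX hY hd hd'⟩
    rcases eq_or_ne e d' with rfl | h2
    · rw [hσdef, Equiv.swap_apply_right]
      exact ⟨Joins.of_parallel h hA hB hX hY hd hd', Joins.of_parallel h hA hB hX hY hd' hd⟩
    rw [hσdef, Equiv.swap_apply_of_ne_of_ne h1 h2]
  have hinv : ∀ C : Finset E, (C.map σ.toEmbedding).map σ.toEmbedding = C := by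
    intro C
    ext e
    simp [σ, Finset.mem_map_equiv]
  have hmem : ∀ C : Finset E, ePlus ∈ C.map σ.toEmbedding ↔ ePlus ∈ C := by
    intro C
    rw [Finset.mem_map_equiv, hσdef, Equiv.symm_swap, Equiv.swap_apply_of_ne_of_ne hpd hpd']
  have hiff : ∀ C : Finset E, (IsSpanningCycle ends N (C.map σ.toEmbedding) ∧
      ePlus ∈ C.map σ.toEmbedding) ↔ (IsSpanningCycle ends N C ∧ ePlus ∈ C) := by
    intro C
    rw [hmem]
    refine and_congr_left fun _ => ⟨fun hC => ?_, fun hC => hC.map h hσ⟩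
    have := hC.map h hσ
    rwa [hinv] at this
  obtain ⟨c, hc⟩ := hν
  have hval : ∀ C : Finset E, ν (C.map σ.toEmbedding) = ν C := by
    intro C
    by_cases hC : IsSpanningCycle ends N C ∧ ePlus ∈ C
    · rw [(hc C).1 hC, (hc _).1 ((hiff C).2 hC)]
    · rw [(hc C).2 hC, (hc _).2 fun h' => hC ((hiff C).1 h')]
  rw [prob_eq_sum, prob_eq_sum]
  refine Fintype.sum_equiv (Equiv.finsetCongr σ) _ _ fun C => ?_
  rw [Equiv.finsetCongr_apply, hval]

theorem mem_iff_notMem_of_card_inter_eq_one {C J : Finset E} {d d' : E} (hdd : d ≠ d')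
    (hJ : J = {d, d'}) (h : (C ∩ J).card = 1) : d ∈ C ↔ d' ∉ C := by
  rw [card_inter_eq_sum, hJ, Finset.sum_pair hdd] at h
  by_cases h1 : d ∈ C <;> by_cases h2 : d' ∈ C <;> simp [h1, h2] at h ⊢

theorem exists_parallel {A B : Finset V} {d : E} (hd : Joins ends A B d)
    (h : edgeCount ends A B = 2) :
    ∃ d', d ≠ d' ∧ Joins ends A B d' ∧ Finset.univ.filter (Joins ends A B) = {d, d'} := by
  obtain ⟨x, y, hxy, hJ⟩ := Finset.card_eq_two.1 h
  have hmem : ∀ e, Joins ends A B e ↔ e = x ∨ e = y := by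
    intro e
    have := Finset.ext_iff.1 hJ e
    simpa using this
  rcases (hmem d).1 hd with rfl | rfl
  · exact ⟨y, hxy, (hmem y).2 (Or.inr rfl), hJ⟩
  · exact ⟨x, hxy.symm, (hmem x).2 (Or.inl rfl), by rw [hJ, Finset.pair_comm]⟩

theorem IsUniformCycle.half_le_prob_exactly_one (h : IsTightPartition ends N) (hN : 3 ≤ N.card)
    (hdbl : ∀ A ∈ N, ∀ B ∈ N, A ≠ B → edgeCount ends A B = 0 ∨ edgeCount ends A B = 2)
    (hν : IsUniformCycle ends N ePlus ν) {b d : E} (hb : b ∈ edgesBetween ends N)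
    (hd : d ∈ edgesBetween ends N) (hbd : b ≠ d) : 1 / 2 ≤ prob ν fun C => b ∈ C ↔ d ∉ C := by
  have hpair : ∀ e ∈ edgesBetween ends N, ∃ A ∈ N, ∃ B ∈ N, ∃ e', e ≠ e' ∧ Joins ends A B e ∧
      Joins ends A B e' ∧ (∀ f, Joins ends A B f → f = e ∨ f = e') ∧
      ∀ C ∈ ν.support, e ∈ C ↔ e' ∉ C := by
    intro e he
    obtain ⟨A, hA, B, hB, hAB, hJ⟩ := mem_edgesBetween.1 he
    have h2 : edgeCount ends A B = 2 := by
      refine (hdbl A hA B hB hAB).resolve_left fun h0 => ?_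
      rw [edgeCount, Finset.card_eq_zero] at h0
      exact Finset.notMem_empty e (h0 ▸ Finset.mem_filter.2 ⟨Finset.mem_univ _, hJ⟩)
    obtain ⟨e', hne, hJ', heq⟩ := exists_parallel hJ h2
    refine ⟨A, hA, B, hB, e', hne, hJ, hJ', fun f hf => ?_, fun C hC => mem_iff_notMem_of_card_inter_eq_one hne heq
      ((hν.isSpanningCycle hC).1.card_inter_joins h hN hdbl hA hB hAB h2)⟩
    have := Finset.mem_filter.2 ⟨Finset.mem_univ f, hf⟩
    rw [heq] at this
    simpa using this
  -- The swap of `d` and `d'` negates membership of `d` and fixes that of `b`; the event and its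
  -- complement are equally likely.
  have core : ∀ b d d' : E, ∀ A ∈ N, ∀ B ∈ N, Joins ends A B d → Joins ends A B d' →
      (∀ C ∈ ν.support, d ∈ C ↔ d' ∉ C) → b ≠ d → b ≠ d' → ePlus ≠ d → ePlus ≠ d' →
      1 / 2 ≤ prob ν fun C => b ∈ C ↔ d ∉ C := by
    intro b d d' A hA B hB hd hd' hx hbd hbd' hp hp'
    have h1 := hν.prob_map_swap h hA hB hd hd' hp hp' (fun C => b ∈ C ↔ d ∉ C)
    have h2 : prob ν (fun C => b ∈ C.map (Equiv.swap d d').toEmbedding ↔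
        d ∉ C.map (Equiv.swap d d').toEmbedding) = prob ν fun C => ¬ (b ∈ C ↔ d ∉ C) := by
      refine prob_congr fun C hC => ?_
      rw [Finset.mem_map_equiv, Finset.mem_map_equiv, Equiv.symm_swap,
        Equiv.swap_apply_of_ne_of_ne hbd hbd', Equiv.swap_apply_left]
      have := hx C hC
      tauto
    rw [h2, prob_not] at h1
    linarith
  obtain ⟨A, hA, B, hB, d', hdd, hJd, hJd', honly, hxd⟩ := hpair d hd
  obtain ⟨A', hA', B', hB', b', hbb, hJb, hJb', -, hxb⟩ := hpair b hb
  rcases eq_or_ne b d' with rfl | hbd'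
  · rw [prob_eq_one fun C hC => ?_]
    · norm_num
    · have := hxd C hC
      tauto
  rcases eq_or_ne d b' with rfl | hdb'
  · rw [prob_eq_one fun C hC => ?_]
    · norm_num
    · exact hxb C hC
  -- The forced edge `e⁺` belongs to at most one of the two parallel pairs; the swap is made in a
  -- pair that does not contain it.
  by_cases hp : ePlus ≠ d ∧ ePlus ≠ d'
  · exact core b d d' A hA B hB hJd hJd' hxd hbd hbd' hp.1 hp.2
  · rw [prob_congr (Q := fun C => d ∈ C ↔ b ∉ C) fun C _ => by tauto]
    refine core d b b' A' hA' B' hB' hJb hJb' hxb hbd.symm hdb' ?_ ?_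
    · rintro rfl
      exact hp ⟨hbd, hbd'⟩
    · rintro rfl
      refine hp ⟨hdb'.symm, ?_⟩
      rintro rfl
      rcases honly b (Joins.of_parallel h hA' hB' hA hB hJb' hJb hJd') with h1 | h1
      exacts [hbd h1, hbd' h1]

end RootCycle


/-! ### Pairs of edges in a critical cut -/

section CutParity

variable {V E : Type*} [Fintype V] [DecidableEq V] [Fintype E] [DecidableEq E]
variable {ends : E → Sym2 V} {ePlus : E} {L : List (Finset V)}
variable {μ : Finset V → PMF (Finset E)} {ν : PMF (Finset E)}

theorem IsSampling.mem_union_iff (h : IsSampling ends ePlus L μ ν) {R : Finset V} (hR : R ∈ L)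
    {T T' : Finset E} (hT : T ∈ (oneTreeLaw μ ν (L.erase R)).support) {e : E}
    (he : e ∈ edgesBetween ends (nodesIn L R)) : e ∈ T ∪ T' ↔ e ∈ T' := by
  rw [Finset.mem_union, or_iff_right fun h' => h.notMem_edgesBetween hR hT h' he]

theorem IsSampling.mem_union_iff_left (h : IsSampling ends ePlus L μ ν) {R : Finset V}
    (hR : R ∈ L) {T T' : Finset E} (hT' : T' ∈ (μ R).support) {e : E}
    (he : e ∉ edgesBetween ends (nodesIn L R)) : e ∈ T ∪ T' ↔ e ∈ T := by
  rw [Finset.mem_union, or_iff_left fun h' => he (((h.tree R hR).isSpanningTree hT').1 h')]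

theorem IsSampling.mem_union_iff_root (h : IsSampling ends ePlus L μ ν)
    {T C : Finset E} (hT : T ∈ (treesLaw μ L).support) {e : E}
    (he : e ∈ edgesBetween ends (currentNodes L)) : e ∈ T ∪ C ↔ e ∈ C := by
  rw [Finset.mem_union, or_iff_right fun h' => h.notMem_edgesBetween_root hT h' he]

theorem IsSampling.nonempty_nodesIn (h : IsSampling ends ePlus L μ ν) {R : Finset V}
    (hR : R ∈ L) : (nodesIn L R).Nonempty :=
  Finset.card_pos.1 (lt_trans Nat.zero_lt_one (one_lt_card_nodesIn (h.hier.two_le R hR)))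

theorem IsSampling.mem_edgesBetween_root (h : IsSampling ends ePlus L μ ν) {Q : Finset V}
    (hQ : Q ∈ currentNodes L) {e : E} (he : e ∈ cut ends Q) :
    e ∈ edgesBetween ends (currentNodes L) := by
  obtain ⟨B, hB, hBQ, hJ⟩ := ((h.hier.isTightPartition_currentNodes h.card).mem_cut_iff hQ).1 he
  exact mem_edgesBetween.2 ⟨Q, hQ, B, hB, hBQ.symm, hJ⟩

theorem IsSampling.half_le_prob_root (h : IsSampling ends ePlus L μ ν) {b d : E}
    (hb : b ∈ edgesBetween ends (currentNodes L)) (hd : d ∈ edgesBetween ends (currentNodes L))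
    (hbd : b ≠ d) : 1 / 2 ≤ prob (oneTreeLaw μ ν L) fun T => b ∈ T ↔ d ∉ T := by
  rw [oneTreeLaw_eq]
  refine le_prob_unionLaw fun T hT => ?_
  rw [prob_congr fun C _ => by rw [h.mem_union_iff_root hT hb, h.mem_union_iff_root hT hd]]
  exact h.cycle.half_le_prob_exactly_one (h.hier.isTightPartition_currentNodes h.card)
    (h.run.three_le_card_currentNodes h.graph h.card) h.root hb hd hbd

/-- Of two edges in a critical cut, exactly one is sampled with probability at least `1/2`. -/
theorem IsSampling.half_le_prob_exactly_one (h : IsSampling ends ePlus L μ ν) :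
    ∀ {Q : Finset V}, Q ∈ criticalSets L → ∀ {b d : E}, b ∈ cut ends Q → d ∈ cut ends Q → b ≠ d →
      1 / 2 ≤ prob (oneTreeLaw μ ν L) fun T => b ∈ T ↔ d ∉ T := by
  intro Q
  -- The induction climbs from `Q` to its parent, so it runs on the number of vertices outside.
  induction hn : Fintype.card V - Q.card using Nat.strong_induction_on generalizing Q with
  | _ n ih =>
  intro hQ b d hb hd hbd
  obtain ⟨R, hR, hQR⟩ := h.hier.exists_parent hQ
  rcases hR with hR | rfl
  · have hR2 := h.hier.two_le R hR
    have hdisj := h.hier.pairwiseDisjoint R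
    have hne := h.nonempty_nodesIn hR
    -- An edge of the level of `R` is a fair coin, independent of an edge of any other level.
    have one : ∀ b d, b ∈ edgesBetween ends (nodesIn L R) →
        d ∉ edgesBetween ends (nodesIn L R) →
        1 / 2 ≤ prob (oneTreeLaw μ ν L) fun T => b ∈ T ↔ d ∉ T := by
      intro b d hb hd
      rw [oneTreeLaw_erase hR]
      refine le_prob_unionLaw fun T hT => ?_
      rw [prob_congr fun T' hT' => by
        rw [h.mem_union_iff hR hT hb, h.mem_union_iff_left hR hT' hd]]
      have hm := (h.tree R hR).prob_mem hb
      by_cases hdT : d ∈ T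
      · rw [prob_congr (Q := fun F => ¬ b ∈ F) fun F _ => by simp [hdT], prob_not, hm]
        norm_num
      · rw [prob_congr (Q := fun F => b ∈ F) fun F _ => by simp [hdT], hm]
    by_cases hbR : b ∈ edgesBetween ends (nodesIn L R) <;>
      by_cases hdR : d ∈ edgesBetween ends (nodesIn L R)
    · rw [oneTreeLaw_erase hR]
      refine le_prob_unionLaw fun T hT => ?_
      rw [prob_congr fun T' _ => by rw [h.mem_union_iff hR hT hbR, h.mem_union_iff hR hT hdR]]
      exact (h.tree R hR).half_le_prob_exactly_one hdisj hne hbR hdR hbd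
    · exact one b d hbR hdR
    · rw [prob_congr (Q := fun T => d ∈ T ↔ b ∉ T) fun T _ => by tauto]
      exact one d b hdR hbR
    · have hlt := Finset.card_lt_card (mem_nodesIn.1 hQR).2.1
      have hle := Finset.card_le_univ R
      have hout : ∀ e ∈ cut ends Q, e ∉ edgesBetween ends (nodesIn L R) → e ∈ cut ends R :=
        fun e he he' => (mem_nodeStar_or_mem_cut hR2 hQR he).resolve_left
          fun h' => he' (nodeStar_subset hQR h')
      exact ih _ (by omega) rfl (mem_criticalSets.2 (Or.inl hR)) (hout b hb hbR) (hout d hd hdR) hbd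
  · exact h.half_le_prob_root (h.mem_edgesBetween_root hQR hb) (h.mem_edgesBetween_root hQR hd) hbd

/-- The outside `Rᶜ` is itself a node of the local graph, so the dichotomy bounds this multiplicity.
-/
theorem IsSampling.edgeCount_compl_le_two (h : IsSampling ends ePlus L μ ν) {R Q : Finset V}
    (hR : R ∈ L) (hQ : Q ∈ nodesIn L R) : edgeCount ends Q Rᶜ ≤ 2 := by
  have hQl := nodesIn_subset_localNodes h.hier (Or.inl hR) hQ
  have hRl := (mem_localNodes h.hier hR).2 (Or.inl rfl)
  have hne : Q ≠ Rᶜ := by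
    rintro rfl
    obtain ⟨v, hv⟩ := h.hier.nonempty _ (mem_nodesIn.1 hQ).1
    exact Finset.mem_compl.1 hv ((mem_nodesIn.1 hQ).2.1.1 hv)
  rcases h.run.dichotomy h.graph h.card hR with h' | h'
  · exact (h' Q hQl Rᶜ hRl hne).trans one_le_two
  · rcases h' Q hQl Rᶜ hRl hne with h' | h' <;> omega

/-- Three edges of the level of `R` and one edge outside. -/
theorem IsSampling.prob_pairs_of_one_notMem (h : IsSampling ends ePlus L μ ν) {R : Finset V}
    (hR : R ∈ L) {a b c d : E} (ha : a ∈ edgesBetween ends (nodesIn L R))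
    (hb : b ∈ edgesBetween ends (nodesIn L R)) (hc : c ∈ edgesBetween ends (nodesIn L R))
    (hd : d ∉ edgesBetween ends (nodesIn L R)) (hab : a ≠ b)
    (hD : ∀ F ∈ (μ R).support, a ∈ F ∨ b ∈ F ∨ c ∈ F) :
    1 / 27 ≤ prob (oneTreeLaw μ ν L) fun T => (a ∈ T ↔ b ∉ T) ∧ (c ∈ T ↔ d ∉ T) := by
  have hdisj := h.hier.pairwiseDisjoint R
  have hne := h.nonempty_nodesIn hR
  have htree := h.tree R hR
  rw [oneTreeLaw_erase hR]
  refine le_prob_unionLaw fun T hT => ?_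
  rw [prob_congr fun T' hT' => by
    rw [h.mem_union_iff hR hT ha, h.mem_union_iff hR hT hb, h.mem_union_iff hR hT hc,
      h.mem_union_iff_left hR hT' hd]]
  -- The outer sample decides `d`, and `c` is required to do the opposite.
  by_cases hdT : d ∈ T
  · rw [prob_congr (Q := fun F => (a ∈ F ↔ b ∉ F) ∧ c ∉ F) fun F _ => by simp [hdT]]
    have := htree.three_edges_notMem hdisj hne ha hb hc hab hD
    linarith
  · rw [prob_congr (Q := fun F => (a ∈ F ↔ b ∉ F) ∧ c ∈ F) fun F _ => by simp [hdT]]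
    have := htree.three_edges_mem hdisj hne ha hb hc hab hD
    linarith

/-- A pair of edges of the level of `R` and a pair of edges outside. -/
theorem IsSampling.prob_pairs_of_pair_notMem (h : IsSampling ends ePlus L μ ν) {R Q : Finset V}
    (hR : R ∈ L) (hQ : Q ∈ criticalSets L) {a b c d : E} (hcQ : c ∈ cut ends Q)
    (hdQ : d ∈ cut ends Q) (ha : a ∈ edgesBetween ends (nodesIn L R))
    (hb : b ∈ edgesBetween ends (nodesIn L R)) (hc : c ∉ edgesBetween ends (nodesIn L R))
    (hd : d ∉ edgesBetween ends (nodesIn L R)) (hab : a ≠ b) (hcd : c ≠ d) :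
    1 / 27 ≤ prob (oneTreeLaw μ ν L) fun T => (a ∈ T ↔ b ∉ T) ∧ (c ∈ T ↔ d ∉ T) := by
  have hdisj := h.hier.pairwiseDisjoint R
  have hne := h.nonempty_nodesIn hR
  have htree := h.tree R hR
  have hg := h.half_le_prob_exactly_one hQ hcQ hdQ hcd
  rw [oneTreeLaw_erase hR] at hg ⊢
  rw [prob_unionLaw_left (G := fun T => c ∈ T ↔ d ∉ T) fun T _ T' hT' => by
    rw [h.mem_union_iff_left hR hT' hc, h.mem_union_iff_left hR hT' hd]] at hg
  -- Each pair succeeds with probability at least `1/2`, independently of the other.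
  have := mul_le_prob_unionLaw (p := oneTreeLaw μ ν (L.erase R)) (q := μ R)
    (G := fun T => c ∈ T ↔ d ∉ T) (P := fun T => (a ∈ T ↔ b ∉ T) ∧ (c ∈ T ↔ d ∉ T))
    (c := 1 / 2) fun T hT hG => by
      rw [prob_congr (Q := fun T' => a ∈ T' ↔ b ∉ T') fun T' hT' => by
        rw [h.mem_union_iff hR hT ha, h.mem_union_iff hR hT hb,
          h.mem_union_iff_left hR hT' hc, h.mem_union_iff_left hR hT' hd, and_iff_left hG]]
      exact htree.half_le_prob_exactly_one hdisj hne ha hb hab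
  linarith

/-- Two pairs, each of one edge of the level of `R` and one edge outside. -/
theorem IsSampling.prob_pairs_of_mixed (h : IsSampling ends ePlus L μ ν) {R Q : Finset V}
    (hR : R ∈ L) (hQ : Q ∈ criticalSets L) {a b c d : E} (hbQ : b ∈ cut ends Q)
    (hdQ : d ∈ cut ends Q) (ha : a ∈ edgesBetween ends (nodesIn L R))
    (hc : c ∈ edgesBetween ends (nodesIn L R)) (hb : b ∉ edgesBetween ends (nodesIn L R))
    (hd : d ∉ edgesBetween ends (nodesIn L R)) (hac : a ≠ c) (hbd : b ≠ d) :
    1 / 27 ≤ prob (oneTreeLaw μ ν L) fun T => (a ∈ T ↔ b ∉ T) ∧ (c ∈ T ↔ d ∉ T) := by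
  have hdisj := h.hier.pairwiseDisjoint R
  have hne := h.nonempty_nodesIn hR
  have htree := h.tree R hR
  have hg := h.half_le_prob_exactly_one hQ hbQ hdQ hbd
  rw [oneTreeLaw_erase hR] at hg ⊢
  rw [prob_unionLaw_left (G := fun T => b ∈ T ↔ d ∉ T) fun T _ T' hT' => by
    rw [h.mem_union_iff_left hR hT' hb, h.mem_union_iff_left hR hT' hd]] at hg
  -- If exactly one of `b`, `d` is present, then exactly one prescribed edge of `a`, `c` has to be
  -- present without the other; this has probability at least `1/2 - 1/4`.
  have := mul_le_prob_unionLaw (p := oneTreeLaw μ ν (L.erase R)) (q := μ R)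
    (G := fun T => b ∈ T ↔ d ∉ T) (P := fun T => (a ∈ T ↔ b ∉ T) ∧ (c ∈ T ↔ d ∉ T))
    (c := 1 / 4) fun T hT hG => by
      rw [prob_congr fun T' hT' => by
        rw [h.mem_union_iff hR hT ha, h.mem_union_iff hR hT hc,
          h.mem_union_iff_left hR hT' hb, h.mem_union_iff_left hR hT' hd]]
      have hle := htree.prob_mem_mem_le hdisj hne hac ha hc
      have hma := htree.prob_mem ha
      have hmc := htree.prob_mem hc
      by_cases hbT : b ∈ T
      · have hdT := hG.1 hbT
        rw [prob_congr (Q := fun F => c ∈ F ∧ ¬ a ∈ F) fun F _ => by simp [hbT, hdT, and_comm]]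
        have := prob_split (μ R) (fun F => c ∈ F) (fun F => a ∈ F)
        rw [prob_congr (Q := fun F => a ∈ F ∧ c ∈ F) (P := fun F => c ∈ F ∧ a ∈ F)
          fun F _ => and_comm] at this
        linarith
      · have hdT := not_not.1 (mt hG.2 hbT)
        rw [prob_congr (Q := fun F => a ∈ F ∧ ¬ c ∈ F) fun F _ => by simp [hbT, hdT]]
        have := prob_split (μ R) (fun F => a ∈ F) (fun F => c ∈ F)
        linarith
  linarith

/-- If the edges of a critical cut are paired in any way, then with probability at least `1/27`
exactly one edge of each pair is sampled. -/
theorem IsSampling.prob_exactly_one_of_each_pair (h : IsSampling ends ePlus L μ ν) {Q : Finset V}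
    (hQ : Q ∈ criticalSets L) {a b c d : E} (hab : a ≠ b) (hac : a ≠ c) (had : a ≠ d)
    (hbc : b ≠ c) (hbd : b ≠ d) (hcd : c ≠ d) (hcut : cut ends Q = {a, b, c, d}) :
    1 / 27 ≤ prob (oneTreeLaw μ ν L) fun T => (a ∈ T ↔ b ∉ T) ∧ (c ∈ T ↔ d ∉ T) := by
  have swap₁ : ∀ a b c d : E, prob (oneTreeLaw μ ν L)
      (fun T => (a ∈ T ↔ b ∉ T) ∧ (c ∈ T ↔ d ∉ T)) = prob (oneTreeLaw μ ν L)
      (fun T => (b ∈ T ↔ a ∉ T) ∧ (c ∈ T ↔ d ∉ T)) :=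
    fun a b c d => prob_congr fun T _ => by tauto
  have swap₂ : ∀ a b c d : E, prob (oneTreeLaw μ ν L)
      (fun T => (a ∈ T ↔ b ∉ T) ∧ (c ∈ T ↔ d ∉ T)) = prob (oneTreeLaw μ ν L)
      (fun T => (a ∈ T ↔ b ∉ T) ∧ (d ∈ T ↔ c ∉ T)) :=
    fun a b c d => prob_congr fun T _ => by tauto
  have swap₃ : ∀ a b c d : E, prob (oneTreeLaw μ ν L)
      (fun T => (a ∈ T ↔ b ∉ T) ∧ (c ∈ T ↔ d ∉ T)) = prob (oneTreeLaw μ ν L)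
      (fun T => (c ∈ T ↔ d ∉ T) ∧ (a ∈ T ↔ b ∉ T)) :=
    fun a b c d => prob_congr fun T _ => and_comm
  have ha : a ∈ cut ends Q := by simp [hcut]
  have hb : b ∈ cut ends Q := by simp [hcut]
  have hc : c ∈ cut ends Q := by simp [hcut]
  have hd : d ∈ cut ends Q := by simp [hcut]
  obtain ⟨R, hR, hQR⟩ := h.hier.exists_parent hQ
  rcases hR with hR | rfl
  · have hR2 := h.hier.two_le R hR
    have hdisj := h.hier.pairwiseDisjoint R
    have hne := h.nonempty_nodesIn hR
    have htree := h.tree R hR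
    have hout : ∀ e ∈ cut ends Q, e ∉ edgesBetween ends (nodesIn L R) →
        e ∈ cut ends Q ∩ cut ends R :=
      fun e he he' => Finset.mem_inter.2 ⟨he, (mem_nodeStar_or_mem_cut hR2 hQR he).resolve_left
        fun h' => he' (nodeStar_subset hQR h')⟩
    -- At most two edges of the cut leave `R`, so at least two of the four belong to the level of
    -- `R`.
    have hthree : ∀ x ∈ cut ends Q, ∀ y ∈ cut ends Q, ∀ z ∈ cut ends Q, x ≠ y → x ≠ z → y ≠ z →
        x ∉ edgesBetween ends (nodesIn L R) → y ∉ edgesBetween ends (nodesIn L R) →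
        z ∉ edgesBetween ends (nodesIn L R) → False := by
      intro x hx y hy z hz hxy hxz hyz hx' hy' hz'
      have hle := h.edgeCount_compl_le_two hR hQR
      rw [edgeCount, ← cut_inter_cut hQR] at hle
      have : ({x, y, z} : Finset E) ⊆ cut ends Q ∩ cut ends R := by
        intro e he
        simp only [Finset.mem_insert, Finset.mem_singleton] at he
        rcases he with rfl | rfl | rfl
        exacts [hout _ hx hx', hout _ hy hy', hout _ hz hz']
      have := Finset.card_le_card this
      rw [Finset.card_eq_three.2 ⟨x, y, z, hxy, hxz, hyz, rfl⟩] at this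
      omega
    obtain ⟨B, hB, hBQ⟩ := Finset.exists_mem_ne (one_lt_card_nodesIn (L := L) hR2) Q
    have hD : ∀ F ∈ (μ R).support, ∃ e ∈ F, e ∈ edgesBetween ends (nodesIn L R) ∧
        (e = a ∨ e = b ∨ e = c ∨ e = d) := by
      intro F hF
      obtain ⟨e, heF, he⟩ := (htree.isSpanningTree hF).exists_mem_nodeStar hQR hB hBQ.symm
      refine ⟨e, heF, nodeStar_subset hQR he, ?_⟩
      have := h.hier.nodeStar_subset_cut hQR he
      simpa [hcut] using this
    have hD3 : ∀ x y z t : E, t ∉ edgesBetween ends (nodesIn L R) →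
        (∀ e, e = a ∨ e = b ∨ e = c ∨ e = d → e = x ∨ e = y ∨ e = z ∨ e = t) →
        ∀ F ∈ (μ R).support, x ∈ F ∨ y ∈ F ∨ z ∈ F := by
      intro x y z t ht hall F hF
      obtain ⟨e, heF, hee, he⟩ := hD F hF
      rcases hall e he with rfl | rfl | rfl | rfl
      · exact Or.inl heF
      · exact Or.inr (Or.inl heF)
      · exact Or.inr (Or.inr heF)
      · exact absurd hee ht
    by_cases ea : a ∈ edgesBetween ends (nodesIn L R) <;>
      by_cases eb : b ∈ edgesBetween ends (nodesIn L R) <;>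
      by_cases ec : c ∈ edgesBetween ends (nodesIn L R) <;>
      by_cases ed : d ∈ edgesBetween ends (nodesIn L R)
    · rw [oneTreeLaw_erase hR]
      refine le_prob_unionLaw fun T hT => ?_
      rw [prob_congr fun T' _ => by
        rw [h.mem_union_iff hR hT ea, h.mem_union_iff hR hT eb, h.mem_union_iff hR hT ec,
          h.mem_union_iff hR hT ed]]
      have := htree.pairs_of_four hdisj hne ea eb ec ed hab hac had hbc hbd hcd fun F hF => by
        obtain ⟨e, heF, -, rfl | rfl | rfl | rfl⟩ := hD F hF <;> simp [heF]
      linarith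
    · exact h.prob_pairs_of_one_notMem hR ea eb ec ed hab
        (hD3 a b c d ed (by rintro e (rfl | rfl | rfl | rfl) <;> simp))
    · rw [swap₂]
      exact h.prob_pairs_of_one_notMem hR ea eb ed ec hab
        (hD3 a b d c ec (by rintro e (rfl | rfl | rfl | rfl) <;> simp))
    · exact h.prob_pairs_of_pair_notMem hR hQ hc hd ea eb ec ed hab hcd
    · rw [swap₃]
      exact h.prob_pairs_of_one_notMem hR ec ed ea eb hcd
        (hD3 c d a b eb (by rintro e (rfl | rfl | rfl | rfl) <;> simp))
    · exact h.prob_pairs_of_mixed hR hQ hb hd ea ec eb ed hac hbd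
    · rw [swap₂]
      exact h.prob_pairs_of_mixed hR hQ hb hc ea ed eb ec had hbc
    · exact (hthree b hb c hc d hd hbc hbd hcd eb ec ed).elim
    · rw [swap₃, swap₂]
      exact h.prob_pairs_of_one_notMem hR ec ed eb ea hcd
        (hD3 c d b a ea (by rintro e (rfl | rfl | rfl | rfl) <;> simp))
    · rw [swap₁]
      exact h.prob_pairs_of_mixed hR hQ ha hd eb ec ea ed hbc had
    · rw [swap₁, swap₂]
      exact h.prob_pairs_of_mixed hR hQ ha hc eb ed ea ec hbd hac
    · exact (hthree a ha c hc d hd hac had hcd ea ec ed).elim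
    · rw [swap₃]
      exact h.prob_pairs_of_pair_notMem hR hQ ha hb ec ed ea eb hcd hab
    · exact (hthree a ha b hb d hd hab had hbd ea eb ed).elim
    · exact (hthree a ha b hb c hc hab hac hbc ea eb ec).elim
    · exact (hthree a ha b hb c hc hab hac hbc ea eb ec).elim
  · have hedge := fun {e} (he : e ∈ cut ends Q) => h.mem_edgesBetween_root hQR he
    have hg := h.half_le_prob_root (hedge ha) (hedge hb) hab
    -- The root cycle uses exactly two of the four edges, so success for one pair forces success for
    -- the other.
    have hle : prob (oneTreeLaw μ ν L) (fun T => a ∈ T ↔ b ∉ T) ≤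
        prob (oneTreeLaw μ ν L) fun T => (a ∈ T ↔ b ∉ T) ∧ (c ∈ T ↔ d ∉ T) := by
      refine prob_mono fun T hT hx => ⟨hx, ?_⟩
      rw [oneTreeLaw_eq] at hT
      obtain ⟨T₀, hT₀, C, hC, rfl⟩ := mem_support_unionLaw.1 hT
      rw [h.mem_union_iff_root hT₀ (hedge ha), h.mem_union_iff_root hT₀ (hedge hb)] at hx
      rw [h.mem_union_iff_root hT₀ (hedge hc), h.mem_union_iff_root hT₀ (hedge hd)]
      have h2 := (h.cycle.isSpanningCycle hC).1.2.2 Q hQR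
      rw [card_inter_eq_sum, hcut, Finset.sum_insert (by simp [hab, hac, had]),
        Finset.sum_insert (by simp [hbc, hbd]), Finset.sum_pair hcd] at h2
      by_cases h1 : a ∈ C <;> by_cases h3 : b ∈ C <;> by_cases h4 : c ∈ C <;>
        by_cases h5 : d ∈ C <;> simp [h1, h3, h4, h5] at h2 hx ⊢
    linarith

end CutParity


/-! ### Edges that are even at last -/

section EvenAtLast

variable {V E : Type*} [Fintype V] [DecidableEq V] [Fintype E] [DecidableEq E]
variable {ends : E → Sym2 V} {ePlus : E} {L : List (Finset V)}
variable {μ : Finset V → PMF (Finset E)} {ν : PMF (Finset E)}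

theorem IsSampling.isTightPartition_localNodes (h : IsSampling ends ePlus L μ ν) {R : Finset V}
    (hR : R ∈ L ∨ R = Finset.univ) : IsTightPartition ends (localNodes L R) := by
  rcases hR with hR | rfl
  · exact h.hier.isTightPartition_localNodes hR
  · rw [localNodes_univ h.hier]
    exact h.hier.isTightPartition_currentNodes h.card

/-- Covers bottom and top edges at once. For a bottom edge, even cuts at all nodes make every cut of
the local graph even, minimum or not. -/
theorem IsSampling.evenAtLast (h : IsSampling ends ePlus L μ ν) {R A B : Finset V}
    (hR : R ∈ L ∨ R = Finset.univ) (hA : A ∈ nodesIn L R) (hB : B ∈ nodesIn L R) (hAB : A ≠ B)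
    {e : E} (he : Joins ends A B e) {T : Finset E} (hTA : IsEvenCut ends T A)
    (hTB : IsEvenCut ends T B)
    (hT : IsDoubledCycle ends (localNodes L R) → ∀ C ∈ localNodes L R, IsEvenCut ends T C) :
    EvenAtLast ends L e T := by
  obtain ⟨a, ha, b, hb, hab⟩ := he
  exact ⟨a, b, A, B, R, hab, h.hier.isHighest hR hA hB hAB ha hb,
    h.hier.isHighest hR hB hA hAB.symm hb ha, h.hier.isLowestCommon hR hA hB,
    fun hd X hX _ _ => (h.isTightPartition_localNodes hR).isEvenCut_of_forall (hT hd) hX,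
    fun _ => ⟨hTA, hTB⟩⟩

theorem odd_card_inter_pair {T J : Finset E} {x y : E} (hxy : x ≠ y) (hJ : J = {x, y})
    (h : x ∈ T ↔ y ∉ T) : Odd (T ∩ J).card := by
  rw [card_inter_eq_sum, hJ, Finset.sum_pair hxy]
  by_cases hx : x ∈ T
  · simp [hx, h.1 hx]
  · simp [hx, not_not.1 (mt h.2 hx)]

/-- At the root any edge of the cut works with certainty: the cycle meets each node cut in two
edges, and no tree contributes to it. -/
theorem IsSampling.exists_evenAtLast_of_root (h : IsSampling ends ePlus L μ ν) {S : Finset V}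
    (hS : S ∈ currentNodes L) :
    ∃ e ∈ cut ends S, 1 / 27 ≤ prob (oneTreeLaw μ ν L) (EvenAtLast ends L e) := by
  have hP := h.hier.isTightPartition_currentNodes h.card
  have hcard : (cut ends S).card = 4 := hP.tight S hS
  obtain ⟨e, he⟩ := Finset.card_pos.1 (by omega : 0 < (cut ends S).card)
  obtain ⟨B, hB, hBS, hJ⟩ := (hP.mem_cut_iff hS).1 he
  refine ⟨e, he, ?_⟩
  have heven : ∀ T ∈ (oneTreeLaw μ ν L).support, ∀ A ∈ currentNodes L, IsEvenCut ends T A := by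
    intro T hT A hA
    rw [oneTreeLaw_eq] at hT
    obtain ⟨T₀, hT₀, C, hC, rfl⟩ := mem_support_unionLaw.1 hT
    have : (T₀ ∪ C) ∩ cut ends A = C ∩ cut ends A := by
      ext f
      rw [Finset.mem_inter, Finset.mem_inter]
      exact and_congr_left fun hf => h.mem_union_iff_root hT₀ (h.mem_edgesBetween_root hA hf)
    rw [IsEvenCut, this, (h.cycle.isSpanningCycle hC).1.2.2 A hA]
    exact even_two
  rw [prob_eq_one fun T hT => h.evenAtLast (Or.inr rfl) hS hB hBS.symm hJ (heven T hT S hS)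
    (heven T hT B hB) fun _ C hC => heven T hT C (by rwa [localNodes_univ h.hier] at hC)]
  norm_num

/-- In the local graph of a doubled cycle, all nodes have even cuts with probability at least
`1/27`. -/
theorem IsSampling.prob_forall_isEvenCut (h : IsSampling ends ePlus L μ ν) {R : Finset V}
    (hR : R ∈ L) (hdbl : ∀ A ∈ localNodes L R, ∀ B ∈ localNodes L R, A ≠ B →
      edgeCount ends A B = 0 ∨ edgeCount ends A B = 2) :
    1 / 27 ≤ prob (oneTreeLaw μ ν L) fun T => ∀ A ∈ localNodes L R, IsEvenCut ends T A := by
  have hP := h.hier.isTightPartition_localNodes hR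
  have hRl : Rᶜ ∈ localNodes L R := (mem_localNodes h.hier hR).2 (Or.inl rfl)
  have hRc := mem_criticalSets.2 (Or.inl hR)
  have hcard : (cut ends Rᶜ).card = 4 := hP.tight _ hRl
  obtain ⟨a, ha⟩ := Finset.card_pos.1 (by omega : 0 < (cut ends Rᶜ).card)
  obtain ⟨B, hB, hBR, hJa⟩ := (hP.mem_cut_iff hRl).1 ha
  have hB2 : edgeCount ends Rᶜ B = 2 := by
    refine (hdbl _ hRl B hB hBR.symm).resolve_left fun h0 => ?_
    rw [edgeCount, Finset.card_eq_zero] at h0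
    exact Finset.notMem_empty a (h0 ▸ Finset.mem_filter.2 ⟨Finset.mem_univ _, hJa⟩)
  -- The four edges leaving `R` are two parallel pairs, to the nodes `B` and `C`.
  obtain ⟨-, C, hC, hCR, hCB, hC2⟩ := hP.exists_next h.graph (h.hier.three_le_card_localNodes hR)
    (h.run.allCrossed_localNodes h.graph h.card hR) hRl hB hBR.symm hB2.ge
  obtain ⟨b, hab, hJb, hBJ⟩ := exists_parallel hJa hB2
  obtain ⟨c, d, hcd, hCJ⟩ := Finset.card_eq_two.1 hC2
  have hJc : Joins ends Rᶜ C c := by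
    have : c ∈ Finset.univ.filter (Joins ends Rᶜ C) := by simp [hCJ]
    simpa using this
  have hJd : Joins ends Rᶜ C d := by
    have : d ∈ Finset.univ.filter (Joins ends Rᶜ C) := by simp [hCJ]
    simpa using this
  have hne : ∀ {x y}, Joins ends Rᶜ B x → Joins ends Rᶜ C y → x ≠ y := by
    rintro x y hx hy rfl
    exact not_joins_and_joins (hP.disjoint hRl hB hBR.symm) (hP.disjoint hB hC hCB.symm) hx hy
  have hac := hne hJa hJc
  have had := hne hJa hJd
  have hbc := hne hJb hJc
  have hbd := hne hJb hJd
  have hcut : cut ends Rᶜ = {a, b, c, d} := by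
    refine (Finset.eq_of_subset_of_card_le ?_ ?_).symm
    · intro x hx
      simp only [Finset.mem_insert, Finset.mem_singleton] at hx
      rcases hx with rfl | rfl | rfl | rfl
      exacts [ha, (hP.mem_cut_iff hRl).2 ⟨B, hB, hBR, hJb⟩,
        (hP.mem_cut_iff hRl).2 ⟨C, hC, hCR, hJc⟩, (hP.mem_cut_iff hRl).2 ⟨C, hC, hCR, hJd⟩]
    · rw [hcard, Finset.card_insert_of_notMem (by simp [hab, hac, had]),
        Finset.card_insert_of_notMem (by simp [hbc, hbd]), Finset.card_pair hcd]
  refine (h.prob_exactly_one_of_each_pair hRc hab hac had hbc hbd hcd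
    (by rw [← cut_compl, hcut])).trans (prob_mono fun T hT hx => ?_)
  have hodd : ∀ A ∈ localNodes L R, Rᶜ ≠ A → edgeCount ends Rᶜ A = 2 →
      Odd (T ∩ Finset.univ.filter (Joins ends Rᶜ A)).card := by
    intro A hA hRA h2
    obtain ⟨x, hx'⟩ := Finset.card_pos.1 (by rw [← edgeCount]; omega :
      0 < (Finset.univ.filter (Joins ends Rᶜ A)).card)
    have hJx : Joins ends Rᶜ A x := by simpa using hx'
    have hmem := (hP.mem_cut_iff hRl).2 ⟨A, hA, hRA.symm, hJx⟩
    have huniq : ∀ {D}, D ∈ localNodes L R → Rᶜ ≠ D → Joins ends Rᶜ D x → A = D := by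
      intro D hD hRD hJ
      rcases Joins.unique hP.disj hRl hD hRl hA hJ hJx with ⟨-, h'⟩ | ⟨h', -⟩
      exacts [h', absurd h' hRD]
    have hABC : A = B ∨ A = C := by
      rw [hcut] at hmem
      simp only [Finset.mem_insert, Finset.mem_singleton] at hmem
      rcases hmem with rfl | rfl | rfl | rfl
      exacts [Or.inl (huniq hB hBR.symm hJa), Or.inl (huniq hB hBR.symm hJb),
        Or.inr (huniq hC hCR.symm hJc), Or.inr (huniq hC hCR.symm hJd)]
    rcases hABC with rfl | rfl
    exacts [odd_card_inter_pair hab hBJ hx.1, odd_card_inter_pair hcd hCJ hx.2]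
  intro A hA
  refine hP.even_inter_cut hdbl hA fun D hD hAD h2 => ?_
  rcases (mem_localNodes h.hier hR).1 hA with rfl | hA'
  · exact hodd D hD hAD h2
  rcases (mem_localNodes h.hier hR).1 hD with rfl | hD'
  · rw [edgeCount_comm] at h2
    simp only [joins_comm (A := A)]
    exact hodd A hA hAD.symm h2
  -- Parallel pairs inside `R` need no luck: the tree contains exactly one edge of each.
  rw [oneTreeLaw_erase hR] at hT
  obtain ⟨T₀, hT₀, F, hF, rfl⟩ := mem_support_unionLaw.1 hT
  obtain ⟨x, y, hxy, hJ⟩ := Finset.card_eq_two.1 h2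
  have hmem : ∀ z, z = x ∨ z = y → Joins ends A D z := by
    intro z hz
    have : z ∈ Finset.univ.filter (Joins ends A D) := by simpa [hJ] using hz
    simpa using this
  have hbetween : ∀ z, z = x ∨ z = y → z ∈ edgesBetween ends (nodesIn L R) :=
    fun z hz => mem_edgesBetween.2 ⟨A, hA', D, hD', hAD, hmem z hz⟩
  refine odd_card_inter_pair hxy hJ ?_
  rw [h.mem_union_iff hR hT₀ (hbetween x (Or.inl rfl)),
    h.mem_union_iff hR hT₀ (hbetween y (Or.inr rfl))]
  exact (h.tree R hR).mem_iff_notMem_of_parallel (h.hier.pairwiseDisjoint R) hA' hD' hAD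
    (hmem x (Or.inl rfl)) (hmem y (Or.inr rfl)) hxy hF

theorem not_isDoubledCycle {N : Finset (Finset V)}
    (hle : ∀ A ∈ N, ∀ B ∈ N, A ≠ B → edgeCount ends A B ≤ 1) : ¬ IsDoubledCycle ends N := by
  rintro ⟨m, hm, f, hinj, hrange, hf⟩
  have : Fact (1 < m) := ⟨by omega⟩
  have hmem : ∀ i, f i ∈ N := fun i => by
    rw [← Finset.mem_coe, ← hrange]; exact Set.mem_range_self i
  have h1 := hle _ (hmem 0) _ (hmem 1) (hinj.ne zero_ne_one)
  have h2 := hf 0 1 zero_ne_one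
  rw [if_pos (Or.inl (zero_add 1).symm)] at h2
  rw [edgeCount] at h1
  omega

theorem IsSampling.even_card_union_inter_cut (h : IsSampling ends ePlus L μ ν) {R A : Finset V}
    (hR : R ∈ L) {T F : Finset E}
    (hT : T ∈ (oneTreeLaw μ ν (L.erase R)).support) (hF : F ∈ (μ R).support)
    (hpar : (F ∩ cut ends A).card % 2 = (T ∩ cut ends A).card % 2) :
    IsEvenCut ends (T ∪ F) A := by
  rw [IsEvenCut, Finset.union_inter_distrib_right, Finset.card_union_of_disjoint, Nat.even_iff]
  · omega
  · refine Finset.disjoint_left.2 fun x hx hx' => ?_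
    exact h.notMem_edgesBetween hR hT (Finset.mem_inter.1 hx).1
      (((h.tree R hR).isSpanningTree hF).1 (Finset.mem_inter.1 hx').1)

/-- The chosen edge `e` is the heaviest one from `S` to another node of `R`. With the outer sample
`T` fixed, the tree has to match the parities of `T` in the cuts of `S` and of the other end `B`.
Simplicity makes `e` the only edge at `S` that meets `B`, so exchanging it in flips the parity at
`B`. -/
theorem IsSampling.exists_evenAtLast_of_edgeCount_le_one (h : IsSampling ends ePlus L μ ν)
    {R S : Finset V} (hR : R ∈ L) (hS : S ∈ nodesIn L R)
    (hle : ∀ A ∈ localNodes L R, ∀ B ∈ localNodes L R, A ≠ B → edgeCount ends A B ≤ 1) :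
    ∃ e ∈ cut ends S, 1 / 27 ≤ prob (oneTreeLaw μ ν L) (EvenAtLast ends L e) := by
  have hR2 := h.hier.two_le R hR
  have hsub := nodesIn_subset_localNodes h.hier (Or.inl hR)
  have hP := h.hier.isTightPartition_localNodes hR
  have hSR : S ≠ Rᶜ := by
    rintro rfl
    obtain ⟨v, hv⟩ := h.hier.nonempty _ (mem_nodesIn.1 hS).1
    exact Finset.mem_compl.1 hv ((mem_nodesIn.1 hS).2.1.1 hv)
  have hext := hle S (hsub hS) Rᶜ ((mem_localNodes h.hier hR).2 (Or.inl rfl)) hSR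
  have hstar := h.hier.card_nodeStar hR2 hS
  obtain ⟨w, c₀, hw⟩ := (h.tree R hR).exists_isTreeLaw
  obtain ⟨e, he, hmax⟩ := Finset.exists_max_image (nodeStar ends (nodesIn L R) S) w
    (Finset.card_pos.1 (by omega))
  obtain ⟨B, hB, hSB, hJ⟩ := mem_nodeStar.1 he
  refine ⟨e, h.hier.nodeStar_subset_cut hS he, ?_⟩
  rw [oneTreeLaw_erase hR]
  refine le_prob_unionLaw fun T hT => ?_
  have heB : e ∈ cut ends B :=
    (hP.mem_cut_iff (hsub hB)).2 ⟨S, hsub hS, hSB, hJ.symm⟩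
  have hother : ∀ f ∈ nodeStar ends (nodesIn L R) S, f ≠ e → f ∉ cut ends B := by
    intro f hf hfe hfB
    obtain ⟨C, hC, hSC, s, hs, t, ht, hst⟩ := mem_nodeStar.1 hf
    have htB : t ∈ B := by
      rcases (mem_cut hst).1 hfB with ⟨hsB, -⟩ | ⟨-, htB⟩
      · exact absurd hsB (Finset.disjoint_left.1 (h.hier.nodes_disjoint hS hB hSB) hs)
      · exact htB
    have h2 := hle S (hsub hS) B (hsub hB) hSB
    refine absurd (Finset.card_le_one.1 h2 f ?_ e ?_) hfe
    · exact Finset.mem_filter.2 ⟨Finset.mem_univ _, s, hs, t, htB, hst⟩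
    · exact Finset.mem_filter.2 ⟨Finset.mem_univ _, hJ⟩
  -- At most one edge at `S` leaves `R`. If none does, `T` misses the cut of `S` altogether and the
  -- prescribed parity is even.
  have hcard : (nodeStar ends (nodesIn L R) S).card = 3 ∨
      (nodeStar ends (nodesIn L R) S).card = 4 ∧ (T ∩ cut ends S).card % 2 = 0 := by
    by_cases h0 : edgeCount ends S Rᶜ = 0
    · right
      refine ⟨by omega, ?_⟩
      have : T ∩ cut ends S = ∅ := by
        refine Finset.eq_empty_of_forall_notMem fun x hx => ?_
        obtain ⟨hxT, hxS⟩ := Finset.mem_inter.1 hx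
        rcases mem_nodeStar_or_mem_cut hR2 hS hxS with h' | h'
        · exact h.notMem_edgesBetween hR hT hxT (nodeStar_subset hS h')
        · have hx' := Finset.mem_inter.2 ⟨hxS, h'⟩
          rw [cut_inter_cut hS, Finset.card_eq_zero.1 h0] at hx'
          exact Finset.notMem_empty x hx'
      rw [this, Finset.card_empty]
    · left; omega
  refine ((h.tree R hR).prob_two_parities (h.hier.pairwiseDisjoint R) hw hS hB hSB hJ hmax hother
    heB (Nat.mod_lt _ two_pos) (Nat.mod_lt (T ∩ cut ends B).card two_pos) hcard).trans
    (prob_mono fun F hF hpar => ?_)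
  have hFS : F ∩ nodeStar ends (nodesIn L R) S = F ∩ cut ends S := by
    ext x
    rw [Finset.mem_inter, Finset.mem_inter]
    refine and_congr_right fun hx => ?_
    rw [h.hier.mem_nodeStar_iff hR2 hS]
    exact and_iff_left (((h.tree R hR).isSpanningTree hF).1 hx)
  rw [hFS] at hpar
  exact h.evenAtLast (Or.inl hR) hS hB hSB hJ (h.even_card_union_inter_cut hR hT hF hpar.1)
    (h.even_card_union_inter_cut hR hT hF hpar.2) fun hd => absurd hd (not_isDoubledCycle hle)

theorem IsSampling.exists_evenAtLast (h : IsSampling ends ePlus L μ ν) {S : Finset V}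
    (hS : S ∈ criticalSets L) :
    ∃ e ∈ cut ends S, 1 / 27 ≤ prob (oneTreeLaw μ ν L) (EvenAtLast ends L e) := by
  obtain ⟨R, hR, hSR⟩ := h.hier.exists_parent hS
  rcases hR with hR | rfl
  · rcases h.run.dichotomy h.graph h.card hR with hle | hdbl
    · exact h.exists_evenAtLast_of_edgeCount_le_one hR hSR hle
    · have hsub := nodesIn_subset_localNodes h.hier (Or.inl hR)
      have hcard := h.hier.card_nodeStar (h.hier.two_le R hR) hSR
      have hext := h.edgeCount_compl_le_two hR hSR
      -- At most two of the four edges leave `R`; in the doubled case any of the remaining ones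
      -- works.
      obtain ⟨e, he⟩ := Finset.card_pos.1
        (by omega : 0 < (nodeStar ends (nodesIn L R) S).card)
      obtain ⟨B, hB, hSB, hJ⟩ := mem_nodeStar.1 he
      exact ⟨e, h.hier.nodeStar_subset_cut hSR he, (h.prob_forall_isEvenCut hR hdbl).trans
        (prob_mono fun T _ hT => h.evenAtLast (Or.inl hR) hSR hB hSB hJ (hT S (hsub hSR))
          (hT B (hsub hB)) fun _ => hT)⟩
  · exact h.exists_evenAtLast_of_root hSR

end EvenAtLast

end HalfIntegralTSP

theorem mainTheorem4 {V E : Type*} [Fintype V] [DecidableEq V] [Fintype E] [DecidableEq E]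
    (x : Sym2 V → ℝ) (hx : HalfIntegralTSP.IsHalfIntegralHeldKarp x)
    (ends : E → Sym2 V) (hG : HalfIntegralTSP.IsSupportGraph x ends)
    (ePlus : E) (hePlus : x (ends ePlus) = 1)
    (L : List (Finset V)) (hL : HalfIntegralTSP.IsExecution ends ePlus L)
    (μ : Finset V → PMF (Finset E))
    (hμ : ∀ S ∈ L, HalfIntegralTSP.IsMaxEntropyTree ends (HalfIntegralTSP.nodesIn L S) (μ S))
    (ν : PMF (Finset E))
    (hν : HalfIntegralTSP.IsUniformCycle ends (HalfIntegralTSP.currentNodes L) ePlus ν)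
    (S : Finset V) (hS : S ∈ HalfIntegralTSP.criticalSets L) :
    ∃ e ∈ HalfIntegralTSP.cut ends S,
      (1 / 27 : ℝ≥0∞) ≤ (HalfIntegralTSP.oneTreeLaw μ ν L).toOuterMeasure
        {T | HalfIntegralTSP.EvenAtLast ends L e T} := by
  -- An end of `e⁺` shows that `V` is nonempty, and the degree condition then yields at least three
  -- vertices.
  obtain ⟨u, -⟩ : ∃ u v, ends ePlus = s(u, v) := by
    induction h : ends ePlus with | _ u v => exact ⟨u, v, rfl⟩
  have : Nonempty V := ⟨u⟩
  have hconn := hx.isFourConnected hG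
  have hcard := hx.three_le_card
  have h : HalfIntegralTSP.IsSampling ends ePlus L μ ν :=
    { graph := hconn
      card := hcard
      run := hL.1
      hier := hL.1.isHierarchy hconn hcard
      tree := hμ
      cycle := hν
      root := hL.doubled hconn hcard hx hG hePlus }
  obtain ⟨e, he, hprob⟩ := h.exists_evenAtLast hS
  refine ⟨e, he, HalfIntegralTSP.le_toOuterMeasure_of_le_prob ?_ ?_⟩
  · simpa using hprob
  · simp
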